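/- Let $T>0$ and let $(\Omega,\mathcal F,(\mathcal F_t)_{0\le t\le T},\mathbf P)$ be a filtered probability space satisfying the usual conditions (right-continuity; every $\mathbf P$-null set lies in every $\mathcal F_t$), with $\mathcal F_0$ $\mathbf P$-trivial and $\mathcal F_T=\mathcal F$. Let $S=(S_t)_{0\le t\le T}$ be an adapted process with càdlàg, strictly positive paths and $S_t\in L^1(\mathbf P)$ for all $t$, and let $0<\lambda<1$. For $0<\lambda'\le\lambda$ and $s\in[0,T]$, let $\mathrm{CPS}_{\mathrm{loc}}(s,T,\lambda')$ be the set of pairs $(\mathbf Q,\tilde S^{\mathbf Q})$ where $\mathbf Q$ is a probability measure on $\mathcal F_T$ equivalent to $\mathbf P$, $\tilde S^{\mathbf Q}$ is a càdlàg local $\mathbf Q$-martingale on $[s,T]$ (there are stopping times $s\le\tau_1\le\tau_2\le\dots$, a.s. eventually $\ge T$, such that each stopped process $(\tilde S^{\mathbf Q})^{\tau_n}$ is a $\mathbf Q$-martingale on $[s,T]$), and almost surely $(1-\lambda')S_u\le\tilde S^{\mathbf Q}_u\le(1+\lambda')S_u$ for all $u\in[s,T]$. Write $\mathrm{CPS}_{\mathrm{loc}}:=\mathrm{CPS}_{\mathrm{loc}}(s,T,\lambda)$,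 let $\mathcal Q_{\mathrm{loc}}$ be the set of measures $\mathbf Q$ occurring in some pair of $\mathrm{CPS}_{\mathrm{loc}}$, and let $L^1_+(\mathcal F_s,\mathcal Q_{\mathrm{loc}})$ be the set of $[0,\infty)$-valued $\mathcal F_s$-measurable random variables that are integrable under every $\mathbf Q\in\mathcal Q_{\mathrm{loc}}$. Assume that $\mathrm{CPS}_{\mathrm{loc}}(0,T,\lambda')\ne\emptyset$ for every $0<\lambda'\le\lambda$. Let $s\in[0,T]$ and let $X_T=(X_T^1,X_T^2)$ be an $\mathbb R^2$-valued $\mathcal F_T$-measurable random variable such that, almost surely, $$X_T^1+(X_T^2)^+(1-\lambda)S_T-(X_T^2)^-(1+\lambda)S_T\ge -M_s$$ for some $M_s\in L^1_+(\mathcal F_s,\mathcal Q_{\mathrm{loc}})$. For $t\in[s,T]$ and $(\mathbf Q,\tilde S^{\mathbf Q})\in\mathrm{CPS}_{\mathrm{loc}}$ put $$F_t^{\mathbf Q}:=\mathbb E_{\mathbf Q}\big[X_T^1+X_T^2\tilde S^{\mathbf Q}_T\mid\mathcal F_t\big],\qquad F_t:=\operatorname*{ess\,sup}_{(\mathbf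 Q,\tilde S^{\mathbf Q})\in\mathrm{CPS}_{\mathrm{loc}}}F_t^{\mathbf Q},$$ where the conditional expectation of $Y$ is understood as $\mathbb E_{\mathbf Q}[Y^+\mid\mathcal F_t]-\mathbb E_{\mathbf Q}[Y^-\mid\mathcal F_t]$ with values in $(-\infty,\infty]$. Then for every $\mathbf Q_0\in\mathcal Q_{\mathrm{loc}}$ and every $t\in[s,T]$ the negative parts of $F_t$ and of all $F_t^{\mathbf Q}$ are $\mathbf Q_0$-integrable, and $$\mathbb E_{\mathbf Q_0}[F_t]=\sup_{(\mathbf Q,\tilde S^{\mathbf Q})\in\mathrm{CPS}_{\mathrm{loc}}}\mathbb E_{\mathbf Q_0}\big[F_t^{\mathbf Q}\big]\in(-\infty,\infty].$$ -/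

import Mathlib

open MeasureTheory Filter Topology Set
open scoped ENNReal

/-! ## Extended-real expectations, conditional expectations and essential suprema -/

/-- The expectation `E[f⁺] - E[f⁻]` of an extended-real random variable (meaningful as soon as one
of the two terms is finite). -/
noncomputable def extExp {Ω : Type*} [MeasurableSpace Ω] (Q : Measure Ω) (f : Ω → EReal) : EReal :=
  ((∫⁻ ω, (f ω).toENNReal ∂Q : ℝ≥0∞) : EReal) - ((∫⁻ ω, (-f ω).toENNReal ∂Q : ℝ≥0∞) : EReal)

/-- The expectation of the negative part of `f` is finite, so that `extExp Q f` is a well-defined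
element of `(-∞, ∞]`. -/
def NegPartIntegrable {Ω : Type*} [MeasurableSpace Ω] (Q : Measure Ω) (f : Ω → EReal) : Prop :=
  ∫⁻ ω, (-f ω).toENNReal ∂Q < ∞

/-- The generalized conditional expectation `E_Q[Y⁺ | m] - E_Q[Y⁻ | m]` of a real random variable;
the conditional expectations of the nonnegative variables `Y⁺`, `Y⁻` take values in `[0, ∞]`. -/
noncomputable def extCondExp {Ω : Type*} [MeasurableSpace Ω] (Q : Measure Ω)
    (m : MeasurableSpace Ω) (Y : Ω → ℝ) : Ω → EReal := fun ω =>
  ((condLExp m Q (fun ω' => ENNReal.ofReal (Y ω')) ω : ℝ≥0∞) : EReal)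
    - ((condLExp m Q (fun ω' => ENNReal.ofReal (-Y ω')) ω : ℝ≥0∞) : EReal)

/-- `g` is (a version of) the essential supremum of the family `f` of random variables. -/
structure IsEssSup {Ω κ : Type*} [MeasurableSpace Ω] (P : Measure Ω) (f : κ → Ω → EReal)
    (g : Ω → EReal) : Prop where
  measurable : Measurable g
  le : ∀ k, f k ≤ᵐ[P] g
  least : ∀ h : Ω → EReal, Measurable h → (∀ k, f k ≤ᵐ[P] h) → g ≤ᵐ[P] h

open scoped Classical in
/-- The essential supremum of a family of random variables (a version of it; it exists for every
family of measurable functions, see `isEssSup_essSupFamily`). -/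
noncomputable def essSupFamily {Ω κ : Type*} [MeasurableSpace Ω] (P : Measure Ω)
    (f : κ → Ω → EReal) : Ω → EReal :=
  if h : ∃ g, IsEssSup P f g then h.choose else fun _ => ⊥

theorem isEssSup_essSupFamily {Ω κ : Type*} [MeasurableSpace Ω] (P : Measure Ω)
    [IsFiniteMeasure P] (f : κ → Ω → EReal) (hf : ∀ k, Measurable (f k)) :
    IsEssSup P f (essSupFamily P f) := by
  have key : ∃ g, IsEssSup P f g := by
    let φ : EReal → ℝ≥0∞ := fun x => (1 + EReal.exp x)⁻¹
    have hφanti : Antitone φ := fun a b hab =>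
      ENNReal.inv_le_inv.2 (add_le_add le_rfl (EReal.exp_monotone hab))
    have hφinj : Function.Injective φ := fun a b hab => by
      have h1 : 1 + EReal.exp a = 1 + EReal.exp b := inv_injective hab
      exact EReal.exp_strictMono.injective ((ENNReal.add_right_inj ENNReal.one_ne_top).1 h1)
    have hφm : Measurable φ := hφanti.measurable
    have hφ1 : ∀ x, φ x ≤ 1 := fun x => ENNReal.inv_le_one.2 le_self_add
    let G : Set κ → Ω → EReal := fun C ω => ⨆ k ∈ C, f k ω
    have hGm : ∀ C : Set κ, C.Countable → Measurable (G C) := fun C hC =>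
      Measurable.biSup C hC fun k _ => hf k
    let I : {C : Set κ // C.Countable} → ℝ≥0∞ := fun C => ∫⁻ ω, φ (G C.1 ω) ∂P
    have hne : Nonempty {C : Set κ // C.Countable} := ⟨⟨∅, countable_empty⟩⟩
    obtain ⟨u, -, hu, hmem⟩ :=
      exists_seq_tendsto_sInf (S := range I) (range_nonempty I) (OrderBot.bddBelow _)
    choose C hC using hmem
    let D : Set κ := ⋃ n, (C n).1
    have hD : D.Countable := countable_iUnion fun n => (C n).2
    have hmonoG : ∀ {A B : Set κ}, A ⊆ B → ∀ ω, G A ω ≤ G B ω := fun hAB ω =>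
      biSup_mono fun k hk => hAB hk
    have hDle : ∀ E : {C : Set κ // C.Countable}, I ⟨D, hD⟩ ≤ I E := by
      intro E
      have h1 : I ⟨D, hD⟩ ≤ sInf (range I) := by
        refine ge_of_tendsto' hu fun n => ?_
        rw [← hC n]
        exact lintegral_mono fun ω =>
          hφanti (hmonoG (subset_iUnion (fun n => (C n).1) n) ω)
      exact h1.trans (sInf_le ⟨E, rfl⟩)
    refine ⟨G D, hGm D hD, fun k => ?_, fun h _ hk => ?_⟩
    · have hE : (insert k D).Countable := hD.insert k
      have hae : (fun ω => φ (G (insert k D) ω)) =ᵐ[P] fun ω => φ (G D ω) := by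
        refine ae_eq_of_ae_le_of_lintegral_le
          (ae_of_all _ fun ω => hφanti (hmonoG (subset_insert k D) ω)) ?_
          (hφm.comp (hGm D hD)).aemeasurable (hDle ⟨_, hE⟩)
        refine ((lintegral_mono fun ω => hφ1 _).trans_lt ?_).ne
        simp
      filter_upwards [hae] with ω hω
      rw [← hφinj hω]
      exact le_biSup (fun j => f j ω) (mem_insert k D)
    · filter_upwards [(ae_ball_iff hD).2 fun k _ => hk k] with ω hω
      exact iSup₂_le hω
  rw [essSupFamily, dif_pos key]
  exact key.choose_spec

/-! ## Martingales and local martingales on an interval `[s, t]` -/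

/-- The path `x` is càdlàg on `[s, t]`. -/
def IsCadlagOn {ι : Type*} [LinearOrder ι] [TopologicalSpace ι] (s t : ι) (x : ι → ℝ) : Prop :=
  ∀ u ∈ Icc s t, ContinuousWithinAt x (Icc u t) u ∧ ∃ l : ℝ, Tendsto x (𝓝[Ico s u] u) (𝓝 l)

/-- `X` is a `Q`-martingale on `[s, t]` (only the values of `X` on `[s, t]` matter). -/
structure IsMartingaleOn {ι Ω : Type*} [LinearOrder ι] [mΩ : MeasurableSpace Ω]
    (𝓕 : Filtration ι mΩ) (Q : Measure Ω) (s t : ι) (X : ι → Ω → ℝ) : Prop where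
  adapted : ∀ u ∈ Icc s t, StronglyMeasurable[𝓕 u] (X u)
  integrable : ∀ u ∈ Icc s t, Integrable (X u) Q
  condExp_eq : ∀ u v, s ≤ u → u ≤ v → v ≤ t → Q[X v | 𝓕 u] =ᵐ[Q] X u

/-- `X` is a (càdlàg) local `Q`-martingale on `[s, t]`: there are stopping times `s ≤ τ₁ ≤ τ₂ ≤ …`
which a.s. eventually reach `t`, such that every stopped process `X^{τₙ}` is a `Q`-martingale on
`[s, t]`. -/
structure IsLocalMartingaleOn {ι Ω : Type*} [LinearOrder ι] [Nonempty ι] [TopologicalSpace ι]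
    [mΩ : MeasurableSpace Ω] (𝓕 : Filtration ι mΩ) (Q : Measure Ω) (s t : ι)
    (X : ι → Ω → ℝ) : Prop where
  adapted : ∀ u ∈ Icc s t, StronglyMeasurable[𝓕 u] (X u)
  cadlag : ∀ᵐ ω ∂Q, IsCadlagOn s t fun u => X u ω
  localizing : ∃ τ : ℕ → Ω → WithTop ι,
    (∀ n, IsStoppingTime 𝓕 (τ n)) ∧ (∀ n ω, (s : WithTop ι) ≤ τ n ω) ∧
    (∀ᵐ ω ∂Q, Monotone fun n => τ n ω) ∧ (∀ᵐ ω ∂Q, ∀ᶠ n in atTop, (t : WithTop ι) ≤ τ n ω) ∧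
    ∀ n, IsMartingaleOn 𝓕 Q s t (stoppedProcess X (τ n))

/-! ## The market with proportional transaction costs -/

/-- A financial market on `[0, T]` with a risk-free asset normalized to `1`, a risky asset `S`, and
proportional transaction costs `lam`, on a filtered probability space satisfying the usual
conditions, with `P`-trivial `𝓕 0` and with `𝓕 T` the whole σ-algebra. -/
structure Market (Ω : Type*) [mΩ : MeasurableSpace Ω] where
  /-- The time horizon. -/
  T : ℝ
  T_pos : 0 < T
  /-- The reference measure. -/
  P : Measure Ω
  isProb : IsProbabilityMeasure P
  /-- The filtration. -/
  𝓕 : Filtration (Icc (0 : ℝ) T) mΩ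
  rightContinuous : ∀ t, t.1 < T → (⨅ u > t, 𝓕 u) ≤ 𝓕 t
  complete : ∀ A : Set Ω, P A = 0 → ∀ t, MeasurableSet[𝓕 t] A
  trivial_zero : ∀ A, MeasurableSet[𝓕 ⟨0, le_rfl, T_pos.le⟩] A → P A = 0 ∨ P A = 1
  eq_top : 𝓕 ⟨T, T_pos.le, le_rfl⟩ = mΩ
  /-- The price process of the risky asset. -/
  S : Icc (0 : ℝ) T → Ω → ℝ
  adapted : ∀ t, StronglyMeasurable[𝓕 t] (S t)
  cadlag : ∀ ω, IsCadlagOn ⟨0, le_rfl, T_pos.le⟩ ⟨T, T_pos.le, le_rfl⟩ fun t => S t ω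
  pos : ∀ t ω, 0 < S t ω
  integrable : ∀ t, Integrable (S t) P
  /-- The proportional transaction costs. -/
  lam : ℝ
  lam_pos : 0 < lam
  lam_lt_one : lam < 1

namespace Market

variable {Ω : Type*} [mΩ : MeasurableSpace Ω] (M : Market Ω)

/-- The initial time `0`. -/
def start : Icc (0 : ℝ) M.T := ⟨0, le_rfl, M.T_pos.le⟩

/-- The terminal time `T`. -/
def horizon : Icc (0 : ℝ) M.T := ⟨M.T, M.T_pos.le, le_rfl⟩

instance : Nonempty (Icc (0 : ℝ) M.T) := ⟨M.start⟩

/-- `(Q, X)` is a consistent local price system on `[s, T]` for the transaction costs `l`. -/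
structure IsCPSloc (l : ℝ) (s : Icc (0 : ℝ) M.T) (Q : Measure Ω)
    (X : Icc (0 : ℝ) M.T → Ω → ℝ) : Prop where
  isProb : IsProbabilityMeasure Q
  ac : Q ≪ M.P
  ac' : M.P ≪ Q
  localMartingale : IsLocalMartingaleOn M.𝓕 Q s M.horizon X
  spread : ∀ᵐ ω ∂M.P, ∀ u, s ≤ u → (1 - l) * M.S u ω ≤ X u ω ∧ X u ω ≤ (1 + l) * M.S u ω

/-- The family of consistent local price systems on `[s, T]` for the transaction costs `l`. -/
def CPSloc (l : ℝ) (s : Icc (0 : ℝ) M.T) : Set (Measure Ω × (Icc (0 : ℝ) M.T → Ω → ℝ)) :=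
  {p | M.IsCPSloc l s p.1 p.2}

/-- The measures `Q` that belong to some consistent local price system on `[s, T]` for the
transaction costs of the market. -/
def Qloc (s : Icc (0 : ℝ) M.T) : Set (Measure Ω) :=
  {Q | ∃ X, (Q, X) ∈ M.CPSloc M.lam s}

/-- `S` admits a consistent local price system (on `[0, T]`) for all transaction costs
`0 < l ≤ lam`. -/
def AdmitsCPSloc : Prop :=
  ∀ l : ℝ, 0 < l → l ≤ M.lam → (M.CPSloc l M.start).Nonempty

/-- The class of `[0, ∞)`-valued `𝓕 s`-measurable random variables that are integrable under every
measure of `M.Qloc s`. -/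
def L1plusQloc (s : Icc (0 : ℝ) M.T) : Set (Ω → ℝ) :=
  {Y | Measurable[M.𝓕 s] Y ∧ (∀ ω, 0 ≤ Y ω) ∧ ∀ Q ∈ M.Qloc s, Integrable Y Q}

/-- The liquidation value at time `T` of `x₁` units of the bond and `x₂` units of the risky
asset. -/
noncomputable def liqValue (x₁ x₂ : ℝ) (ω : Ω) : ℝ :=
  x₁ + max x₂ 0 * (1 - M.lam) * M.S M.horizon ω - max (-x₂) 0 * (1 + M.lam) * M.S M.horizon ω

/-- The conditional price `E_Q[X₁ + X₂ X_T | 𝓕 t]` of the claim `(X₁, X₂)` under a pair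
`p = (Q, X)`. -/
noncomputable def condPrice (X₁ X₂ : Ω → ℝ) (p : Measure Ω × (Icc (0 : ℝ) M.T → Ω → ℝ))
    (t : Icc (0 : ℝ) M.T) : Ω → EReal :=
  extCondExp p.1 (M.𝓕 t) fun ω => X₁ ω + X₂ ω * p.2 M.horizon ω

/-- The process `F`: the essential supremum of the conditional prices at time `t` over all
consistent local price systems on `[s, T]`. -/
noncomputable def supPrice (X₁ X₂ : Ω → ℝ) (s t : Icc (0 : ℝ) M.T) : Ω → EReal :=
  essSupFamily M.P fun p : M.CPSloc M.lam s => M.condPrice X₁ X₂ p.1 t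

theorem measurable_condPrice (X₁ X₂ : Ω → ℝ) (p : Measure Ω × (Icc (0 : ℝ) M.T → Ω → ℝ))
    (t : Icc (0 : ℝ) M.T) : Measurable (M.condPrice X₁ X₂ p t) := by
  unfold condPrice extCondExp
  simp only [sub_eq_add_neg]
  exact (measurable_condLExp' _ _ _).coe_ereal_ennreal.add
    (measurable_condLExp' _ _ _).coe_ereal_ennreal.neg

/-- `M.supPrice X₁ X₂ s t` is indeed the essential supremum that it names. -/
theorem isEssSup_supPrice (X₁ X₂ : Ω → ℝ) (s t : Icc (0 : ℝ) M.T) :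
    IsEssSup M.P (fun p : M.CPSloc M.lam s => M.condPrice X₁ X₂ p.1 t)
      (M.supPrice X₁ X₂ s t) := by
  have := M.isProb
  exact isEssSup_essSupFamily _ _ fun p => M.measurable_condPrice X₁ X₂ p.1 t

end Market

/-! Adding the `𝓕 s`-measurable variable `Ms` makes every claim price nonnegative and shifts all
conditional prices at time `t` by the same `Q₀`-integrable amount (`IsCPSloc.condPrice_ae_eq`). It
therefore suffices to interchange expectation and essential supremum for a family of `[0, ∞]`-valued
variables. This holds if the family is directed upwards up to a factor `r < 1`, for every such `r`
(`exists_dominating_of_directed`).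

The financial content is this approximate directedness (`AdmitsCPSloc.exists_raisedPrice_ge`). Given
price systems `(Q i, S i)` and an `𝓕 t`-measurable choice `sel` of an index, take a price system
`(Q', S')` for tiny costs `δ`. Let `ν` follow `Q'` up to time `t` and afterwards the conditional law
of the selected `Q i`. The price after `t` is the selected `S i`. At time `t` it lies between `c *
S'` and `d * S'`, with `c` close to `1 - lam` and `d` close to `1 + lam`, and it is extended back to
`s` as `c * S'` plus a conditional expectation under `Q'`; this keeps the bounds
(`exists_extension`, `exists_paste`).

Before `t` the result may leave the bid-ask spread slightly, since `S'` only approximates `S`.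
Mixing the pasted measure with `Q'`, with weight `ε` on the latter, repairs this: for `δ` small
compared with `ε`, the component `S'`, strictly inside the spread, absorbs the error. Under the
mixture the process `L * X + (1 - L) * S'` is a local martingale, where `L` is the density
martingale of the first component (`exists_mixture`). As `ν` and `Q'` agree on `𝓕 t`, `L` equals `1
- ε` up to time `t`; later any convex combination stays in the spread. Since the raised claim is
nonnegative also at the price `S'`, only the factor `1 - ε` is lost.

Local martingales are handled through expectations at stopping times (`Reduces`), which for
nonnegative processes is equivalent to the stopped process being a martingale and is stable under
pasting and mixing. The closed martingales that occur need càdlàg versions, obtained from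
upcrossings along dyadic times and the usual conditions (`exists_cadlag_condExp`). -/

namespace Market

/-! ### Dyadic grids of the time interval. -/

section Grid

variable {Ω : Type*} [mΩ : MeasurableSpace Ω] (M : Market Ω)

theorem le_horizon (u : Icc (0 : ℝ) M.T) : u ≤ M.horizon := u.2.2

theorem start_le (u : Icc (0 : ℝ) M.T) : M.start ≤ u := u.2.1

/-- The `k`-th point of the `n`-th dyadic grid of `[0, T]`. -/
noncomputable def grid (n k : ℕ) : Icc (0 : ℝ) M.T :=
  ⟨min (k * (M.T / 2 ^ n)) M.T,
    le_min (mul_nonneg k.cast_nonneg (div_nonneg M.T_pos.le (by positivity))) M.T_pos.le,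
    min_le_right _ _⟩

theorem coe_grid (n k : ℕ) : (M.grid n k : ℝ) = min (k * (M.T / 2 ^ n)) M.T := rfl

theorem step_pos (n : ℕ) : 0 < M.T / 2 ^ n := div_pos M.T_pos (by positivity)

theorem grid_mono (n : ℕ) : Monotone (M.grid n) := fun i j hij => by
  have := M.step_pos n
  refine Subtype.coe_le_coe.1 ?_
  rw [coe_grid, coe_grid]
  gcongr

theorem grid_succ (n k : ℕ) : M.grid (n + 1) (2 * k) = M.grid n k := by
  apply Subtype.ext
  rw [coe_grid, coe_grid]
  congr 1
  push_cast
  rw [pow_succ]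
  field_simp

theorem grid_add (n m k : ℕ) : M.grid (n + m) (2 ^ m * k) = M.grid n k := by
  induction m with
  | zero => simp
  | succ m ih => rw [← ih, ← grid_succ M (n + m), pow_succ]; congr 1; ring

theorem grid_last (n : ℕ) : M.grid n (2 ^ n) = M.horizon := by
  apply Subtype.ext
  rw [coe_grid]
  push_cast
  rw [mul_div_cancel₀ _ (by positivity)]
  simp [horizon]

/-- The first point of the `n`-th dyadic grid that is strictly larger than `x` (or the horizon). -/
noncomputable def next (n : ℕ) (x : Icc (0 : ℝ) M.T) : Icc (0 : ℝ) M.T :=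
  M.grid n (⌊(x : ℝ) / (M.T / 2 ^ n)⌋₊ + 1)

theorem lt_next (n : ℕ) {x : Icc (0 : ℝ) M.T} (hx : x < M.horizon) : x < M.next n x := by
  refine Subtype.coe_lt_coe.1 (lt_min ?_ hx)
  have h := Nat.lt_floor_add_one ((x : ℝ) / (M.T / 2 ^ n))
  rw [div_lt_iff₀ (M.step_pos n)] at h
  exact_mod_cast h

theorem le_next (n : ℕ) (x : Icc (0 : ℝ) M.T) : x ≤ M.next n x := by
  rcases (M.le_horizon x).lt_or_eq with h | h
  · exact (M.lt_next n h).le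
  · refine Subtype.coe_le_coe.1 (le_min ?_ x.2.2)
    have h := Nat.lt_floor_add_one ((x : ℝ) / (M.T / 2 ^ n))
    rw [div_lt_iff₀ (M.step_pos n)] at h
    exact_mod_cast h.le

theorem coe_next_le (n : ℕ) (x : Icc (0 : ℝ) M.T) : (M.next n x : ℝ) ≤ x + M.T / 2 ^ n := by
  have h := Nat.floor_le (div_nonneg x.2.1 (M.step_pos n).le)
  rw [le_div_iff₀ (M.step_pos n)] at h
  refine (min_le_left _ _).trans ?_
  push_cast
  rw [add_mul, one_mul]
  gcongr

theorem tendsto_next (x : Icc (0 : ℝ) M.T) :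
    Tendsto (fun n => M.next n x) atTop (𝓝 x) := by
  rw [tendsto_subtype_rng]
  refine tendsto_of_tendsto_of_tendsto_of_le_of_le tendsto_const_nhds (h := fun n : ℕ =>
    (x : ℝ) + M.T / 2 ^ n) ?_ (fun n => M.le_next n x) (fun n => M.coe_next_le n x)
  have : Tendsto (fun n : ℕ => M.T / 2 ^ n) atTop (𝓝 0) := by
    have := (tendsto_pow_atTop_nhds_zero_of_lt_one (r := (1/2 : ℝ)) (by norm_num)
      (by norm_num)).const_mul M.T
    simpa [div_eq_mul_inv] using this
  simpa using this.const_add (x : ℝ)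

/-- The right-hand side involves only a grid point that is at most `v`; hence rounding a stopping
time up to the grid gives a stopping time. Below the horizon the cap at `T` plays no role. -/
theorem next_le_iff (n : ℕ) (x v : Icc (0 : ℝ) M.T) (hv : v < M.horizon) :
    M.next n x ≤ v ↔ x < M.grid n ⌊(v : ℝ) / (M.T / 2 ^ n)⌋₊ := by
  have hs := M.step_pos n
  have hv' : (v : ℝ) < M.T := hv
  have hf := Nat.floor_le (div_nonneg v.2.1 hs.le)
  rw [le_div_iff₀ hs] at hf
  rw [← Subtype.coe_le_coe, ← Subtype.coe_lt_coe, next, coe_grid, coe_grid,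
    min_eq_left (a := (⌊(v : ℝ) / (M.T / 2 ^ n)⌋₊ : ℝ) * _) (by linarith), min_le_iff,
    or_iff_left (by linarith), ← le_div_iff₀ hs, ← div_lt_iff₀ hs,
    ← Nat.le_floor_iff (div_nonneg v.2.1 hs.le), Nat.add_one_le_iff,
    Nat.floor_lt (div_nonneg x.2.1 hs.le)]

theorem grid_floor_le (n : ℕ) (v : Icc (0 : ℝ) M.T) :
    M.grid n ⌊(v : ℝ) / (M.T / 2 ^ n)⌋₊ ≤ v := by
  have hf := Nat.floor_le (div_nonneg v.2.1 (M.step_pos n).le)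
  rw [le_div_iff₀ (M.step_pos n)] at hf
  exact (min_le_left _ _).trans hf

theorem exists_grid_between {u v : Icc (0 : ℝ) M.T} (h : u < v) :
    ∃ n k, u < M.grid n k ∧ M.grid n k < v := by
  have hu : u < M.horizon := h.trans_le (M.le_horizon v)
  obtain ⟨n, hn⟩ := ((M.tendsto_next u).eventually (eventually_lt_nhds h)).exists
  exact ⟨n, _, M.lt_next n hu, hn⟩

theorem countable_range_next (n : ℕ) : (range (M.next n)).Countable :=
  (countable_range (M.grid n)).mono (by rintro _ ⟨x, rfl⟩; exact ⟨_, rfl⟩)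

end Grid

/-! ### Stopping times with values in the time interval. -/

section StoppingTimes

variable {Ω : Type*} [mΩ : MeasurableSpace Ω] (M : Market Ω)

/-- A stopping time with values in `[0, T]`. -/
def IsStop (σ : Ω → Icc (0 : ℝ) M.T) : Prop :=
  IsStoppingTime M.𝓕 fun ω => (σ ω : WithTop (Icc (0 : ℝ) M.T))

variable {M} {σ τ : Ω → Icc (0 : ℝ) M.T}

theorem isStop_iff : M.IsStop σ ↔ ∀ u, MeasurableSet[M.𝓕 u] {ω | σ ω ≤ u} := by
  simp [IsStop, IsStoppingTime]

theorem isStop_const (u : Icc (0 : ℝ) M.T) : M.IsStop fun _ => u := isStoppingTime_const _ _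

theorem IsStop.min (hσ : M.IsStop σ) (hτ : M.IsStop τ) :
    M.IsStop fun ω => min (σ ω) (τ ω) := by
  rw [isStop_iff] at *
  intro u
  convert (hσ u).union (hτ u) using 1
  ext ω
  simp

theorem IsStop.max (hσ : M.IsStop σ) (hτ : M.IsStop τ) :
    M.IsStop fun ω => max (σ ω) (τ ω) := by
  rw [isStop_iff] at *
  intro u
  convert (hσ u).inter (hτ u) using 1
  ext ω
  simp

theorem IsStop.measurableSet_le (hσ : M.IsStop σ) (u : Icc (0 : ℝ) M.T) :
    MeasurableSet[M.𝓕 u] {ω | σ ω ≤ u} := isStop_iff.1 hσ u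

theorem IsStop.measurableSet_lt (hσ : M.IsStop σ) (u : Icc (0 : ℝ) M.T) :
    MeasurableSet[M.𝓕 u] {ω | σ ω < u} := by
  simpa using IsStoppingTime.measurableSet_lt hσ u

open scoped Classical in
/-- Two stopping times that are both at least `t` can be pasted along a set of `𝓕 t`. -/
theorem IsStop.ite (hσ : M.IsStop σ) (hτ : M.IsStop τ) {A : Set Ω} {t : Icc (0 : ℝ) M.T}
    (hA : MeasurableSet[M.𝓕 t] A) (hσt : ∀ ω ∈ A, t ≤ σ ω) (hτt : ∀ ω ∈ A, t ≤ τ ω) :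
    M.IsStop fun ω => if ω ∈ A then σ ω else τ ω := by
  rw [isStop_iff] at *
  intro u
  rcases lt_or_ge u t with h | h
  -- Before time `t` neither time has occurred on `A`, so membership in `A` need not be known.
  · convert hτ u using 1
    ext ω
    by_cases hω : ω ∈ A
    · simp [hω, (h.trans_le (hσt ω hω)).not_ge, (h.trans_le (hτt ω hω)).not_ge]
    · simp [hω]
  · have hA' := M.𝓕.mono h A hA
    convert (hA'.inter (hσ u)).union (hA'.compl.inter (hτ u)) using 1
    ext ω
    by_cases hω : ω ∈ A <;> simp [hω]

theorem IsStop.next (hσ : M.IsStop σ) (n : ℕ) : M.IsStop fun ω => M.next n (σ ω) := by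
  rw [isStop_iff]
  intro v
  rcases (M.le_horizon v).lt_or_eq with h | h
  · simp_rw [M.next_le_iff n _ v h]
    exact M.𝓕.mono (M.grid_floor_le n v) _ (hσ.measurableSet_lt _)
  · subst h
    simp [M.le_horizon]

/-- A stopping time cut off at the horizon. -/
noncomputable def cutoff (M : Market Ω) (τ : Ω → WithTop (Icc (0 : ℝ) M.T)) (ω : Ω) :
    Icc (0 : ℝ) M.T := (min (M.horizon : WithTop (Icc (0 : ℝ) M.T)) (τ ω)).untopA

theorem coe_cutoff (τ : Ω → WithTop (Icc (0 : ℝ) M.T)) (ω : Ω) :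
    (M.cutoff τ ω : WithTop (Icc (0 : ℝ) M.T)) = min (M.horizon : WithTop _) (τ ω) := by
  have h := ne_top_of_le_ne_top WithTop.coe_ne_top
    (min_le_left (M.horizon : WithTop (Icc (0 : ℝ) M.T)) (τ ω))
  rw [cutoff, WithTop.untopA_eq_untop h, WithTop.coe_untop]

theorem isStop_cutoff {τ : Ω → WithTop (Icc (0 : ℝ) M.T)} (hτ : IsStoppingTime M.𝓕 τ) :
    M.IsStop (M.cutoff τ) := by
  unfold IsStop
  simp_rw [coe_cutoff]
  exact (isStoppingTime_const M.𝓕 M.horizon).min hτ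

/-- Localizing times may take the value `⊤`, but no time index exceeds the horizon, so cutting them
off changes nothing. -/
theorem stoppedProcess_eq_min_cutoff (X : Icc (0 : ℝ) M.T → Ω → ℝ)
    (τ : Ω → WithTop (Icc (0 : ℝ) M.T)) (u : Icc (0 : ℝ) M.T) (ω : Ω) :
    stoppedProcess X τ u ω = X (Min.min u (M.cutoff τ ω)) ω := by
  have : (min (u : WithTop (Icc (0 : ℝ) M.T)) (τ ω)) =
      ((Min.min u (M.cutoff τ ω) : Icc (0 : ℝ) M.T) : WithTop _) := by
    rw [WithTop.coe_min, coe_cutoff, ← min_assoc,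
      min_eq_left (WithTop.coe_le_coe.2 (M.le_horizon u))]
  rw [stoppedProcess, this]
  rfl

theorem stoppedProcess_coe (X : Icc (0 : ℝ) M.T → Ω → ℝ) (σ : Ω → Icc (0 : ℝ) M.T)
    (u : Icc (0 : ℝ) M.T) (ω : Ω) :
    stoppedProcess X (fun ω => (σ ω : WithTop _)) u ω = X (Min.min u (σ ω)) ω := by
  rw [stoppedProcess, ← WithTop.coe_min]
  rfl

end StoppingTimes

/-! ### Right-continuous paths and sampling at stopping times. -/

section Sampling

variable {Ω : Type*} [mΩ : MeasurableSpace Ω] {M : Market Ω}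

/-- Completeness of the filtration in the form that keeps almost sure limits `𝓕 t`-measurable
without changing them on a null set. -/
theorem isComplete_trim {t : Icc (0 : ℝ) M.T} : (M.P.trim (M.𝓕.le t)).IsComplete :=
  ⟨fun A hA => M.complete A (measure_eq_zero_of_trim_eq_zero _ hA) t⟩

theorem ae_trim {t : Icc (0 : ℝ) M.T} {p : Ω → Prop} (h : ∀ᵐ ω ∂M.P, p ω) :
    ∀ᵐ ω ∂(M.P.trim (M.𝓕.le t)), p ω := by
  rw [ae_iff] at h ⊢
  rwa [trim_measurableSet_eq _ (M.complete _ h t)]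

/-- Random variables that are a.s. equal to an `𝓕 t`-measurable one are `𝓕 t`-measurable. -/
theorem measurable_of_ae_tendsto {t : Icc (0 : ℝ) M.T} {f : ℕ → Ω → ℝ} {g : Ω → ℝ}
    (hf : ∀ n, Measurable[M.𝓕 t] (f n))
    (hfg : ∀ᵐ ω ∂M.P, Tendsto (fun n => f n ω) atTop (𝓝 (g ω))) : Measurable[M.𝓕 t] g := by
  exact @measurable_of_tendsto_metrizable_ae _ _ (M.𝓕 t) _ _ _ _ (M.P.trim (M.𝓕.le t))
    isComplete_trim _ _ hf (ae_trim hfg)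

/-- The path `x` is right-continuous on `[s, T]`. -/
def RightCont (s : Icc (0 : ℝ) M.T) (x : Icc (0 : ℝ) M.T → ℝ) : Prop :=
  ∀ u, s ≤ u → ContinuousWithinAt x (Ici u) u

theorem Icc_horizon (u : Icc (0 : ℝ) M.T) : Icc u M.horizon = Ici u := by
  ext v
  simp [M.le_horizon v]

theorem RightCont.of_isCadlagOn {s : Icc (0 : ℝ) M.T} {x : Icc (0 : ℝ) M.T → ℝ}
    (h : IsCadlagOn s M.horizon x) : M.RightCont s x := fun u hu => by
  have := (h u ⟨hu, M.le_horizon u⟩).1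
  rwa [Icc_horizon] at this

theorem RightCont.tendsto_next {s : Icc (0 : ℝ) M.T} {x : Icc (0 : ℝ) M.T → ℝ}
    (h : M.RightCont s x) {u : Icc (0 : ℝ) M.T} (hu : s ≤ u) :
    Tendsto (fun n => x (M.next n u)) atTop (𝓝 (x u)) :=
  (h u hu).tendsto.comp (tendsto_nhdsWithin_iff.2
    ⟨M.tendsto_next u, Eventually.of_forall fun n => M.le_next n u⟩)

theorem RightCont.tendsto_min_next {s : Icc (0 : ℝ) M.T} {x : Icc (0 : ℝ) M.T → ℝ}
    (h : M.RightCont s x) {u t : Icc (0 : ℝ) M.T} (hu : s ≤ u) (ht : s ≤ t) :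
    Tendsto (fun n => x (min (M.next n u) t)) atTop (𝓝 (x (min u t))) :=
  (h _ (le_min hu ht)).tendsto.comp (tendsto_nhdsWithin_iff.2
    ⟨(M.tendsto_next u).min tendsto_const_nhds,
      Eventually.of_forall fun n => min_le_min_right _ (M.le_next n u)⟩)

/-- If two right-continuous paths are comparable on the dyadic points, they are comparable. -/
theorem RightCont.le_of_grid {s t : Icc (0 : ℝ) M.T} {x y : Icc (0 : ℝ) M.T → ℝ}
    (hx : M.RightCont s x) (hy : M.RightCont s y)
    (h : ∀ n k, s ≤ M.grid n k → x (min (M.grid n k) t) ≤ y (min (M.grid n k) t)) :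
    ∀ u, s ≤ u → u ≤ t → x u ≤ y u := fun u hu hut => by
  have := le_of_tendsto_of_tendsto' (hx.tendsto_min_next hu (hu.trans hut))
    (hy.tendsto_min_next hu (hu.trans hut)) fun n => h n _ (hu.trans (M.le_next n u))
  rwa [min_eq_left hut] at this

/-- Two a.s. right-continuous processes that are a.s. comparable at each time of `[s, t]` are a.s.
comparable on `[s, t]`. -/
theorem ae_forall_le {Q : Measure Ω} {s t : Icc (0 : ℝ) M.T} (hst : s ≤ t)
    {X Y : Icc (0 : ℝ) M.T → Ω → ℝ}
    (hX : ∀ᵐ ω ∂Q, M.RightCont s fun u => X u ω) (hY : ∀ᵐ ω ∂Q, M.RightCont s fun u => Y u ω)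
    (h : ∀ u, s ≤ u → u ≤ t → X u ≤ᵐ[Q] Y u) :
    ∀ᵐ ω ∂Q, ∀ u, s ≤ u → u ≤ t → X u ω ≤ Y u ω := by
  have h' : ∀ᵐ ω ∂Q, ∀ n k, s ≤ M.grid n k →
      X (min (M.grid n k) t) ω ≤ Y (min (M.grid n k) t) ω := by
    rw [ae_all_iff]; intro n; rw [ae_all_iff]; intro k
    by_cases hs : s ≤ M.grid n k
    · filter_upwards [h _ (le_min hs hst) (min_le_right _ _)] with ω hω _ using hω
    · exact ae_of_all _ fun ω h => absurd h hs
  filter_upwards [hX, hY, h'] with ω h1 h2 h3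
  exact RightCont.le_of_grid h1 h2 h3

/-- An adapted right-continuous process sampled at a bounded stopping time. -/
theorem measurable_sample {s t : Icc (0 : ℝ) M.T} {X : Icc (0 : ℝ) M.T → Ω → ℝ}
    (hX : ∀ u, s ≤ u → Measurable[M.𝓕 u] (X u)) (hc : ∀ᵐ ω ∂M.P, M.RightCont s fun u => X u ω)
    {σ : Ω → Icc (0 : ℝ) M.T} (hσ : M.IsStop σ) (hs : ∀ ω, s ≤ σ ω) (hst : s ≤ t) :
    Measurable[M.𝓕 t] fun ω => X (min (σ ω) t) ω := by
  refine measurable_of_ae_tendsto (f := fun n ω => X (min (M.next n (σ ω)) t) ω) (fun n => ?_) ?_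
  · intro E hE
    -- The rounded time has countably many values, so the event splits into countably many pieces on
    -- which the process is evaluated at a fixed time.
    have hcount : ((fun x => min (M.next n x) t) '' univ).Countable := by
      have := (M.countable_range_next n).image fun x => min x t
      rwa [← range_comp, ← image_univ] at this
    have : (fun ω => X (min (M.next n (σ ω)) t) ω) ⁻¹' E =
        ⋃ c ∈ (fun x => min (M.next n x) t) '' univ,
          {ω | min (M.next n (σ ω)) t = c} ∩ {ω | s ≤ c ∧ c ≤ t ∧ X c ω ∈ E} := by
      ext ω
      simp only [mem_preimage, mem_iUnion]
      constructor
      · intro h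
        exact ⟨_, ⟨σ ω, trivial, rfl⟩, rfl, le_min ((hs ω).trans (M.le_next n _)) hst,
          min_le_right _ _, h⟩
      · rintro ⟨c, -, h1, -, -, h2⟩
        simp only [mem_ofPred_eq] at h1
        rwa [h1]
    rw [this]
    refine MeasurableSet.biUnion hcount fun c _ => ?_
    by_cases hsc : s ≤ c ∧ c ≤ t
    · refine MeasurableSet.inter ?_ ?_
      · have hst := ((hσ.next n).min (isStop_const t))
        have h1 := M.𝓕.mono hsc.2 _ (hst.measurableSet_le c)
        have h2 := M.𝓕.mono hsc.2 _ (hst.measurableSet_lt c)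
        convert h1.diff h2 using 1
        ext ω
        simp only [Set.mem_sdiff, mem_ofPred_eq, not_lt]
        exact le_antisymm_iff
      · simp only [hsc, true_and]
        exact M.𝓕.mono hsc.2 _ (hX c hsc.1 hE)
    · convert MeasurableSet.empty using 1
      ext ω
      simp only [mem_inter_iff, mem_ofPred_eq, mem_empty_iff_false, iff_false]
      tauto
  · filter_upwards [hc] with ω hω
    exact hω.tendsto_min_next (hs ω) hst

end Sampling

end Market

namespace Market

/-! ### Optional sampling. -/

section OptionalSampling

/-- The measures with densities `f` and `g` coincide on `m`, so they integrate `m`-measurable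
functions equally. No integrability is needed. -/
theorem lintegral_mul_congr {Ω : Type*} {m mΩ : MeasurableSpace Ω} {Q : Measure Ω} (hm : m ≤ mΩ)
    {f g : Ω → ℝ≥0∞} (hf : Measurable f) (hg : Measurable g)
    (h : ∀ B, MeasurableSet[m] B → ∫⁻ ω in B, f ω ∂Q = ∫⁻ ω in B, g ω ∂Q) {W : Ω → ℝ≥0∞}
    (hW : Measurable[m] W) : ∫⁻ ω, W ω * f ω ∂Q = ∫⁻ ω, W ω * g ω ∂Q := by
  have hW' := hW.mono hm le_rfl
  have key : (Q.withDensity f).trim hm = (Q.withDensity g).trim hm := by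
    refine @Measure.ext _ m _ _ fun B hB => ?_
    rw [trim_measurableSet_eq _ hB, trim_measurableSet_eq _ hB,
      withDensity_apply _ (hm _ hB), withDensity_apply _ (hm _ hB), h B hB]
  have e1 := lintegral_withDensity_eq_lintegral_mul Q hf hW'
  have e2 := lintegral_withDensity_eq_lintegral_mul Q hg hW'
  rw [← lintegral_trim hm hW, key, lintegral_trim hm hW, e2] at e1
  simp_rw [mul_comm (W _)]
  exact e1.symm

/-- Vitali's theorem for an a.s. convergent sequence of conditional expectations of one random
variable. -/
theorem tendsto_setIntegral_of_condExp {Ω : Type*} {mΩ : MeasurableSpace Ω} {Q : Measure Ω}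
    [IsFiniteMeasure Q] {g : Ω → ℝ} (hg : Integrable g Q) {m : ℕ → MeasurableSpace Ω}
    (hm : ∀ n, m n ≤ mΩ) {f : ℕ → Ω → ℝ} (hf : ∀ n, f n =ᵐ[Q] Q[g | m n]) {h : Ω → ℝ}
    (hlim : ∀ᵐ ω ∂Q, Tendsto (fun n => f n ω) atTop (𝓝 (h ω))) :
    Integrable h Q ∧ ∀ A : Set Ω,
      Tendsto (fun n => ∫ ω in A, f n ω ∂Q) atTop (𝓝 (∫ ω in A, h ω ∂Q)) := by
  have hUI : UniformIntegrable f 1 Q :=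
    (hg.uniformIntegrable_condExp hm).ae_eq fun n => (hf n).symm
  have hh : MemLp h 1 Q := hUI.memLp_of_ae_tendsto hlim
  have hL := tendsto_Lp_finite_of_tendsto_ae le_rfl ENNReal.one_ne_top hUI.1 hh hUI.2.1 hlim
  refine ⟨memLp_one_iff_integrable.1 hh, fun A => ?_⟩
  refine tendsto_setIntegral_of_L1 h hh.1
    (Eventually.of_forall fun n => memLp_one_iff_integrable.1 (hUI.memLp n)) ?_ A
  simpa [eLpNorm_one_eq_lintegral_enorm] using hL

variable {Ω : Type*} [mΩ : MeasurableSpace Ω] {M : Market Ω}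

/-- **Optional sampling** for nonnegative right-continuous martingales. -/
theorem lintegral_sample_of_isMartingaleOn {Q : Measure Ω} [IsProbabilityMeasure Q]
    {s : Icc (0 : ℝ) M.T} {Y : Icc (0 : ℝ) M.T → Ω → ℝ}
    (hY : IsMartingaleOn M.𝓕 Q s M.horizon Y) (hc : ∀ᵐ ω ∂Q, M.RightCont s fun u => Y u ω)
    (h0 : ∀ᵐ ω ∂Q, ∀ u, s ≤ u → 0 ≤ Y u ω) {σ : Ω → Icc (0 : ℝ) M.T} (hσ : M.IsStop σ)
    (hs : ∀ ω, s ≤ σ ω) :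
    ∫⁻ ω, ENNReal.ofReal (Y (σ ω) ω) ∂Q = ∫⁻ ω, ENNReal.ofReal (Y M.horizon ω) ∂Q := by
  have hmart := martingale_condExp (Y M.horizon) M.𝓕 Q
  have hsT := M.le_horizon s
  have hint := hY.integrable M.horizon ⟨hsT, le_rfl⟩
  have hσn := fun n => hσ.next n
  have heq : ∀ᵐ ω ∂Q, ∀ n k, s ≤ M.grid n k →
      (Q[Y M.horizon | M.𝓕 (M.grid n k)]) ω = Y (M.grid n k) ω := by
    rw [ae_all_iff]; intro n; rw [ae_all_iff]; intro k
    by_cases h : s ≤ M.grid n k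
    · filter_upwards [hY.condExp_eq _ _ h (M.le_horizon _) le_rfl] with ω hω _ using hω
    · exact ae_of_all _ fun ω h' => absurd h' h
  -- The rounded times have countable range, where optional sampling is already available. All
  -- sampled values are conditional expectations of one variable, hence uniformly integrable.
  have hf : ∀ n, (fun ω => Y (M.next n (σ ω)) ω) =ᵐ[Q]
      Q[Y M.horizon | IsStoppingTime.measurableSpace (hσn n)] := by
    intro n
    have h1 := hmart.stoppedValue_ae_eq_condExp_of_le_const_of_countable_range (hσn n)
      (n := M.horizon) (fun ω => WithTop.coe_le_coe.2 (M.le_horizon _)) (by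
        have := (M.countable_range_next n).image
          (fun x => (x : WithTop (Icc (0 : ℝ) M.T)))
        refine this.mono ?_
        rintro _ ⟨ω, rfl⟩
        exact ⟨_, ⟨_, rfl⟩, rfl⟩)
    rw [condExp_of_stronglyMeasurable (M.𝓕.le _) (hY.adapted _ ⟨hsT, le_rfl⟩) hint] at h1
    refine EventuallyEq.trans ?_ h1
    filter_upwards [heq] with ω hω
    exact (hω n _ ((hs ω).trans (M.le_next n _))).symm
  have hlim : ∀ᵐ ω ∂Q, Tendsto (fun n => Y (M.next n (σ ω)) ω) atTop (𝓝 (Y (σ ω) ω)) := by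
    filter_upwards [hc] with ω hω
    exact hω.tendsto_next (hs ω)
  obtain ⟨h1, h2⟩ := tendsto_setIntegral_of_condExp hint
    (fun n => IsStoppingTime.measurableSpace_le (hσn n)) hf hlim
  have h3 := h2 univ
  simp only [Measure.restrict_univ] at h3
  have h4 : ∀ n, ∫ ω, Y (M.next n (σ ω)) ω ∂Q = ∫ ω, Y M.horizon ω ∂Q := fun n => by
    rw [integral_congr_ae (hf n), integral_condExp (IsStoppingTime.measurableSpace_le (hσn n))]
  simp only [h4] at h3
  have h5 := tendsto_nhds_unique h3 tendsto_const_nhds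
  rw [← ofReal_integral_eq_lintegral_ofReal h1, ← ofReal_integral_eq_lintegral_ofReal hint, h5]
  · filter_upwards [h0] with ω hω using hω _ hsT
  · filter_upwards [h0] with ω hω using hω _ (hs ω)

end OptionalSampling

/-! ### Reduction by stopping times, expressed through expectations. -/

section Reduces

variable {Ω : Type*} [mΩ : MeasurableSpace Ω] {M : Market Ω}

/-- An adapted, right-continuous, nonnegative process on `[s, T]`. -/
structure IsPosAdapted (M : Market Ω) (s : Icc (0 : ℝ) M.T) (X : Icc (0 : ℝ) M.T → Ω → ℝ) :
    Prop where
  adapted : ∀ u, s ≤ u → Measurable[M.𝓕 u] (X u)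
  rightCont : ∀ᵐ ω ∂M.P, M.RightCont s fun u => X u ω
  nonneg : ∀ᵐ ω ∂M.P, ∀ u, s ≤ u → 0 ≤ X u ω

theorem IsPosAdapted.measurable_sample {s t : Icc (0 : ℝ) M.T} {X : Icc (0 : ℝ) M.T → Ω → ℝ}
    (h : M.IsPosAdapted s X) {σ : Ω → Icc (0 : ℝ) M.T} (hσ : M.IsStop σ) (hs : ∀ ω, s ≤ σ ω)
    (ht : ∀ ω, σ ω ≤ t) (hst : s ≤ t) : Measurable[M.𝓕 t] fun ω => X (σ ω) ω := by
  have := Market.measurable_sample h.adapted h.rightCont hσ hs hst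
  simpa only [min_eq_left (ht _)] using this

theorem IsPosAdapted.measurable_sample' {s : Icc (0 : ℝ) M.T} {X : Icc (0 : ℝ) M.T → Ω → ℝ}
    (h : M.IsPosAdapted s X) {σ : Ω → Icc (0 : ℝ) M.T} (hσ : M.IsStop σ) (hs : ∀ ω, s ≤ σ ω) :
    Measurable fun ω => X (σ ω) ω :=
  (h.measurable_sample hσ hs (fun _ => M.le_horizon _) (M.le_horizon _)).mono (M.𝓕.le _) le_rfl

/-- The expectation of `X` is preserved under sampling at stopping times between `s` and `τ`. -/
def Reduces (M : Market Ω) (Q : Measure Ω) (X : Icc (0 : ℝ) M.T → Ω → ℝ) (s : Icc (0 : ℝ) M.T)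
    (τ : Ω → Icc (0 : ℝ) M.T) : Prop :=
  ∀ σ, M.IsStop σ → (∀ ω, s ≤ σ ω) → (∀ ω, σ ω ≤ τ ω) →
    ∫⁻ ω, ENNReal.ofReal (X (σ ω) ω) ∂Q = ∫⁻ ω, ENNReal.ofReal (X s ω) ∂Q

variable {Q : Measure Ω} {X : Icc (0 : ℝ) M.T → Ω → ℝ} {s t : Icc (0 : ℝ) M.T}
  {τ : Ω → Icc (0 : ℝ) M.T}

/-- Optional sampling for the stopped process gives its terminal expectation both at `σ` and at the
constant time `s`, and at these times stopping has no effect. -/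
theorem reduces_of_isMartingaleOn [IsProbabilityMeasure Q] (hQ : Q ≪ M.P)
    (hX : M.IsPosAdapted s X) {τ : Ω → WithTop (Icc (0 : ℝ) M.T)}
    (hsτ : ∀ ω, (s : WithTop (Icc (0 : ℝ) M.T)) ≤ τ ω)
    (h : IsMartingaleOn M.𝓕 Q s M.horizon (stoppedProcess X τ)) :
    M.Reduces Q X s (M.cutoff τ) := by
  intro σ hσ hs hle
  have hsc : ∀ ω, s ≤ M.cutoff τ ω := fun ω => by
    rw [← WithTop.coe_le_coe, coe_cutoff]
    exact le_min (WithTop.coe_le_coe.2 (M.le_horizon s)) (hsτ ω)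
  have hc : ∀ᵐ ω ∂Q, M.RightCont s fun u => stoppedProcess X τ u ω := by
    filter_upwards [hQ.ae_le hX.rightCont] with ω hω u hu
    simp_rw [stoppedProcess_eq_min_cutoff]
    have h1 := hω (min u (M.cutoff τ ω)) (le_min hu (hsc ω))
    refine h1.tendsto.comp (tendsto_nhdsWithin_iff.2 ⟨?_, ?_⟩)
    · exact ((continuous_id.min continuous_const).tendsto u).mono_left nhdsWithin_le_nhds
    · filter_upwards [self_mem_nhdsWithin] with v hv using min_le_min_right _ (mem_Ici.1 hv)
  have h0 : ∀ᵐ ω ∂Q, ∀ u, s ≤ u → 0 ≤ stoppedProcess X τ u ω := by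
    filter_upwards [hQ.ae_le hX.nonneg] with ω hω u hu
    rw [stoppedProcess_eq_min_cutoff]
    exact hω _ (le_min hu (hsc ω))
  have h1 := lintegral_sample_of_isMartingaleOn h hc h0 hσ hs
  have h2 := lintegral_sample_of_isMartingaleOn h hc h0 (isStop_const s) fun _ => le_rfl
  simp_rw [stoppedProcess_eq_min_cutoff] at h1 h2
  simp_rw [fun ω => min_eq_left (hle ω)] at h1
  simp_rw [fun ω => min_eq_left (hsc ω)] at h2
  rw [h1, h2]

theorem Reduces.mono {τ' : Ω → Icc (0 : ℝ) M.T} (h : M.Reduces Q X s τ)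
    (hle : ∀ ω, τ' ω ≤ τ ω) : M.Reduces Q X s τ' :=
  fun σ hσ hs hστ => h σ hσ hs fun ω => (hστ ω).trans (hle ω)

/-- A reduced process is still reduced when it is started at a later time `t`, conditionally on
`𝓕 t`. -/
theorem Reduces.setLIntegral_eq (h : M.Reduces Q X s τ) (hτ : M.IsStop τ) (hsτ : ∀ ω, s ≤ τ ω)
    (hst : s ≤ t) (hfin : ∫⁻ ω, ENNReal.ofReal (X s ω) ∂Q ≠ ∞)
    {κ : Ω → Icc (0 : ℝ) M.T} (hκ : M.IsStop κ) (htκ : ∀ ω, t ≤ κ ω)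
    (hκτ : ∀ ω, κ ω ≤ max (τ ω) t) {B : Set Ω} (hB : MeasurableSet[M.𝓕 t] B) :
    ∫⁻ ω in B, ENNReal.ofReal (X (κ ω) ω) ∂Q = ∫⁻ ω in B, ENNReal.ofReal (X t ω) ∂Q := by
  classical
  -- Where `τ < t`, the bound on `κ` forces `κ = t` and there is nothing to prove; only `B₁`
  -- matters.
  obtain ⟨B₁, hB₁⟩ : ∃ B₁ : Set Ω, B₁ = B ∩ {ω | t ≤ τ ω} := ⟨_, rfl⟩
  have hm : MeasurableSet[M.𝓕 t] {ω | t ≤ τ ω} := by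
    have := (hτ.measurableSet_lt t).compl
    simpa [compl_ofPred] using this
  have hB₁m : MeasurableSet[M.𝓕 t] B₁ := hB₁ ▸ hB.inter hm
  have hle : ∀ ω ∈ B₁, t ≤ τ ω := fun ω hω => (hB₁ ▸ hω : ω ∈ B ∩ {ω | t ≤ τ ω}).2
  have hB₁m' := M.𝓕.le t _ hB₁m
  have hB' := M.𝓕.le t _ hB
  have hmin : M.IsStop fun ω => min t (τ ω) := (isStop_const t).min hτ
  -- The test time is `κ` on `B₁` and `min t τ` elsewhere. Comparing it with `min t τ` everywhere,
  -- the finite contribution of the complement cancels.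
  have e1 := h _ (hκ.ite hmin hB₁m (fun ω _ => htκ ω) fun ω hω => le_min le_rfl (hle ω hω))
    (fun ω => by split_ifs; exacts [hst.trans (htκ ω), le_min hst (hsτ ω)])
    (fun ω => by
      split_ifs with hω
      · exact (hκτ ω).trans (max_le le_rfl (hle ω hω))
      · exact min_le_right _ _)
  have e2 := h _ hmin (fun ω => le_min hst (hsτ ω)) (fun ω => min_le_right _ _)
  rw [← e2, ← lintegral_add_compl _ hB₁m', ← lintegral_add_compl (fun ω => ENNReal.ofReal
    (X (min t (τ ω)) ω)) hB₁m'] at e1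
  have c1 : ∫⁻ ω in B₁ᶜ, ENNReal.ofReal (X (if ω ∈ B₁ then κ ω else min t (τ ω)) ω) ∂Q =
      ∫⁻ ω in B₁ᶜ, ENNReal.ofReal (X (min t (τ ω)) ω) ∂Q :=
    setLIntegral_congr_fun hB₁m'.compl fun ω hω => by simp only [if_neg hω]
  have c2 : ∫⁻ ω in B₁, ENNReal.ofReal (X (if ω ∈ B₁ then κ ω else min t (τ ω)) ω) ∂Q =
      ∫⁻ ω in B₁, ENNReal.ofReal (X (κ ω) ω) ∂Q :=
    setLIntegral_congr_fun hB₁m' fun ω hω => by simp only [if_pos hω]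
  have c3 : ∫⁻ ω in B₁, ENNReal.ofReal (X (min t (τ ω)) ω) ∂Q =
      ∫⁻ ω in B₁, ENNReal.ofReal (X t ω) ∂Q :=
    setLIntegral_congr_fun hB₁m' fun ω hω => by simp only [min_eq_left (hle ω hω)]
  have hne : ∫⁻ ω in B₁ᶜ, ENNReal.ofReal (X (min t (τ ω)) ω) ∂Q ≠ ∞ :=
    ne_top_of_le_ne_top hfin (e2 ▸ setLIntegral_le_lintegral _ _)
  rw [c1, c2, c3, ENNReal.add_left_inj hne] at e1
  rw [← lintegral_inter_add_sdiff _ B (M.𝓕.le t _ hm),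
    ← lintegral_inter_add_sdiff (fun ω => ENNReal.ofReal (X t ω)) B (M.𝓕.le t _ hm), ← hB₁, e1]
  congr 1
  refine setLIntegral_congr_fun (hB'.diff (M.𝓕.le t _ hm)) fun ω hω => ?_
  have h1 : τ ω < t := not_le.1 hω.2
  have h2 : κ ω = t := le_antisymm ((hκτ ω).trans (max_le h1.le le_rfl)) (htκ ω)
  simp only [h2]

theorem Reduces.lintegral_eq (h : M.Reduces Q X s τ) (hτ : M.IsStop τ) (hsτ : ∀ ω, s ≤ τ ω)
    (hst : s ≤ t) (hfin : ∫⁻ ω, ENNReal.ofReal (X s ω) ∂Q ≠ ∞) :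
    M.Reduces Q X t fun ω => max (τ ω) t := fun κ hκ htκ hκτ => by
  simpa using h.setLIntegral_eq hτ hsτ hst hfin hκ htκ hκτ MeasurableSet.univ

/-- Weighted version of `Reduces.setLIntegral_eq`. -/
theorem Reduces.lintegral_mul_eq (h : M.Reduces Q X s τ) (hX : M.IsPosAdapted s X)
    (hτ : M.IsStop τ) (hsτ : ∀ ω, s ≤ τ ω)
    (hst : s ≤ t) (hfin : ∫⁻ ω, ENNReal.ofReal (X s ω) ∂Q ≠ ∞)
    {κ : Ω → Icc (0 : ℝ) M.T} (hκ : M.IsStop κ) (htκ : ∀ ω, t ≤ κ ω)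
    (hκτ : ∀ ω, κ ω ≤ max (τ ω) t) {W : Ω → ℝ≥0∞} (hW : Measurable[M.𝓕 t] W) :
    ∫⁻ ω, W ω * ENNReal.ofReal (X (κ ω) ω) ∂Q = ∫⁻ ω, W ω * ENNReal.ofReal (X t ω) ∂Q := by
  have m1 : Measurable fun ω => ENNReal.ofReal (X (κ ω) ω) :=
    (hX.measurable_sample' hκ fun ω => hst.trans (htκ ω)).ennreal_ofReal
  have m2 : Measurable fun ω => ENNReal.ofReal (X t ω) :=
    ((hX.adapted t hst).mono (M.𝓕.le t) le_rfl).ennreal_ofReal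
  exact lintegral_mul_congr (M.𝓕.le t) m1 m2
    (fun B hB => h.setLIntegral_eq hτ hsτ hst hfin hκ htκ hκτ hB) hW

/-- Converse of `reduces_of_isMartingaleOn`: testing on `B` in `𝓕 u`, the stopped process no longer
moves after `u` on `{τ < u}`, and on the complement the conditional form `Reduces.setLIntegral_eq`
applies. -/
theorem Reduces.isMartingaleOn [IsProbabilityMeasure Q] (hQ : Q ≪ M.P)
    (hX : M.IsPosAdapted s X) (h : M.Reduces Q X s τ) (hτ : M.IsStop τ) (hsτ : ∀ ω, s ≤ τ ω)
    (hfin : ∫⁻ ω, ENNReal.ofReal (X s ω) ∂Q ≠ ∞) :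
    IsMartingaleOn M.𝓕 Q s M.horizon
      (stoppedProcess X fun ω => (τ ω : WithTop (Icc (0 : ℝ) M.T))) := by
  have hrw : ∀ u, stoppedProcess X (fun ω => (τ ω : WithTop (Icc (0 : ℝ) M.T))) u =
      fun ω => X (min u (τ ω)) ω := fun u => funext fun ω => stoppedProcess_coe X τ u ω
  have hmin : ∀ u, M.IsStop fun ω => min u (τ ω) := fun u => (isStop_const u).min hτ
  have hmeas : ∀ u, s ≤ u → Measurable[M.𝓕 u] fun ω => X (min u (τ ω)) ω := fun u hu =>
    hX.measurable_sample (hmin u) (fun ω => le_min hu (hsτ ω)) (fun ω => min_le_left _ _) hu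
  have hnn : ∀ u, s ≤ u → 0 ≤ᵐ[Q] fun ω => X (min u (τ ω)) ω := fun u hu => by
    filter_upwards [hQ.ae_le hX.nonneg] with ω hω using hω _ (le_min hu (hsτ ω))
  have hint : ∀ u, s ≤ u → Integrable (fun ω => X (min u (τ ω)) ω) Q := fun u hu => by
    refine ⟨((hmeas u hu).mono (M.𝓕.le u) le_rfl).aestronglyMeasurable, ?_⟩
    rw [hasFiniteIntegral_iff_ofReal (hnn u hu), h _ (hmin u) (fun ω => le_min hu (hsτ ω))
      fun ω => min_le_right _ _]
    exact hfin.lt_top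
  refine ⟨fun u hu => ?_, fun u hu => ?_, fun u v hu huv _ => ?_⟩
  · rw [hrw]
    exact (hmeas u hu.1).stronglyMeasurable
  · rw [hrw]
    exact hint u hu.1
  · rw [hrw, hrw]
    symm
    refine ae_eq_condExp_of_forall_setIntegral_eq (M.𝓕.le u) (hint v (hu.trans huv))
      (fun _ _ _ => (hint u hu).integrableOn) (fun B hB _ => ?_)
      (hmeas u hu).stronglyMeasurable.aestronglyMeasurable
    have hB' := M.𝓕.le u _ hB
    rw [integral_eq_lintegral_of_nonneg_ae (ae_restrict_of_ae (hnn u hu))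
      (hint u hu).integrableOn.aestronglyMeasurable,
      integral_eq_lintegral_of_nonneg_ae (ae_restrict_of_ae (hnn v (hu.trans huv)))
      (hint v (hu.trans huv)).integrableOn.aestronglyMeasurable]
    congr 1
    have hm : MeasurableSet[M.𝓕 u] {ω | τ ω < u} := hτ.measurableSet_lt u
    have hm' := M.𝓕.le u _ hm
    rw [← lintegral_inter_add_sdiff _ B hm',
      ← lintegral_inter_add_sdiff (fun ω => ENNReal.ofReal (X (min v (τ ω)) ω)) B hm']
    have key := h.setLIntegral_eq hτ hsτ hu hfin ((hmin v).max (isStop_const u))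
      (fun ω => le_max_right _ _) (fun ω => max_le_max_right _ (min_le_right _ _)) (hB.diff hm)
    congr 1
    · refine setLIntegral_congr_fun (hB'.inter hm') fun ω hω => ?_
      have : τ ω < u := hω.2
      simp only [min_eq_right this.le, min_eq_right (this.le.trans huv)]
    · refine Eq.trans ?_ (key.symm.trans ?_)
      · refine setLIntegral_congr_fun (hB'.diff hm') fun ω hω => ?_
        have : u ≤ τ ω := not_lt.1 hω.2
        simp only [min_eq_left this]
      · refine setLIntegral_congr_fun (hB'.diff hm') fun ω hω => ?_
        have : u ≤ τ ω := not_lt.1 hω.2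
        simp only [max_eq_left (le_min huv this)]

/-- Fatou: a nonnegative process that is reduced by stopping times that eventually reach the horizon
is a supermartingale. -/
theorem setLIntegral_le_of_reduces (hX : M.IsPosAdapted s X)
    {τ : ℕ → Ω → Icc (0 : ℝ) M.T} (h : ∀ n, M.Reduces Q X s (τ n)) (hτ : ∀ n, M.IsStop (τ n))
    (hsτ : ∀ n ω, s ≤ τ n ω) (hT : ∀ᵐ ω ∂Q, ∀ᶠ n in atTop, τ n ω = M.horizon)
    (hfin : ∫⁻ ω, ENNReal.ofReal (X s ω) ∂Q ≠ ∞) {u : Icc (0 : ℝ) M.T} (hsu : s ≤ u)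
    (hut : u ≤ t) {B : Set Ω} (hB : MeasurableSet[M.𝓕 u] B) :
    ∫⁻ ω in B, ENNReal.ofReal (X t ω) ∂Q ≤ ∫⁻ ω in B, ENNReal.ofReal (X u ω) ∂Q := by
  -- These times are at least `u`, remain within the reduced range, and eventually equal `t`.
  have hst : ∀ n, M.IsStop fun ω => min t (max (τ n ω) u) := fun n =>
    (isStop_const t).min ((hτ n).max (isStop_const u))
  have hle : ∀ n ω, u ≤ min t (max (τ n ω) u) := fun n ω => le_min hut (le_max_right _ _)
  have heq : ∀ n, ∫⁻ ω in B, ENNReal.ofReal (X (min t (max (τ n ω) u)) ω) ∂Q =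
      ∫⁻ ω in B, ENNReal.ofReal (X u ω) ∂Q := fun n =>
    (h n).setLIntegral_eq (hτ n) (hsτ n) hsu hfin (hst n) (hle n) (fun ω => min_le_right _ _) hB
  have hF := lintegral_liminf_le (μ := Q.restrict B) (u := (atTop : Filter ℕ))
    (f := fun n ω => ENNReal.ofReal (X (min t (max (τ n ω) u)) ω)) fun n =>
      (hX.measurable_sample' (hst n) fun ω => hsu.trans (hle n ω)).ennreal_ofReal
  simp only [heq, liminf_const] at hF
  refine le_trans (le_of_eq (lintegral_congr_ae ?_)) hF
  filter_upwards [ae_restrict_of_ae hT] with ω hω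
  refine (Tendsto.liminf_eq (tendsto_const_nhds.congr' ?_)).symm
  filter_upwards [hω] with n hn
  rw [hn, max_eq_left (M.le_horizon u), min_eq_left (M.le_horizon t)]

end Reduces

end Market

namespace Market

/-! ### Càdlàg versions of closed martingales. -/

section Regularization

variable {Ω : Type*} [mΩ : MeasurableSpace Ω] (M : Market Ω)

/-- The dyadic points of `[0, T]`. -/
def dyadic : Set (Icc (0 : ℝ) M.T) := {x | ∃ n k, x = M.grid n k}

theorem next_mem_dyadic (n : ℕ) (x : Icc (0 : ℝ) M.T) : M.next n x ∈ M.dyadic := ⟨n, _, rfl⟩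

theorem eventually_eq_grid {x : Icc (0 : ℝ) M.T} (hx : x ∈ M.dyadic) :
    ∀ᶠ n in atTop, ∃ k, x = M.grid n k := by
  obtain ⟨n, k, rfl⟩ := hx
  filter_upwards [eventually_ge_atTop n] with m hm
  obtain ⟨j, rfl⟩ := Nat.exists_eq_add_of_le hm
  exact ⟨_, (M.grid_add n j k).symm⟩

theorem tendsto_next_dyadic {u : Icc (0 : ℝ) M.T} (hu : u < M.horizon) :
    Tendsto (fun n => M.next n u) atTop (𝓝[Ioi u ∩ M.dyadic] u) :=
  tendsto_nhdsWithin_iff.2 ⟨M.tendsto_next u,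
    Eventually.of_forall fun n => ⟨M.lt_next n hu, M.next_mem_dyadic n u⟩⟩

/-- The path `f` makes `K` upcrossings of `[a, b]` along dyadic points of `(u, v)`. -/
def Upcrosses (f : Icc (0 : ℝ) M.T → ℝ) (a b : ℝ) :
    ℕ → Icc (0 : ℝ) M.T → Icc (0 : ℝ) M.T → Prop
  | 0, _, _ => True
  | K + 1, u, v => ∃ x ∈ M.dyadic, ∃ y ∈ M.dyadic, u < x ∧ x < y ∧ y < v ∧ f x < a ∧ b < f y ∧
      Upcrosses f a b K u x

variable {M}

theorem Upcrosses.mono {f : Icc (0 : ℝ) M.T → ℝ} {a b : ℝ} {K : ℕ} {u v w : Icc (0 : ℝ) M.T}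
    (h : M.Upcrosses f a b K u v) (hvw : v ≤ w) : M.Upcrosses f a b K u w := by
  cases K with
  | zero => trivial
  | succ K =>
    obtain ⟨x, hx, y, hy, h1, h2, h3, h4⟩ := h
    exact ⟨x, hx, y, hy, h1, h2, h3.trans_le hvw, h4⟩

/-- The finitely many dyadic points involved all belong to every sufficiently fine grid, where the
discrete upcrossing count sees them. -/
theorem Upcrosses.le_upcrossingsBefore {Y : Icc (0 : ℝ) M.T → Ω → ℝ} {ω : Ω} {a b : ℝ}
    (hab : a < b) {K : ℕ} {u v : Icc (0 : ℝ) M.T}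
    (h : M.Upcrosses (fun u => Y u ω) a b K u v) :
    ∀ᶠ n in atTop, ∀ m, v ≤ M.grid n m →
      K ≤ upcrossingsBefore a b (fun k => Y (M.grid n k)) m ω := by
  induction K generalizing v with
  | zero => exact Eventually.of_forall fun n m _ => Nat.zero_le _
  | succ K ih =>
    obtain ⟨x, hx, y, hy, -, hxy, hyv, hxa, hyb, hK⟩ := h
    filter_upwards [M.eventually_eq_grid hx, M.eventually_eq_grid hy, ih hK] with n h1 h2 h3 m hm
    obtain ⟨i, rfl⟩ := h1
    obtain ⟨j, rfl⟩ := h2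
    have hij : i ≤ j := ((M.grid_mono n).reflect_lt hxy).le
    have hjm : j + 1 ≤ m := (M.grid_mono n).reflect_lt (hyv.trans_le hm)
    have e1 := upcrossingsBefore_lt_of_exists_upcrossing (f := fun k => Y (M.grid n k)) (ω := ω) hab
      (le_refl i) hxa hij hyb
    exact (Nat.succ_le_of_lt ((h3 i le_rfl).trans_lt e1)).trans (upcrossingsBefore_mono hab hjm ω)

/-- The path `f` is regular along the dyadic points: it is bounded, and makes finitely many
upcrossings of every interval. -/
def RegularPath (M : Market Ω) (f : Icc (0 : ℝ) M.T → ℝ) : Prop :=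
  (∃ C, ∀ q ∈ M.dyadic, |f q| ≤ C) ∧
    ∀ a b : ℚ, a < b → ∃ K, ∀ u v, ¬ M.Upcrosses f a b K u v

variable {f : Icc (0 : ℝ) M.T → ℝ}

/-- A bounded path without a limit along `l` is frequently below some rational `a` and above some
rational `b > a`; the hypothesis `H` turns this into arbitrarily many upcrossings. -/
theorem RegularPath.exists_tendsto (h : M.RegularPath f) {l : Filter (Icc (0 : ℝ) M.T)}
    (hl : M.dyadic ∈ l)
    (H : ∀ a b : ℚ, a < b → (∃ᶠ x in l, f x < a) → (∃ᶠ x in l, b < f x) → ∀ K, ∃ u v,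
      M.Upcrosses f a b K u v) : ∃ c, Tendsto f l (𝓝 c) := by
  obtain ⟨C, hC⟩ := h.1
  refine tendsto_of_no_upcrossings Rat.isDenseEmbedding_coe_real.dense ?_
    ⟨C, ?_⟩ ⟨-C, ?_⟩
  · rintro _ ⟨a, rfl⟩ _ ⟨b, rfl⟩ hab ⟨h1, h2⟩
    obtain ⟨K, hK⟩ := h.2 a b (by exact_mod_cast hab)
    obtain ⟨u, v, huv⟩ := H a b (by exact_mod_cast hab) h1 h2 K
    exact hK u v huv
  · rw [eventually_map]
    filter_upwards [hl] with x hx using (abs_le.1 (hC x hx)).2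
  · rw [eventually_map]
    filter_upwards [hl] with x hx using (abs_le.1 (hC x hx)).1

theorem RegularPath.exists_right_limit (h : M.RegularPath f) (u : Icc (0 : ℝ) M.T) :
    ∃ c, Tendsto f (𝓝[Ioi u ∩ M.dyadic] u) (𝓝 c) := by
  have hmem : Ioi u ∩ M.dyadic ∈ 𝓝[Ioi u ∩ M.dyadic] u := self_mem_nhdsWithin
  refine h.exists_tendsto (mem_of_superset hmem inter_subset_right) fun a b _ h1 h2 K => ?_
  have hu : ∃ v, u < v := by
    obtain ⟨x, -, hx⟩ := (h1.and_eventually hmem).exists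
    exact ⟨x, hx.1⟩
  -- `Upcrosses` lists the last upcrossing first, so the points can be chosen successively closer to
  -- `u` from the right.
  suffices ∀ K, ∀ v, u < v → M.Upcrosses f a b K u v by
    obtain ⟨v, hv⟩ := hu
    exact ⟨u, v, this K v hv⟩
  intro K
  induction K with
  | zero => exact fun _ _ => trivial
  | succ K ih =>
    intro v hv
    have small : ∀ w, u < w → ∀ᶠ x in 𝓝[Ioi u ∩ M.dyadic] u, x < w := fun w hw =>
      nhdsWithin_le_nhds (eventually_lt_nhds hw)
    obtain ⟨y, hy, hy', hyv⟩ := (h2.and_eventually ((eventually_of_mem hmem fun x hx => hx).and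
      (small v hv))).exists
    obtain ⟨x, hx, hx', hxy⟩ := (h1.and_eventually ((eventually_of_mem hmem fun x hx => hx).and
      (small y hy'.1))).exists
    exact ⟨x, hx'.2, y, hy'.2, hx'.1, hxy, hyv, hx, hy, ih x hx'.1⟩

theorem RegularPath.exists_left_limit (h : M.RegularPath f) (u : Icc (0 : ℝ) M.T) :
    ∃ c, Tendsto f (𝓝[Iio u ∩ M.dyadic] u) (𝓝 c) := by
  have hmem : Iio u ∩ M.dyadic ∈ 𝓝[Iio u ∩ M.dyadic] u := self_mem_nhdsWithin
  refine h.exists_tendsto (mem_of_superset hmem inter_subset_right) fun a b _ h1 h2 K => ?_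
  obtain ⟨w, hw⟩ : ∃ w, w < u := by
    obtain ⟨x, -, hx⟩ := (h1.and_eventually hmem).exists
    exact ⟨x, hx.1⟩
  suffices ∀ K, ∃ v, w ≤ v ∧ v < u ∧ M.Upcrosses f a b K w v by
    obtain ⟨v, -, -, hv⟩ := this K
    exact ⟨w, v, hv⟩
  intro K
  induction K with
  | zero => exact ⟨w, le_rfl, hw, trivial⟩
  | succ K ih =>
    obtain ⟨v, hwv, hvu, hK⟩ := ih
    have large : ∀ w, w < u → ∀ᶠ x in 𝓝[Iio u ∩ M.dyadic] u, w < x := fun w hw =>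
      nhdsWithin_le_nhds (eventually_gt_nhds hw)
    obtain ⟨x, hx, hx', hxv⟩ := (h1.and_eventually ((eventually_of_mem hmem fun x hx => hx).and
      (large v hvu))).exists
    obtain ⟨y, hy, hy', hyx⟩ := (h2.and_eventually ((eventually_of_mem hmem fun x hx => hx).and
      (large x hx'.1))).exists
    -- The new upcrossing is added on the right of the earlier ones; its end must still be strictly
    -- below `u` so that the induction can continue.
    obtain ⟨n, k, hz1, hz2⟩ := M.exists_grid_between hy'.1
    exact ⟨_, hwv.trans (hxv.trans (hyx.trans hz1)).le, hz2, x, hx'.2, y, hy'.2,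
      hwv.trans_lt hxv, hyx, hz1, hx, hy, hK.mono hxv.le⟩

theorem mem_of_right_limit {g : Icc (0 : ℝ) M.T → ℝ} {w : Icc (0 : ℝ) M.T} (hw : w < M.horizon)
    (hg : Tendsto f (𝓝[Ioi w ∩ M.dyadic] w) (𝓝 (g w))) {I : Set (Icc (0 : ℝ) M.T)}
    (hI : I ∈ 𝓝 w) {C : Set ℝ} (hC : IsClosed C) (h : ∀ q ∈ I ∩ M.dyadic, f q ∈ C) :
    g w ∈ C := by
  have hg' := hg.comp (M.tendsto_next_dyadic hw)
  refine hC.mem_of_tendsto hg' ?_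
  filter_upwards [(M.tendsto_next w).eventually hI] with n hn
  exact h _ ⟨hn, M.next_mem_dyadic n w⟩

/-- Each value of `g` before the horizon is a limit of dyadic values of `f` taken nearby. If these
lie in a closed neighbourhood, so does `g`; hence `g` inherits the one-sided limits of `f`. -/
theorem RegularPath.isCadlagOn (h : M.RegularPath f) {g : Icc (0 : ℝ) M.T → ℝ}
    (hg : ∀ u, u < M.horizon → Tendsto f (𝓝[Ioi u ∩ M.dyadic] u) (𝓝 (g u))) :
    IsCadlagOn M.start M.horizon g := by
  intro u hu
  constructor
  · rw [Icc_horizon]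
    rcases (M.le_horizon u).lt_or_eq with hlt | heq
    · rw [← continuousWithinAt_Ioi_iff_Ici]
      refine (closed_nhds_basis (g u)).tendsto_right_iff.2 fun C ⟨hC, hC'⟩ => ?_
      obtain ⟨U, hU, huU, hUC⟩ := mem_nhdsWithin.1 ((hg u hlt).eventually hC)
      rw [eventually_nhdsWithin_iff]
      filter_upwards [hU.mem_nhds huU, Iio_mem_nhds hlt] with w hw hwT huw
      refine mem_of_right_limit hwT (hg w hwT) (I := U ∩ Ioi u)
        ((hU.inter isOpen_Ioi).mem_nhds ⟨hw, huw⟩) hC' fun q hq => hUC ⟨hq.1.1, hq.1.2, hq.2⟩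
    · have : Ici u = {u} := by
        ext v
        rw [mem_Ici, mem_singleton_iff]
        exact ⟨fun hv => le_antisymm (heq ▸ M.le_horizon v) hv, fun hv => hv ▸ le_rfl⟩
      rw [this]
      exact continuousWithinAt_singleton
  · obtain ⟨c, hc⟩ := h.exists_left_limit u
    refine ⟨c, (closed_nhds_basis c).tendsto_right_iff.2 fun C ⟨hC, hC'⟩ => ?_⟩
    obtain ⟨U, hU, huU, hUC⟩ := mem_nhdsWithin.1 (hc.eventually hC)
    rw [eventually_nhdsWithin_iff]
    filter_upwards [hU.mem_nhds huU] with w hw hwu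
    have hwT : w < M.horizon := hwu.2.trans_le (M.le_horizon u)
    exact mem_of_right_limit hwT (hg w hwT) (I := U ∩ Iio u)
      ((hU.inter isOpen_Iio).mem_nhds ⟨hw, hwu.2⟩) hC' fun q hq => hUC ⟨hq.1.1, hq.1.2, hq.2⟩

/-- The filtration sampled along the `n`-th dyadic grid. -/
noncomputable def gridFiltration (M : Market Ω) (n : ℕ) : Filtration ℕ mΩ where
  seq k := M.𝓕 (M.grid n k)
  mono' _ _ h := M.𝓕.mono (M.grid_mono n h)
  le' _ := M.𝓕.le _

theorem martingale_grid {Q : Measure Ω} {Y : Icc (0 : ℝ) M.T → Ω → ℝ} (hY : Martingale Y M.𝓕 Q)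
    (n : ℕ) : Martingale (fun k => Y (M.grid n k)) (M.gridFiltration n) Q :=
  ⟨fun _ => hY.1 _, fun _ _ h => hY.2 _ _ (M.grid_mono n h)⟩

/-- Doob's maximal inequality on each grid has a bound independent of the grid; letting the grid
refine and then the level `c` grow leaves a null set. -/
theorem ae_bounded_dyadic {Q : Measure Ω} [IsFiniteMeasure Q] {Y : Icc (0 : ℝ) M.T → Ω → ℝ}
    (hY : Martingale Y M.𝓕 Q) (h0 : ∀ u ω, 0 ≤ Y u ω) :
    ∀ᵐ ω ∂Q, ∃ C, ∀ q ∈ M.dyadic, |Y q ω| ≤ C := by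
  let A : NNReal → ℕ → Set Ω := fun c n =>
    {ω | (c : ℝ) ≤ (Finset.range (2 ^ n + 1)).sup' Finset.nonempty_range_add_one
      fun k => Y (M.grid n k) ω}
  have hmono : ∀ c, Monotone (A c) := fun c => monotone_nat_of_le_succ fun n ω hω => by
    simp only [A, mem_ofPred_eq, Finset.le_sup'_iff, Finset.mem_range] at hω ⊢
    obtain ⟨k, hk, hck⟩ := hω
    exact ⟨2 * k, by rw [pow_succ]; omega, by rwa [M.grid_succ]⟩
  have hA : ∀ (c : NNReal) n, (c : ℝ≥0∞) * Q (A c n) ≤ ENNReal.ofReal (∫ ω, Y M.horizon ω ∂Q) := by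
    intro c n
    have := maximal_ineq (martingale_grid hY n).submartingale (fun k ω => h0 _ ω) (ε := c) (2 ^ n)
    simp only [grid_last] at this
    refine (le_trans (le_of_eq ?_) this).trans (ENNReal.ofReal_le_ofReal
      (setIntegral_le_integral (hY.integrable _) (ae_of_all _ (h0 _))))
    rfl
  have hU : ∀ c : NNReal, (c : ℝ≥0∞) * Q (⋃ n, A c n) ≤ ENNReal.ofReal (∫ ω, Y M.horizon ω ∂Q) := by
    intro c
    rw [(hmono c).measure_iUnion, ENNReal.mul_iSup]
    exact iSup_le fun n => hA c n
  have hzero : Q (⋂ c : ℕ, ⋃ n, A c n) = 0 := by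
    by_contra hne
    have hb : ∀ c : ℕ, (c : ℝ≥0∞) * Q (⋂ c : ℕ, ⋃ n, A c n) ≤
        ENNReal.ofReal (∫ ω, Y M.horizon ω ∂Q) := fun c =>
      (mul_le_mul_right (measure_mono (iInter_subset _ c)) _).trans (by exact_mod_cast hU c)
    obtain ⟨c, hc⟩ := ENNReal.exists_nat_mul_gt hne
      (ENNReal.ofReal_ne_top (r := ∫ ω, Y M.horizon ω ∂Q))
    exact absurd (hb c) (not_le.2 hc)
  filter_upwards [measure_eq_zero_iff_ae_notMem.1 hzero] with ω hω
  simp only [mem_iInter, mem_iUnion, not_forall, not_exists] at hω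
  obtain ⟨c, hc⟩ := hω
  refine ⟨c, fun q ⟨n, k, hq⟩ => ?_⟩
  rw [abs_of_nonneg (h0 _ _)]
  by_contra hlt
  -- Indices beyond `2 ^ n` only repeat the horizon, so the finite maximum covers the whole grid.
  have hlast : M.grid n (min k (2 ^ n)) = M.grid n k := by
    rcases le_total k (2 ^ n) with h | h
    · rw [min_eq_left h]
    · rw [min_eq_right h]
      exact le_antisymm (M.grid_mono n h) (by rw [grid_last]; exact M.le_horizon _)
  refine hc n ?_
  simp only [A, mem_ofPred_eq, Finset.le_sup'_iff, Finset.mem_range]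
  exact ⟨min k (2 ^ n), by omega, by rw [hlast, ← hq]; simpa using (not_le.1 hlt).le⟩

/-- Doob's upcrossing inequality bounds the expected count on every grid by the same constant, and
Fatou's lemma makes the limiting count almost surely finite. -/
theorem ae_finite_upcrossings {Q : Measure Ω} [IsFiniteMeasure Q] {Y : Icc (0 : ℝ) M.T → Ω → ℝ}
    (hY : Martingale Y M.𝓕 Q) {a b : ℝ} (hab : a < b) :
    ∀ᵐ ω ∂Q, ∃ K, ∀ u v, ¬ M.Upcrosses (fun u => Y u ω) a b K u v := by
  let U : ℕ → Ω → ℕ := fun n => upcrossingsBefore a b (fun k => Y (M.grid n k)) (2 ^ n)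
  have hm : ∀ n, Measurable fun ω => (U n ω : ℝ≥0∞) := fun n =>
    measurable_from_top.comp ((martingale_grid hY n).1.measurable_upcrossingsBefore hab)
  have hE : ∀ n, ∫⁻ ω, (U n ω : ℝ≥0∞) ∂Q ≤
      ENNReal.ofReal ((b - a)⁻¹ * ∫ ω, (Y M.horizon ω - a)⁺ ∂Q) := by
    intro n
    have h1 :=
      (martingale_grid hY n).submartingale.mul_integral_upcrossingsBefore_le_integral_pos_part
      a b (2 ^ n)
    simp only [grid_last] at h1
    have h2 := (martingale_grid hY n).1.integrable_upcrossingsBefore (μ := Q) (N := 2 ^ n) hab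
    have h3 : ∫⁻ ω, (U n ω : ℝ≥0∞) ∂Q = ENNReal.ofReal (∫ ω, (U n ω : ℝ) ∂Q) := by
      rw [ofReal_integral_eq_lintegral_ofReal h2 (ae_of_all _ fun ω => by positivity)]
      simp only [ENNReal.ofReal_natCast, U]
    rw [h3]
    refine ENNReal.ofReal_le_ofReal ?_
    rwa [le_inv_mul_iff₀ (sub_pos.2 hab)]
  have hF : ∫⁻ ω, liminf (fun n => (U n ω : ℝ≥0∞)) atTop ∂Q ≠ ∞ := by
    refine ne_top_of_le_ne_top
      (ENNReal.ofReal_ne_top (r := (b - a)⁻¹ * ∫ ω, (Y M.horizon ω - a)⁺ ∂Q))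
      ((lintegral_liminf_le hm).trans
      (liminf_le_of_le (by isBoundedDefault) fun c hc => ?_))
    obtain ⟨n, hn⟩ := hc.exists
    exact hn.trans (hE n)
  filter_upwards [ae_lt_top (.liminf hm) hF] with ω hω
  obtain ⟨K, hK⟩ := ENNReal.exists_nat_gt hω.ne
  refine ⟨K, fun u v h => ?_⟩
  refine absurd hK (not_lt.2 ?_)
  refine le_liminf_of_le (by isBoundedDefault) ?_
  filter_upwards [h.le_upcrossingsBefore hab] with n hn
  exact_mod_cast hn (2 ^ n) (by rw [grid_last]; exact M.le_horizon v)

/-- **Càdlàg modification** of a nonnegative closed martingale under the usual conditions. -/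
theorem exists_cadlag_condExp {Q : Measure Ω} [IsProbabilityMeasure Q]
    (hPQ : M.P ≪ Q) {V : Ω → ℝ} (hV : Integrable V Q) (h0 : 0 ≤ᵐ[Q] V) :
    ∃ N : Icc (0 : ℝ) M.T → Ω → ℝ, (∀ u, Measurable[M.𝓕 u] (N u)) ∧
      (∀ u, N u =ᵐ[Q] Q[V | M.𝓕 u]) ∧
      ∀ᵐ ω ∂M.P, IsCadlagOn M.start M.horizon fun u => N u ω := by
  classical
  let Y : Icc (0 : ℝ) M.T → Ω → ℝ := fun u ω => max (Q[V | M.𝓕 u] ω) 0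
  have hYae : ∀ u, Y u =ᵐ[Q] Q[V | M.𝓕 u] := fun u => by
    filter_upwards [condExp_nonneg (m := M.𝓕 u) h0] with ω hω using max_eq_left hω
  have hYm : ∀ u, StronglyMeasurable[M.𝓕 u] (Y u) := fun u =>
    (continuous_id.max continuous_const).comp_stronglyMeasurable
      (stronglyMeasurable_condExp (m := M.𝓕 u) (μ := Q) (f := V))
  have hY : Martingale Y M.𝓕 Q := by
    refine ⟨hYm, fun u v huv => ?_⟩
    exact (condExp_congr_ae (hYae v)).trans
      ((condExp_condExp_of_le (M.𝓕.mono huv) (M.𝓕.le v)).trans (hYae u).symm)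
  have hY0 : ∀ u ω, 0 ≤ Y u ω := fun u ω => le_max_right _ _
  have hreg : ∀ᵐ ω ∂Q, M.RegularPath fun u => Y u ω := by
    have : ∀ᵐ ω ∂Q, ∀ a b : ℚ, a < b → ∃ K, ∀ u v, ¬ M.Upcrosses (fun u => Y u ω) a b K u v := by
      rw [ae_all_iff]; intro a; rw [ae_all_iff]; intro b
      by_cases hab : a < b
      · filter_upwards [ae_finite_upcrossings hY (a := a) (b := b) (by exact_mod_cast hab)]
          with ω hω _ using hω
      · exact ae_of_all _ fun ω h => absurd h hab
    filter_upwards [ae_bounded_dyadic hY hY0, this] with ω h1 h2 using ⟨h1, h2⟩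
  -- Right limits along dyadic times; at the horizon, which has no later times, the value itself is
  -- kept.
  let N : Icc (0 : ℝ) M.T → Ω → ℝ := fun u ω =>
    if u = M.horizon then Y u ω else limUnder atTop fun n => Y (M.next n u) ω
  have hlim : ∀ ω, M.RegularPath (fun u => Y u ω) → ∀ u, u < M.horizon →
      Tendsto (fun v => Y v ω) (𝓝[Ioi u ∩ M.dyadic] u) (𝓝 (N u ω)) := by
    intro ω hω u hu
    obtain ⟨c, hc⟩ := hω.exists_right_limit u
    have : N u ω = c := by
      simp only [N, if_neg hu.ne]
      exact (hc.comp (M.tendsto_next_dyadic hu)).limUnder_eq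
    rwa [this]
  have hseq : ∀ u, u < M.horizon →
      ∀ᵐ ω ∂Q, Tendsto (fun n => Y (M.next n u) ω) atTop (𝓝 (N u ω)) := fun u hu => by
    filter_upwards [hreg] with ω hω
    exact (hlim ω hω u hu).comp (M.tendsto_next_dyadic hu)
  have hNm : ∀ u, Measurable[M.𝓕 u] (N u) := by
    intro u
    rcases (M.le_horizon u).lt_or_eq with hu | hu
    -- The limit looks only at times just after `u`, so it is `𝓕 v`-measurable for each `v > u`;
    -- right-continuity of the filtration does the rest.
    · have hv : ∀ v > u, Measurable[M.𝓕 v] (N u) := fun v hv => by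
        obtain ⟨n₀, hn₀⟩ := eventually_atTop.1
          ((M.tendsto_next u).eventually (eventually_le_nhds hv))
        refine measurable_of_ae_tendsto (f := fun n => Y (M.next (n + n₀) u))
          (fun n => ((hYm _).measurable).mono (M.𝓕.mono (hn₀ _ (Nat.le_add_left _ _))) le_rfl) ?_
        filter_upwards [hPQ.ae_le (hseq u hu)] with ω hω
        exact (tendsto_add_atTop_iff_nat n₀).2 hω
      intro E hE
      refine M.rightContinuous u hu _ ?_
      simp only [MeasurableSpace.measurableSet_iInf]
      exact fun v hvu => hv v hvu hE
    · have : N u = Y u := funext fun ω => if_pos hu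
      rw [this]
      exact (hYm u).measurable
  refine ⟨N, hNm, fun u => ?_, ?_⟩
  · rcases (M.le_horizon u).lt_or_eq with hu | hu
    · obtain ⟨h1, h2⟩ := tendsto_setIntegral_of_condExp hV (fun n => M.𝓕.le (M.next n u))
        (fun n => hYae (M.next n u)) (hseq u hu)
      refine ae_eq_condExp_of_forall_setIntegral_eq (M.𝓕.le u) hV (fun _ _ _ => h1.integrableOn)
        (fun A hA _ => tendsto_nhds_unique (h2 A) ?_) (hNm u).stronglyMeasurable.aestronglyMeasurable
      refine tendsto_const_nhds.congr fun n => ?_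
      rw [setIntegral_congr_ae (M.𝓕.le u A hA) ((hYae (M.next n u)).mono fun ω h _ => h),
        setIntegral_condExp (M.𝓕.le _) hV (M.𝓕.mono (M.le_next n u) A hA)]
    · have : N u = Y u := funext fun ω => if_pos hu
      rw [this]
      exact hYae u
  · filter_upwards [hPQ.ae_le hreg] with ω hω
    exact hω.isCadlagOn (hlim ω hω)

end Regularization

end Market

namespace Market

/-! ### Optional sampling for càdlàg versions of closed martingales. -/

section ClosedMartingale

theorem measurableSet_horizon {Ω : Type*} [mΩ : MeasurableSpace Ω] (M : Market Ω) {A : Set Ω}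
    (hA : MeasurableSet A) : MeasurableSet[M.𝓕 M.horizon] A := by
  have := M.eq_top
  rw [horizon, this]
  exact hA

variable {Ω : Type*} [mΩ : MeasurableSpace Ω] {M : Market Ω}

/-- `N` is an adapted càdlàg version of the martingale `E_Q[V | 𝓕 u]`. -/
structure IsCadlagVersion (M : Market Ω) (Q : Measure Ω) (V : Ω → ℝ)
    (N : Icc (0 : ℝ) M.T → Ω → ℝ) : Prop where
  adapted : ∀ u, Measurable[M.𝓕 u] (N u)
  ae_eq : ∀ u, N u =ᵐ[Q] Q[V | M.𝓕 u]
  cadlag : ∀ᵐ ω ∂M.P, IsCadlagOn M.start M.horizon fun u => N u ω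

variable {Q : Measure Ω} {V : Ω → ℝ} {N : Icc (0 : ℝ) M.T → Ω → ℝ}

namespace IsCadlagVersion

theorem rightCont (h : M.IsCadlagVersion Q V N) (s : Icc (0 : ℝ) M.T) :
    ∀ᵐ ω ∂M.P, M.RightCont s fun u => N u ω := by
  filter_upwards [h.cadlag] with ω hω u hu
  exact RightCont.of_isCadlagOn hω u (M.start_le u)

theorem ae_forall_nonneg (h : M.IsCadlagVersion Q V N) (hPQ : M.P ≪ Q) (h0 : 0 ≤ᵐ[Q] V) :
    ∀ᵐ ω ∂M.P, ∀ u, 0 ≤ N u ω := by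
  have := ae_forall_le (Q := M.P) (s := M.start) (t := M.horizon) (M.start_le _)
    (X := fun _ _ => 0) (Y := N) (ae_of_all _ fun ω u hu => continuousWithinAt_const)
    (h.rightCont _) fun u _ _ => ?_
  · filter_upwards [this] with ω hω u using hω u (M.start_le u) (M.le_horizon u)
  · refine hPQ.ae_le ?_
    filter_upwards [h.ae_eq u, condExp_nonneg (m := M.𝓕 u) h0] with ω h1 h2
    rw [h1]
    exact h2

theorem isPosAdapted (h : M.IsCadlagVersion Q V N) (hPQ : M.P ≪ Q) (h0 : 0 ≤ᵐ[Q] V)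
    (s : Icc (0 : ℝ) M.T) : M.IsPosAdapted s N where
  adapted u _ := h.adapted u
  rightCont := h.rightCont s
  nonneg := (h.ae_forall_nonneg hPQ h0).mono fun _ hω u _ => hω u

variable [IsProbabilityMeasure Q]

theorem ae_eq_of_measurable (h : M.IsCadlagVersion Q V N) {t : Icc (0 : ℝ) M.T}
    (hV : Measurable[M.𝓕 t] V) (hVi : Integrable V Q) {u : Icc (0 : ℝ) M.T} (htu : t ≤ u) :
    N u =ᵐ[Q] V := by
  have := h.ae_eq u
  rwa [condExp_of_stronglyMeasurable (M.𝓕.le u)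
    (hV.mono (M.𝓕.mono htu) le_rfl).stronglyMeasurable hVi] at this

theorem isMartingaleOn (h : M.IsCadlagVersion Q V N) (s : Icc (0 : ℝ) M.T) :
    IsMartingaleOn M.𝓕 Q s M.horizon N where
  adapted u _ := (h.adapted u).stronglyMeasurable
  integrable u _ := integrable_condExp.congr (h.ae_eq u).symm
  condExp_eq u v _ huv _ := (condExp_congr_ae (h.ae_eq v)).trans
    ((condExp_condExp_of_le (M.𝓕.mono huv) (M.𝓕.le v)).trans (h.ae_eq u).symm)

theorem lintegral_sample (h : M.IsCadlagVersion Q V N) (hQP : Q ≪ M.P) (hPQ : M.P ≪ Q)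
    (h0 : 0 ≤ᵐ[Q] V) (hVm : Measurable V) (hV : Integrable V Q) {σ : Ω → Icc (0 : ℝ) M.T}
    (hσ : M.IsStop σ) :
    ∫⁻ ω, ENNReal.ofReal (N (σ ω) ω) ∂Q = ∫⁻ ω, ENNReal.ofReal (V ω) ∂Q := by
  have hp := h.isPosAdapted hPQ h0 M.start
  rw [lintegral_sample_of_isMartingaleOn (h.isMartingaleOn M.start) (hQP.ae_le hp.rightCont)
    (hQP.ae_le hp.nonneg) hσ fun ω => M.start_le _]
  refine lintegral_congr_ae ?_
  have := h.ae_eq_of_measurable (t := M.horizon) (u := M.horizon)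
      (fun _ hE => M.measurableSet_horizon (hVm hE)) hV le_rfl
  filter_upwards [this] with ω hω
  rw [hω]

/-- Optional sampling, integrated against a process at the stopping time. -/
theorem lintegral_sample_mul (h : M.IsCadlagVersion Q V N) (hQP : Q ≪ M.P) (hPQ : M.P ≪ Q)
    (h0 : 0 ≤ᵐ[Q] V) (hVm : Measurable V) (hV : Integrable V Q) {s : Icc (0 : ℝ) M.T}
    {X : Icc (0 : ℝ) M.T → Ω → ℝ} (hX : M.IsPosAdapted s X) {σ : Ω → Icc (0 : ℝ) M.T}
    (hσ : M.IsStop σ) (hs : ∀ ω, s ≤ σ ω) :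
    ∫⁻ ω, ENNReal.ofReal (N (σ ω) ω) * ENNReal.ofReal (X (σ ω) ω) ∂Q =
      ∫⁻ ω, ENNReal.ofReal (V ω) * ENNReal.ofReal (X (σ ω) ω) ∂Q := by
  classical
  have hσ' : IsStoppingTime M.𝓕 fun ω => (σ ω : WithTop (Icc (0 : ℝ) M.T)) := hσ
  have hle : hσ'.measurableSpace ≤ mΩ := IsStoppingTime.measurableSpace_le hσ'
  have hXσ : Measurable fun ω => X (σ ω) ω := hX.measurable_sample' hσ hs
  have hmX : Measurable[hσ'.measurableSpace] fun ω => X (σ ω) ω := by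
    intro E hE
    rw [IsStoppingTime.measurableSet]
    refine ⟨le_iSup M.𝓕 M.horizon _ (M.measurableSet_horizon (hXσ hE)), fun u => ?_⟩
    rcases le_or_gt s u with hu | hu
    · have h1 := hX.measurable_sample (hσ.min (isStop_const u)) (fun ω => le_min (hs ω) hu)
        (fun ω => min_le_right _ _) hu
      convert (h1 hE).inter (hσ.measurableSet_le u) using 1
      ext ω
      simp only [mem_inter_iff, mem_preimage, mem_ofPred_eq, WithTop.coe_le_coe]
      refine and_congr_left fun hω => ?_
      rw [min_eq_left hω]
    · convert MeasurableSet.empty using 1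
      ext ω
      simp only [mem_inter_iff, mem_ofPred_eq, WithTop.coe_le_coe, mem_empty_iff_false, iff_false]
      exact fun hω => absurd (hu.trans_le (hs ω)) (not_lt.2 hω.2)
  have hNσ : Measurable fun ω => ENNReal.ofReal (N (σ ω) ω) :=
    ((h.isPosAdapted hPQ h0 M.start).measurable_sample' hσ fun ω => M.start_le _).ennreal_ofReal
  have hset : ∀ C, MeasurableSet[hσ'.measurableSpace] C →
      ∫⁻ ω in C, ENNReal.ofReal (N (σ ω) ω) ∂Q = ∫⁻ ω in C, ENNReal.ofReal (V ω) ∂Q := by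
    intro C hC
    have hC' := hle C hC
    rw [IsStoppingTime.measurableSet] at hC
    -- Sampling at this time and at the horizon gives the same expectation, and the two differ only
    -- on `C`; this localizes optional sampling to `C`.
    have hst : M.IsStop fun ω => if ω ∈ C then σ ω else M.horizon := by
      rw [isStop_iff]
      intro u
      rcases (M.le_horizon u).lt_or_eq with hu | hu
      · convert hC.2 u using 1
        ext ω
        by_cases hω : ω ∈ C <;> simp [hω, hu]
      · have : {ω | (if ω ∈ C then σ ω else M.horizon) ≤ u} = univ :=
          eq_univ_of_forall fun ω => by
            subst hu
            exact M.le_horizon _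
        rw [this]
        exact MeasurableSet.univ
    have e1 := (h.lintegral_sample hQP hPQ h0 hVm hV hst).trans
      (h.lintegral_sample hQP hPQ h0 hVm hV (isStop_const M.horizon)).symm
    have e2 := h.ae_eq_of_measurable (t := M.horizon) (u := M.horizon)
      (fun _ hE => M.measurableSet_horizon (hVm hE)) hV le_rfl
    rw [← lintegral_add_compl _ hC', ← lintegral_add_compl (fun ω => ENNReal.ofReal
      (N M.horizon ω)) hC'] at e1
    have c1 : ∫⁻ ω in Cᶜ, ENNReal.ofReal (N (if ω ∈ C then σ ω else M.horizon) ω) ∂Q =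
        ∫⁻ ω in Cᶜ, ENNReal.ofReal (N M.horizon ω) ∂Q :=
      setLIntegral_congr_fun hC'.compl fun ω hω => by simp only [if_neg hω]
    have c2 : ∫⁻ ω in C, ENNReal.ofReal (N (if ω ∈ C then σ ω else M.horizon) ω) ∂Q =
        ∫⁻ ω in C, ENNReal.ofReal (N (σ ω) ω) ∂Q :=
      setLIntegral_congr_fun hC' fun ω hω => by simp only [if_pos hω]
    have hfin : ∫⁻ ω in Cᶜ, ENNReal.ofReal (N M.horizon ω) ∂Q ≠ ∞ := by
      refine ne_top_of_le_ne_top ?_ (setLIntegral_le_lintegral _ _)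
      exact ((h.isMartingaleOn M.start).integrable _ ⟨M.start_le _, le_rfl⟩).lintegral_lt_top.ne
    rw [c1, c2, ENNReal.add_left_inj hfin] at e1
    rw [e1]
    refine lintegral_congr_ae ?_
    filter_upwards [ae_restrict_of_ae e2] with ω hω
    rw [hω]
  have hV' : Measurable fun ω => ENNReal.ofReal (V ω) := hVm.ennreal_ofReal
  simp_rw [mul_comm _ (ENNReal.ofReal (X _ _))]
  exact lintegral_mul_congr hle hNσ hV' hset (ENNReal.measurable_ofReal.comp hmX)

theorem one_sub (h : M.IsCadlagVersion Q V N) (hV : Integrable V Q) :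
    M.IsCadlagVersion Q (fun ω => 1 - V ω) fun u ω => 1 - N u ω where
  adapted u := measurable_const.sub (h.adapted u)
  ae_eq u := by
    have h1 := condExp_sub (integrable_const (1 : ℝ)) hV (M.𝓕 u) (μ := Q)
    rw [condExp_const (M.𝓕.le u)] at h1
    filter_upwards [h.ae_eq u, h1] with ω h2 h3
    rw [h2]
    exact h3.symm
  cadlag := by
    filter_upwards [h.cadlag] with ω hω u hu
    obtain ⟨h1, l, h2⟩ := hω u hu
    exact ⟨continuousWithinAt_const.sub h1, 1 - l, tendsto_const_nhds.sub h2⟩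

end IsCadlagVersion

end ClosedMartingale

/-! ### Mixtures of two measures. -/

section Mixture

variable {Ω : Type*} [mΩ : MeasurableSpace Ω] {M : Market Ω}

/-- The mixture of two measures with weights `1 - ε` and `ε`. -/
noncomputable def mix (ε : ℝ) (Q₁ Q₂ : Measure Ω) : Measure Ω :=
  ENNReal.ofReal (1 - ε) • Q₁ + ENNReal.ofReal ε • Q₂

variable {ε : ℝ} {Q₁ Q₂ : Measure Ω}

theorem isProbabilityMeasure_mix [IsProbabilityMeasure Q₁] [IsProbabilityMeasure Q₂]
    (h0 : 0 < ε) (h1 : ε < 1) : IsProbabilityMeasure (mix ε Q₁ Q₂) := by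
  constructor
  simp only [mix, Measure.add_apply, Measure.smul_apply, measure_univ, smul_eq_mul, mul_one]
  rw [← ENNReal.ofReal_add (by linarith) h0.le]
  simp

/-- The density of the first component of a mixture: a `[0, 1]`-valued random variable. -/
theorem exists_density_mix [IsProbabilityMeasure Q₁] [IsProbabilityMeasure Q₂]
    (h0 : 0 < ε) (h1 : ε < 1) :
    ∃ V : Ω → ℝ, Measurable V ∧ (∀ ω, 0 ≤ V ω) ∧ (∀ ω, V ω ≤ 1) ∧
      (∀ f : Ω → ℝ≥0∞, Measurable f → ∫⁻ ω, ENNReal.ofReal (V ω) * f ω ∂(mix ε Q₁ Q₂) =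
        ENNReal.ofReal (1 - ε) * ∫⁻ ω, f ω ∂Q₁) ∧
      ∀ f : Ω → ℝ≥0∞, Measurable f → ∫⁻ ω, ENNReal.ofReal (1 - V ω) * f ω ∂(mix ε Q₁ Q₂) =
        ENNReal.ofReal ε * ∫⁻ ω, f ω ∂Q₂ := by
  have := isProbabilityMeasure_mix (Q₁ := Q₁) (Q₂ := Q₂) h0 h1
  set Q := mix ε Q₁ Q₂ with hQ
  have hle : ENNReal.ofReal (1 - ε) • Q₁ ≤ Q := Measure.le_add_right le_rfl
  have : IsFiniteMeasure (ENNReal.ofReal (1 - ε) • Q₁) := isFiniteMeasure_of_le Q hle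
  set r := (ENNReal.ofReal (1 - ε) • Q₁).rnDeriv Q with hr
  have hr1 : r ≤ᵐ[Q] 1 := Measure.rnDeriv_le_one_of_le hle
  have hrm : Measurable r := Measure.measurable_rnDeriv _ _
  -- Truncation makes the bounds hold everywhere, although the derivative is at most `1` only almost
  -- everywhere.
  let V : Ω → ℝ := fun ω => (min (r ω) 1).toReal
  have hVm : Measurable V := (hrm.min measurable_const).ennreal_toReal
  have hV0 : ∀ ω, 0 ≤ V ω := fun ω => ENNReal.toReal_nonneg
  have hV1 : ∀ ω, V ω ≤ 1 := fun ω => by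
    have := ENNReal.toReal_mono ENNReal.one_ne_top (min_le_right (r ω) 1)
    simpa using this
  have hVr : (fun ω => ENNReal.ofReal (V ω)) =ᵐ[Q] r := by
    filter_upwards [hr1] with ω hω
    have : min (r ω) 1 = r ω := min_eq_left hω
    simp only [V, this]
    exact ENNReal.ofReal_toReal (ne_top_of_le_ne_top ENNReal.one_ne_top hω)
  have m1 : Q.withDensity (fun ω => ENNReal.ofReal (V ω)) = ENNReal.ofReal (1 - ε) • Q₁ := by
    rw [withDensity_congr_ae hVr]
    exact Measure.withDensity_rnDeriv_eq _ _ (Measure.absolutelyContinuous_of_le hle)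
  have m2 : Q.withDensity (fun ω => ENNReal.ofReal (1 - V ω)) = ENNReal.ofReal ε • Q₂ := by
    have hsum : Q.withDensity (fun ω => ENNReal.ofReal (V ω)) +
        Q.withDensity (fun ω => ENNReal.ofReal (1 - V ω)) = Q := by
      rw [← withDensity_add_left hVm.ennreal_ofReal]
      have : ((fun ω => ENNReal.ofReal (V ω)) + fun ω => ENNReal.ofReal (1 - V ω)) = 1 := by
        ext ω
        simp only [Pi.add_apply, Pi.one_apply]
        rw [← ENNReal.ofReal_add (hV0 ω) (by linarith [hV1 ω])]
        simp
      rw [this, withDensity_one]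
    rw [m1] at hsum
    ext B hB
    have e1 : (ENNReal.ofReal (1 - ε) • Q₁ + Q.withDensity (fun ω => ENNReal.ofReal (1 - V ω))) B =
        (ENNReal.ofReal (1 - ε) • Q₁ + ENNReal.ofReal ε • Q₂) B := by
      rw [hsum, hQ, mix]
    rw [Measure.add_apply, Measure.add_apply] at e1
    exact (ENNReal.add_right_inj (measure_ne_top _ _)).1 e1
  refine ⟨V, hVm, hV0, hV1, fun f hf => ?_, fun f hf => ?_⟩
  · have := lintegral_withDensity_eq_lintegral_mul Q hVm.ennreal_ofReal hf
    rw [m1, lintegral_smul_measure] at this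
    exact this.symm
  · have := lintegral_withDensity_eq_lintegral_mul Q
      (measurable_const.sub hVm).ennreal_ofReal (f := fun ω => ENNReal.ofReal (1 - V ω)) hf
    rw [m2, lintegral_smul_measure] at this
    exact this.symm

end Mixture

end Market

namespace Market

/-! ### Nonnegative local martingales. -/

section PosLocMart

variable {Ω : Type*} [mΩ : MeasurableSpace Ω] {M : Market Ω}

/-- The stopping times `τ n` reduce the process `X` on `[s, T]` to martingales. -/
structure IsReducedBy (M : Market Ω) (Q : Measure Ω) (s : Icc (0 : ℝ) M.T)
    (X : Icc (0 : ℝ) M.T → Ω → ℝ) (τ : ℕ → Ω → Icc (0 : ℝ) M.T) : Prop where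
  isStop : ∀ n, M.IsStop (τ n)
  le : ∀ n ω, s ≤ τ n ω
  mono : ∀ᵐ ω ∂M.P, Monotone fun n => τ n ω
  eventually : ∀ᵐ ω ∂M.P, ∀ᶠ n in atTop, τ n ω = M.horizon
  reduces : ∀ n, M.Reduces Q X s (τ n)

/-- `X` is a nonnegative càdlàg local `Q`-martingale on `[s, T]`. -/
structure IsPosLocMart (M : Market Ω) (Q : Measure Ω) (s : Icc (0 : ℝ) M.T)
    (X : Icc (0 : ℝ) M.T → Ω → ℝ) : Prop where
  isProb : IsProbabilityMeasure Q
  ac : Q ≪ M.P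
  adapted : ∀ u, s ≤ u → Measurable[M.𝓕 u] (X u)
  cadlag : ∀ᵐ ω ∂M.P, IsCadlagOn s M.horizon fun u => X u ω
  nonneg : ∀ᵐ ω ∂M.P, ∀ u, s ≤ u → 0 ≤ X u ω
  lintegral_ne_top : ∫⁻ ω, ENNReal.ofReal (X s ω) ∂Q ≠ ∞
  reduced : ∃ τ, M.IsReducedBy Q s X τ

variable {Q : Measure Ω} {s t : Icc (0 : ℝ) M.T} {X : Icc (0 : ℝ) M.T → Ω → ℝ}

theorem IsCadlagOn_mono {s t : Icc (0 : ℝ) M.T} {x : Icc (0 : ℝ) M.T → ℝ}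
    (h : IsCadlagOn s M.horizon x) (hst : s ≤ t) : IsCadlagOn t M.horizon x := fun u hu => by
  obtain ⟨h1, l, h2⟩ := h u ⟨hst.trans hu.1, hu.2⟩
  exact ⟨h1, l, h2.mono_left (nhdsWithin_mono _ (Ico_subset_Ico_left hst))⟩

theorem isCadlagOn_ite {x y : Icc (0 : ℝ) M.T → ℝ} (hx : IsCadlagOn s M.horizon x)
    (hy : IsCadlagOn s M.horizon y) (t : Icc (0 : ℝ) M.T) :
    IsCadlagOn s M.horizon fun u => if u < t then x u else y u := by
  intro u hu
  obtain ⟨hx1, lx, hx2⟩ := hx u hu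
  obtain ⟨hy1, ly, hy2⟩ := hy u hu
  constructor
  · rcases lt_or_ge u t with h | h
    · refine hx1.congr_of_eventuallyEq ?_ (if_pos h)
      filter_upwards [nhdsWithin_le_nhds (Iio_mem_nhds h)] with v hv using if_pos hv
    · exact hy1.congr (fun v hv => if_neg (h.trans hv.1).not_gt) (if_neg h.not_gt)
  · rcases le_or_gt u t with h | h
    · refine ⟨lx, hx2.congr' ?_⟩
      filter_upwards [self_mem_nhdsWithin] with v hv using (if_pos (hv.2.trans_le h)).symm
    · refine ⟨ly, hy2.congr' ?_⟩
      filter_upwards [nhdsWithin_le_nhds (Ioi_mem_nhds h)] with v hv using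
        (if_neg (not_lt.2 (le_of_lt hv))).symm

theorem IsReducedBy.min {τ τ' : ℕ → Ω → Icc (0 : ℝ) M.T} {Q' : Measure Ω}
    {X' : Icc (0 : ℝ) M.T → Ω → ℝ} (h : M.IsReducedBy Q s X τ) (h' : M.IsReducedBy Q' s X' τ') :
    M.IsReducedBy Q s X fun n ω => min (τ n ω) (τ' n ω) where
  isStop n := (h.isStop n).min (h'.isStop n)
  le n ω := le_min (h.le n ω) (h'.le n ω)
  mono := by
    filter_upwards [h.mono, h'.mono] with ω h1 h2 using h1.min h2
  eventually := by
    filter_upwards [h.eventually, h'.eventually] with ω h1 h2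
    filter_upwards [h1, h2] with n h3 h4
    rw [h3, h4, min_self]
  reduces n := (h.reduces n).mono fun ω => min_le_left _ _

namespace IsPosLocMart

theorem isPosAdapted (h : M.IsPosLocMart Q s X) : M.IsPosAdapted s X where
  adapted := h.adapted
  rightCont := h.cadlag.mono fun _ hω => RightCont.of_isCadlagOn hω
  nonneg := h.nonneg

theorem measurable (h : M.IsPosLocMart Q s X) {u : Icc (0 : ℝ) M.T} (hu : s ≤ u) :
    Measurable (X u) := (h.adapted u hu).mono (M.𝓕.le u) le_rfl

theorem setLIntegral_le (h : M.IsPosLocMart Q s X) {u : Icc (0 : ℝ) M.T} (hsu : s ≤ u)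
    (hut : u ≤ t) {B : Set Ω} (hB : MeasurableSet[M.𝓕 u] B) :
    ∫⁻ ω in B, ENNReal.ofReal (X t ω) ∂Q ≤ ∫⁻ ω in B, ENNReal.ofReal (X u ω) ∂Q := by
  obtain ⟨τ, hτ⟩ := h.reduced
  exact setLIntegral_le_of_reduces h.isPosAdapted hτ.reduces hτ.isStop hτ.le
    (h.ac.ae_le hτ.eventually) h.lintegral_ne_top hsu hut hB

theorem lintegral_ne_top' (h : M.IsPosLocMart Q s X) (hst : s ≤ t) :
    ∫⁻ ω, ENNReal.ofReal (X t ω) ∂Q ≠ ∞ := by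
  refine ne_top_of_le_ne_top h.lintegral_ne_top ?_
  simpa using h.setLIntegral_le le_rfl hst MeasurableSet.univ

theorem integrable (h : M.IsPosLocMart Q s X) (hst : s ≤ t) : Integrable (X t) Q := by
  refine ⟨(h.measurable hst).aestronglyMeasurable, ?_⟩
  rw [hasFiniteIntegral_iff_ofReal]
  · exact (h.lintegral_ne_top' hst).lt_top
  · filter_upwards [h.ac.ae_le h.nonneg] with ω hω using hω t hst

theorem restart (h : M.IsPosLocMart Q s X) (hst : s ≤ t) : M.IsPosLocMart Q t X where
  isProb := h.isProb
  ac := h.ac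
  adapted u hu := h.adapted u (hst.trans hu)
  cadlag := h.cadlag.mono fun _ hω => IsCadlagOn_mono hω hst
  nonneg := h.nonneg.mono fun _ hω u hu => hω u (hst.trans hu)
  lintegral_ne_top := h.lintegral_ne_top' hst
  reduced := by
    obtain ⟨τ, hτ⟩ := h.reduced
    -- Raising the localizing times to `t` keeps reduction valid: where `τ n < t`, the only sampling
    -- time left is `t` itself.
    refine ⟨fun n ω => max (τ n ω) t, fun n => (hτ.isStop n).max (isStop_const t),
      fun n ω => le_max_right _ _, ?_, ?_, fun n =>
        (hτ.reduces n).lintegral_eq (hτ.isStop n) (hτ.le n) hst h.lintegral_ne_top⟩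
    · filter_upwards [hτ.mono] with ω hω using hω.max monotone_const
    · filter_upwards [hτ.eventually] with ω hω
      filter_upwards [hω] with n hn
      rw [hn, max_eq_left (M.le_horizon t)]

theorem isLocalMartingaleOn (h : M.IsPosLocMart Q s X) :
    IsLocalMartingaleOn M.𝓕 Q s M.horizon X where
  adapted u hu := (h.adapted u hu.1).stronglyMeasurable
  cadlag := h.ac.ae_le h.cadlag
  localizing := by
    have := h.isProb
    obtain ⟨τ, hτ⟩ := h.reduced
    refine ⟨fun n ω => (τ n ω : WithTop (Icc (0 : ℝ) M.T)), hτ.isStop,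
      fun n ω => WithTop.coe_le_coe.2 (hτ.le n ω), ?_, ?_, fun n =>
        (hτ.reduces n).isMartingaleOn h.ac h.isPosAdapted (hτ.isStop n) (hτ.le n)
          h.lintegral_ne_top⟩
    · filter_upwards [h.ac.ae_le hτ.mono] with ω hω i j hij using WithTop.coe_le_coe.2 (hω hij)
    · filter_upwards [h.ac.ae_le hτ.eventually] with ω hω
      filter_upwards [hω] with n hn using hn ▸ le_rfl

end IsPosLocMart

/-- The spread forces nonnegativity, and equivalence of the measures moves the almost sure
statements from `Q` to `P`. The initial value is integrable because the stopped process has the same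
value at `s`. -/
theorem IsCPSloc.isPosLocMart {l : ℝ} (hl : l ≤ 1) (h : M.IsCPSloc l s Q X) :
    M.IsPosLocMart Q s X := by
  have := h.isProb
  have hadapt : ∀ u, s ≤ u → Measurable[M.𝓕 u] (X u) := fun u hu =>
    (h.localMartingale.adapted u ⟨hu, M.le_horizon u⟩).measurable
  have hcad : ∀ᵐ ω ∂M.P, IsCadlagOn s M.horizon fun u => X u ω :=
    h.ac'.ae_le h.localMartingale.cadlag
  have hnn : ∀ᵐ ω ∂M.P, ∀ u, s ≤ u → 0 ≤ X u ω := by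
    filter_upwards [h.spread] with ω hω u hu
    exact (mul_nonneg (by linarith) (M.pos u ω).le).trans (hω u hu).1
  have hpos : M.IsPosAdapted s X :=
    ⟨hadapt, hcad.mono fun _ hω => RightCont.of_isCadlagOn hω, hnn⟩
  obtain ⟨τ, h1, h2, h3, h4, h5⟩ := h.localMartingale.localizing
  refine ⟨this, h.ac, hadapt, hcad, hnn, ?_, fun n => M.cutoff (τ n), fun n => isStop_cutoff (h1 n),
    fun n ω => ?_, ?_, ?_, fun n => reduces_of_isMartingaleOn h.ac hpos (h2 n) (h5 n)⟩
  · have := (h5 0).integrable s ⟨le_rfl, M.le_horizon s⟩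
    have heq : stoppedProcess X (τ 0) s = X s := by
      ext ω
      exact stoppedProcess_eq_of_le (h2 0 ω)
    rw [heq] at this
    exact this.lintegral_lt_top.ne
  · rw [← WithTop.coe_le_coe, coe_cutoff]
    exact le_min (WithTop.coe_le_coe.2 (M.le_horizon s)) (h2 n ω)
  · filter_upwards [h.ac'.ae_le h3] with ω hω i j hij
    rw [← WithTop.coe_le_coe, coe_cutoff, coe_cutoff]
    exact min_le_min_left _ (hω hij)
  · filter_upwards [h.ac'.ae_le h4] with ω hω
    filter_upwards [hω] with n hn
    rw [← WithTop.coe_inj, coe_cutoff]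
    exact min_eq_left hn

end PosLocMart

/-! ### Change of measure on a smaller σ-algebra. -/

section Weights

/-- A weight that is measurable for the smaller σ-algebra and turns `Q` into `Q'` on a set. -/
theorem exists_weight {Ω : Type*} {m mΩ : MeasurableSpace Ω} (hm : m ≤ mΩ) {Q Q' : Measure Ω}
    [IsProbabilityMeasure Q] [IsProbabilityMeasure Q'] (hac : Q' ≪ Q) {A : Set Ω}
    (hA : MeasurableSet[m] A) :
    ∃ W : Ω → ℝ≥0∞, Measurable[m] W ∧ (∀ ω ∉ A, W ω = 0) ∧
      ∀ f : Ω → ℝ≥0∞, Measurable[m] f → ∫⁻ ω, W ω * f ω ∂Q = ∫⁻ ω in A, f ω ∂Q' := by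
  have hac' : Q'.trim hm ≪ Q.trim hm := hac.trim hm
  set D := (Q'.trim hm).rnDeriv (Q.trim hm) with hD
  have hDm : Measurable[m] D := Measure.measurable_rnDeriv _ _
  refine ⟨A.indicator D, hDm.indicator hA, fun ω hω => indicator_of_notMem hω _, fun f hf => ?_⟩
  have hAf : Measurable[m] (A.indicator f) := hf.indicator hA
  have e1 := lintegral_rnDeriv_mul hac' hAf.aemeasurable
  rw [← hD, lintegral_trim hm hAf, lintegral_trim hm
      (f := fun ω => D ω * A.indicator f ω) (hDm.mul hAf),
    lintegral_indicator (hm _ hA)] at e1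
  rw [← e1]
  refine lintegral_congr fun ω => ?_
  by_cases hω : ω ∈ A <;> simp [hω]

theorem sum_setLIntegral_eq {Ω : Type*} [MeasurableSpace Ω] {κ : Type*} [Fintype κ]
    {Q : Measure Ω} {sel : Ω → κ} (hsel : ∀ i, MeasurableSet {ω | sel ω = i}) (f : Ω → ℝ≥0∞) :
    ∑ i, ∫⁻ ω in {ω | sel ω = i}, f ω ∂Q = ∫⁻ ω, f ω ∂Q := by
  rw [← tsum_fintype (L := SummationFilter.unconditional κ), ← lintegral_iUnion hsel]
  · have : ⋃ i, {ω | sel ω = i} = univ := by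
      ext ω
      simp
    rw [this, Measure.restrict_univ]
  · intro i j hij
    rw [Function.onFun, disjoint_left]
    intro ω h1 h2
    exact hij (h1.symm.trans h2)

end Weights

end Market

namespace Market

/-! ### Backward extension of a price process. -/

section Paste

variable {Ω : Type*} [mΩ : MeasurableSpace Ω] {M : Market Ω}

/-- A nonnegative local martingale that is squeezed at time `t` between multiples of a second one
can be extended to `[s, t]`, staying between the same multiples. -/
theorem IsPosLocMart.exists_extension {Q : Measure Ω} {s t : Icc (0 : ℝ) M.T}
    {X : Icc (0 : ℝ) M.T → Ω → ℝ} (h : M.IsPosLocMart Q s X) (hPQ : M.P ≪ Q) (hst : s ≤ t)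
    {Y : Ω → ℝ} (hY : Measurable[M.𝓕 t] Y) {c d : ℝ} (hc : 0 ≤ c) (hcd' : c ≤ d)
    (hcd : ∀ᵐ ω ∂M.P, c * X t ω ≤ Y ω ∧ Y ω ≤ d * X t ω) :
    ∃ b : Icc (0 : ℝ) M.T → Ω → ℝ, (∀ u, s ≤ u → Measurable[M.𝓕 u] (b u)) ∧
      (∀ᵐ ω ∂M.P, IsCadlagOn s M.horizon fun u => b u ω) ∧ (b t =ᵐ[M.P] Y) ∧
      (∀ᵐ ω ∂M.P, ∀ u, s ≤ u → 0 ≤ b u ω) ∧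
      (∀ᵐ ω ∂M.P, ∀ u, s ≤ u → u ≤ t → c * X u ω ≤ b u ω ∧ b u ω ≤ d * X u ω) ∧
      ∀ τ, M.Reduces Q X s τ → M.Reduces Q b s τ := by
  have := h.isProb
  have hdc : 0 ≤ d - c := sub_nonneg.2 hcd'
  -- Only the excess over `c * X t` needs a conditional expectation; it lies between `0` and `(d -
  -- c) * X t`, hence is integrable. The part `c * X` is already a local martingale.
  set V : Ω → ℝ := fun ω => Y ω - c * X t ω with hVdef
  have hVt : Measurable[M.𝓕 t] V := hY.sub ((h.adapted t hst).const_mul c)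
  have hV : Measurable V := hVt.mono (M.𝓕.le t) le_rfl
  have hV0 : 0 ≤ᵐ[M.P] V := by
    filter_upwards [hcd] with ω hω using sub_nonneg.2 hω.1
  have hVd : ∀ᵐ ω ∂M.P, V ω ≤ (d - c) * X t ω := by
    filter_upwards [hcd] with ω hω
    simp only [hVdef]
    linarith [hω.2]
  have hVi : Integrable V Q := by
    refine ((h.integrable hst).const_mul (d - c)).mono' hV.aestronglyMeasurable ?_
    filter_upwards [h.ac.ae_le hV0, h.ac.ae_le hVd] with ω h1 h2
    rwa [Real.norm_of_nonneg h1]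
  obtain ⟨N, hN1, hN2, hN3⟩ := exists_cadlag_condExp hPQ hVi (h.ac.ae_le hV0)
  have hN : M.IsCadlagVersion Q V N := ⟨hN1, hN2, hN3⟩
  have hNpos := hN.ae_forall_nonneg hPQ (h.ac.ae_le hV0)
  -- Conditioning `V ≤ (d - c) * X t` on `𝓕 u` and using that `X` is a supermartingale gives the
  -- bound at each time; right-continuity makes it simultaneous.
  have hNle : ∀ᵐ ω ∂M.P, ∀ u, s ≤ u → u ≤ t → N u ω ≤ (d - c) * X u ω := by
    refine ae_forall_le hst (hN.rightCont s) (h.isPosAdapted.rightCont.mono fun ω hω u hu =>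
      (hω u hu).const_mul (d - c)) fun u hsu hut => hPQ.ae_le ?_
    have hm := M.𝓕.le u
    have hXu : Measurable[M.𝓕 u] fun ω => ENNReal.ofReal ((d - c) * X u ω) :=
      ENNReal.measurable_ofReal.comp ((h.adapted u hsu).const_mul _)
    have hNu : Measurable[M.𝓕 u] fun ω => ENNReal.ofReal (N u ω) :=
      ENNReal.measurable_ofReal.comp (hN1 u)
    have key : (fun ω => ENNReal.ofReal (N u ω)) ≤ᵐ[Q.trim hm]
        fun ω => ENNReal.ofReal ((d - c) * X u ω) := by
      refine ae_le_of_forall_setLIntegral_le_of_sigmaFinite hNu fun B hB _ => ?_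
      rw [setLIntegral_trim hm hNu hB, setLIntegral_trim hm hXu hB]
      have e1 : ∫⁻ ω in B, ENNReal.ofReal (N u ω) ∂Q = ∫⁻ ω in B, ENNReal.ofReal (V ω) ∂Q := by
        have hi := (hN.isMartingaleOn s).integrable u ⟨hsu, M.le_horizon u⟩
        rw [← ofReal_integral_eq_lintegral_ofReal hi.integrableOn
            (ae_restrict_of_ae (h.ac.ae_le (hNpos.mono fun ω hω => hω u))),
          ← ofReal_integral_eq_lintegral_ofReal hVi.integrableOn
            (ae_restrict_of_ae (h.ac.ae_le hV0)),
          setIntegral_congr_ae (hm B hB) ((hN2 u).mono fun ω hω _ => hω),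
          setIntegral_condExp hm hVi hB]
      rw [e1]
      calc ∫⁻ ω in B, ENNReal.ofReal (V ω) ∂Q
          ≤ ∫⁻ ω in B, ENNReal.ofReal ((d - c) * X t ω) ∂Q := by
            refine lintegral_mono_ae (ae_restrict_of_ae ?_)
            filter_upwards [h.ac.ae_le hVd] with ω hω using ENNReal.ofReal_le_ofReal hω
        _ = ENNReal.ofReal (d - c) * ∫⁻ ω in B, ENNReal.ofReal (X t ω) ∂Q := by
            simp_rw [ENNReal.ofReal_mul hdc]
            exact lintegral_const_mul _ (h.measurable hst).ennreal_ofReal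
        _ ≤ ENNReal.ofReal (d - c) * ∫⁻ ω in B, ENNReal.ofReal (X u ω) ∂Q := by
            exact mul_le_mul' le_rfl (h.setLIntegral_le hsu hut hB)
        _ = ∫⁻ ω in B, ENNReal.ofReal ((d - c) * X u ω) ∂Q := by
            simp_rw [ENNReal.ofReal_mul hdc]
            exact (lintegral_const_mul _ (h.measurable hsu).ennreal_ofReal).symm
    filter_upwards [ae_le_of_ae_le_trim key, h.ac.ae_le h.nonneg] with ω h1 h2
    exact (ENNReal.ofReal_le_ofReal_iff (mul_nonneg hdc (h2 u hsu))).1 h1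
  refine ⟨fun u ω => c * X u ω + N u ω, fun u hu => ((h.adapted u hu).const_mul c).add (hN1 u),
    ?_, ?_, ?_, ?_, ?_⟩
  · filter_upwards [h.cadlag, hN3] with ω h1 h2 u hu
    obtain ⟨h3, l, h4⟩ := h1 u hu
    obtain ⟨h5, l', h6⟩ := IsCadlagOn_mono h2 (M.start_le s) u hu
    exact ⟨(h3.const_mul c).add h5, c * l + l', (h4.const_mul c).add h6⟩
  · filter_upwards [hPQ.ae_le (hN.ae_eq_of_measurable hVt hVi le_rfl)] with ω hω
    rw [hω]
    simp [hVdef]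
  · filter_upwards [h.nonneg, hNpos] with ω h1 h2 u hu
    exact add_nonneg (mul_nonneg hc (h1 u hu)) (h2 u)
  · filter_upwards [hNpos, hNle] with ω h1 h2 u hsu hut
    exact ⟨le_add_of_nonneg_right (h1 u), by linarith [h2 u hsu hut]⟩
  · intro τ hτ σ hσ hs hle
    -- The contribution of `X` is constant by reduction, that of `N` by optional sampling of a
    -- closed martingale at any stopping time.
    have claim : ∀ σ, M.IsStop σ → (∀ ω, s ≤ σ ω) → (∀ ω, σ ω ≤ τ ω) →
        ∫⁻ ω, ENNReal.ofReal (c * X (σ ω) ω + N (σ ω) ω) ∂Q = ENNReal.ofReal c *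
          ∫⁻ ω, ENNReal.ofReal (X s ω) ∂Q + ∫⁻ ω, ENNReal.ofReal (V ω) ∂Q := by
      intro σ hσ hs hle
      have hXσ := h.isPosAdapted.measurable_sample' hσ hs
      rw [← hτ σ hσ hs hle, ← hN.lintegral_sample h.ac hPQ (h.ac.ae_le hV0) hV hVi hσ,
        ← lintegral_const_mul _ hXσ.ennreal_ofReal,
        ← lintegral_add_left (hXσ.ennreal_ofReal.const_mul _)]
      refine lintegral_congr_ae ?_
      filter_upwards [h.ac.ae_le h.nonneg, h.ac.ae_le hNpos] with ω h1 h2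
      rw [ENNReal.ofReal_add (mul_nonneg hc (h1 _ (hs ω))) (h2 _), ENNReal.ofReal_mul hc]
    rw [claim σ hσ hs hle, claim _ (isStop_const s) (fun _ => le_rfl)
      fun ω => (hs ω).trans (hle ω)]

end Paste

end Market

namespace Market

/-! ### Pasting price systems at time `t`. -/

section Paste

theorem measurable_indicator_one {Ω : Type*} {m : MeasurableSpace Ω} {B : Set Ω}
    (hB : MeasurableSet B) : Measurable (B.indicator (1 : Ω → ℝ≥0∞)) :=
  measurable_one.indicator hB

theorem measurable_select {Ω κ β : Type*} [Countable κ] [MeasurableSpace β]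
    {m m' : MeasurableSpace Ω} (hm : m ≤ m') {sel : Ω → κ}
    (hsel : ∀ i, MeasurableSet[m] {ω | sel ω = i}) {g : κ → Ω → β}
    (hg : ∀ i, Measurable[m'] (g i)) : Measurable[m'] fun ω => g (sel ω) ω := by
  intro E hE
  have : (fun ω => g (sel ω) ω) ⁻¹' E = ⋃ i, {ω | sel ω = i} ∩ g i ⁻¹' E := by
    ext ω
    simp
  rw [this]
  exact MeasurableSet.iUnion fun i => (hm _ (hsel i)).inter (hg i hE)

variable {Ω : Type*} [mΩ : MeasurableSpace Ω] {M : Market Ω}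

/-- On `{sel = i}` the measure `ν` has density `dQ' / dQ i`, taken on `𝓕 t`, with respect to `Q i`:
the past then follows `Q'`, while the conditional law after `t` remains that of `Q i`. The last
clause expresses this as Bayes' formula. Before `t`, the process `X` comes from `exists_extension`
under `Q'`. -/
theorem exists_paste {κ : Type*} [Fintype κ] {s t : Icc (0 : ℝ) M.T} (hst : s ≤ t) {sel : Ω → κ}
    (hsel : ∀ i, MeasurableSet[M.𝓕 t] {ω | sel ω = i})
    {Q' : Measure Ω} {S' : Icc (0 : ℝ) M.T → Ω → ℝ} (h' : M.IsPosLocMart Q' s S') (hPQ' : M.P ≪ Q')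
    {Q : κ → Measure Ω} {S : κ → Icc (0 : ℝ) M.T → Ω → ℝ} (h : ∀ i, M.IsPosLocMart (Q i) s (S i))
    (hPQ : ∀ i, M.P ≪ Q i) {c d : ℝ} (hc : 0 ≤ c) (hcd' : c ≤ d)
    (hcd : ∀ i, ∀ᵐ ω ∂M.P, c * S' t ω ≤ S i t ω ∧ S i t ω ≤ d * S' t ω) :
    ∃ (ν : Measure Ω) (X : Icc (0 : ℝ) M.T → Ω → ℝ), M.IsPosLocMart ν s X ∧
      (∀ B, MeasurableSet[M.𝓕 t] B → ν B = Q' B) ∧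
      (∀ u, t ≤ u → ∀ ω, X u ω = S (sel ω) u ω) ∧
      (∀ᵐ ω ∂M.P, ∀ u, s ≤ u → u ≤ t → c * S' u ω ≤ X u ω ∧ X u ω ≤ d * S' u ω) ∧
      ∀ f : κ → Ω → ℝ≥0∞, (∀ i, Measurable (f i)) → ∀ B, MeasurableSet[M.𝓕 t] B →
        ∫⁻ ω in B, f (sel ω) ω ∂ν =
          ∫⁻ ω in B, condLExp (M.𝓕 t) (Q (sel ω)) (f (sel ω)) ω ∂Q' := by
  classical
  have := h'.isProb
  have := fun i => (h i).isProb
  have hsel' : ∀ i, MeasurableSet {ω | sel ω = i} := fun i => M.𝓕.le t _ (hsel i)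
  obtain ⟨b, hb1, hb2, hb3, hb4, hb5, hb6⟩ := h'.exists_extension hPQ' hst
    (Y := fun ω => S (sel ω) t ω) (measurable_select le_rfl hsel fun i => (h i).adapted t hst)
    hc hcd' (by
      filter_upwards [ae_all_iff.2 hcd] with ω hω using hω _)
  have hbpos : M.IsPosAdapted s b :=
    ⟨hb1, hb2.mono fun _ hω => RightCont.of_isCadlagOn hω, hb4⟩
  choose W hW1 hW2 hW3 using fun i =>
    exists_weight (M.𝓕.le t) (Q := Q i) (h'.ac.trans (hPQ i)) (hsel i)
  have hWm : ∀ i, Measurable (W i) := fun i => (hW1 i).mono (M.𝓕.le t) le_rfl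
  let ν : Measure Ω := ∑ i, (Q i).withDensity (W i)
  have hR : ∀ f : Ω → ℝ≥0∞, Measurable f → ∫⁻ ω, f ω ∂ν = ∑ i, ∫⁻ ω, W i ω * f ω ∂(Q i) := by
    intro f hf
    rw [lintegral_finsetSum_measure]
    exact Finset.sum_congr rfl fun i _ => lintegral_withDensity_eq_lintegral_mul _ (hWm i) hf
  have hRt : ∀ f : Ω → ℝ≥0∞, Measurable[M.𝓕 t] f → ∫⁻ ω, f ω ∂ν = ∫⁻ ω, f ω ∂Q' := by
    intro f hf
    rw [hR f (hf.mono (M.𝓕.le t) le_rfl), ← sum_setLIntegral_eq hsel' f]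
    exact Finset.sum_congr rfl fun i _ => hW3 i f hf
  have hRB : ∀ B, MeasurableSet[M.𝓕 t] B → ν B = Q' B := fun B hB => by
    have := hRt (B.indicator 1) (measurable_indicator_one hB)
    rwa [lintegral_indicator_one (M.𝓕.le t B hB), lintegral_indicator_one (M.𝓕.le t B hB)] at this
  let X : Icc (0 : ℝ) M.T → Ω → ℝ := fun u ω => if u < t then b u ω else S (sel ω) u ω
  have hXt : ∀ u, t ≤ u → ∀ ω, X u ω = S (sel ω) u ω := fun u hu ω => if_neg hu.not_gt
  have hXm : ∀ u, s ≤ u → Measurable[M.𝓕 u] (X u) := by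
    intro u hu
    rcases lt_or_ge u t with hut | hut
    · have : X u = b u := funext fun ω => if_pos hut
      rw [this]
      exact hb1 u hu
    · have : X u = fun ω => S (sel ω) u ω := funext fun ω => hXt u hut ω
      rw [this]
      exact measurable_select (M.𝓕.mono hut) hsel fun i => (h i).adapted u hu
  have hXc : ∀ᵐ ω ∂M.P, IsCadlagOn s M.horizon fun u => X u ω := by
    filter_upwards [hb2, ae_all_iff.2 fun i => (h i).cadlag] with ω h1 h2
    exact isCadlagOn_ite h1 (h2 (sel ω)) t
  have hXnn : ∀ᵐ ω ∂M.P, ∀ u, s ≤ u → 0 ≤ X u ω := by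
    filter_upwards [hb4, ae_all_iff.2 fun i => (h i).nonneg] with ω h1 h2 u hu
    simp only [X]
    split_ifs
    exacts [h1 u hu, h2 _ u hu]
  have hXpos : M.IsPosAdapted s X :=
    ⟨hXm, hXc.mono fun _ hω => RightCont.of_isCadlagOn hω, hXnn⟩
  obtain ⟨τ', hτ'⟩ := h'.reduced
  choose τ hτ using fun i => (h i).reduced
  -- Before `t` the times `τ'` reduce the extension `b`; after `t` the times of the selected process
  -- take over. The maximum with `t` makes the choice of index known in time.
  let ρ : ℕ → Ω → Icc (0 : ℝ) M.T := fun n ω => min (τ' n ω) (max (τ (sel ω) n ω) t)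
  have hρ : ∀ n, M.IsStop (ρ n) := by
    intro n
    refine (hτ'.isStop n).min (isStop_iff.2 fun u => ?_)
    rcases lt_or_ge u t with hut | hut
    · convert MeasurableSet.empty using 1
      ext ω
      simp [hut]
    · have : {ω | max (τ (sel ω) n ω) t ≤ u} = ⋃ i, {ω | sel ω = i} ∩ {ω | τ i n ω ≤ u} := by
        ext ω
        simp [hut]
      rw [this]
      exact MeasurableSet.iUnion fun i =>
        (M.𝓕.mono hut _ (hsel i)).inter (((hτ i).isStop n).measurableSet_le u)
  have claim : ∀ n σ, M.IsStop σ → (∀ ω, s ≤ σ ω) → (∀ ω, σ ω ≤ ρ n ω) →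
      ∫⁻ ω, ENNReal.ofReal (X (σ ω) ω) ∂ν = ∫⁻ ω, ENNReal.ofReal (b s ω) ∂Q' := by
    intro n σ hσ hs hle
    have hσt : M.IsStop fun ω => min (σ ω) t := hσ.min (isStop_const t)
    have hbσ : Measurable[M.𝓕 t] fun ω => b (min (σ ω) t) ω :=
      hbpos.measurable_sample hσt (fun ω => le_min (hs ω) hst) (fun ω => min_le_right _ _) hst
    have hlow : MeasurableSet[M.𝓕 t] {ω | σ ω < t} := hσ.measurableSet_lt t
    have hhigh : MeasurableSet[M.𝓕 t] {ω | t ≤ σ ω} := by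
      have := hlow.compl
      simpa [compl_ofPred] using this
    rw [hR _ (hXpos.measurable_sample' hσ hs).ennreal_ofReal,
      ← hb6 _ (hτ'.reduces n) _ hσt (fun ω => le_min (hs ω) hst)
        (fun ω => (min_le_left _ _).trans ((hle ω).trans (min_le_left _ _))),
      ← sum_setLIntegral_eq hsel']
    refine Finset.sum_congr rfl fun i _ => ?_
    -- The part of `σ` after `t`, on `{sel = i}` only; elsewhere `ρ` gives no control by `τ i`, but
    -- there the weight `W i` vanishes.
    let κ' : Ω → Icc (0 : ℝ) M.T := fun ω => if ω ∈ {ω | sel ω = i} then max (σ ω) t else t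
    have hκ' : M.IsStop κ' := (hσ.max (isStop_const t)).ite (isStop_const t) (hsel i)
      (fun ω _ => le_max_right _ _) fun ω _ => le_rfl
    have hκt : ∀ ω, t ≤ κ' ω := fun ω => by
      simp only [κ']
      split_ifs
      exacts [le_max_right _ _, le_rfl]
    have hκτ : ∀ ω, κ' ω ≤ max (τ i n ω) t := fun ω => by
      simp only [κ']
      split_ifs with hω
      · refine max_le ((hle ω).trans ((min_le_right _ _).trans ?_)) (le_max_right _ _)
        rw [show sel ω = i from hω]
      · exact le_max_right _ _
    set f₁ : Ω → ℝ≥0∞ := {ω | σ ω < t}.indicator fun ω => ENNReal.ofReal (b (min (σ ω) t) ω)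
      with hf₁
    set g : Ω → ℝ≥0∞ := {ω | t ≤ σ ω}.indicator 1 with hg
    have hf₁m : Measurable[M.𝓕 t] f₁ := (ENNReal.measurable_ofReal.comp hbσ).indicator hlow
    have hgm : Measurable[M.𝓕 t] g := measurable_indicator_one hhigh
    have hSt : Measurable[M.𝓕 t] fun ω => ENNReal.ofReal (S i t ω) :=
      ENNReal.measurable_ofReal.comp ((h i).adapted t hst)
    -- Split at `t`. The first term is `𝓕 t`-measurable; in the second, reduction replaces `κ'` by
    -- `t`. The weight then carries both to `Q'`, where `b t` equals the selected price at `t`.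
    have e1 : ∀ ω, W i ω * ENNReal.ofReal (X (σ ω) ω) =
        W i ω * f₁ ω + (W i ω * g ω) * ENNReal.ofReal (S i (κ' ω) ω) := by
      intro ω
      by_cases hω : sel ω = i
      · rcases lt_or_ge (σ ω) t with hlt | hge
        · simp [hf₁, hg, X, hlt, hlt.not_ge, hlt.le]
        · have hk : κ' ω = σ ω := by
            simp only [κ']
            rw [if_pos (show ω ∈ {ω | sel ω = i} from hω), max_eq_left hge]
          simp [hf₁, hg, hge.not_gt, hge, hk, hXt _ hge, hω]
      · simp [hW2 i ω hω]
    simp_rw [e1]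
    rw [lintegral_add_left (f := fun ω => W i ω * f₁ ω) ((hWm i).mul (hf₁m.mono (M.𝓕.le t) le_rfl)),
      ((hτ i).reduces n).lintegral_mul_eq (h i).isPosAdapted ((hτ i).isStop n) ((hτ i).le n) hst
        (h i).lintegral_ne_top hκ' hκt hκτ
        (W := fun ω => W i ω * g ω) ((hW1 i).mul hgm)]
    simp_rw [mul_assoc]
    rw [hW3 i _ hf₁m, hW3 i (fun ω => g ω * ENNReal.ofReal (S i t ω)) (hgm.mul hSt),
      ← lintegral_add_left (hf₁m.mono (M.𝓕.le t) le_rfl)]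
    refine lintegral_congr_ae ?_
    filter_upwards [ae_restrict_of_ae (h'.ac.ae_le hb3), ae_restrict_mem (hsel' i)] with ω h1 h2
    rcases lt_or_ge (σ ω) t with hlt | hge
    · simp [hf₁, hg, hlt, hlt.not_ge]
    · have h2' : sel ω = i := h2
      simp [hf₁, hg, hge.not_gt, hge, h1, h2']
  have hRP : ν ≪ M.P := by
    refine Measure.AbsolutelyContinuous.mk fun B hB hPB => ?_
    rw [← lintegral_indicator_one hB, hR _ (measurable_indicator_one hB)]
    refine Finset.sum_eq_zero fun i _ => ?_
    rw [lintegral_eq_zero_iff (f := fun ω => W i ω * B.indicator 1 ω)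
      ((hWm i).mul (measurable_indicator_one hB))]
    filter_upwards [measure_eq_zero_iff_ae_notMem.1 ((h i).ac hPB)] with ω hω
    simp [hω]
  have hRprob : IsProbabilityMeasure ν := ⟨by
    rw [hRB univ MeasurableSet.univ]
    exact measure_univ⟩
  refine ⟨ν, X, ⟨hRprob, hRP, hXm, hXc, hXnn, ?_, ρ, hρ, fun n ω => le_min (hτ'.le n ω)
    (hst.trans (le_max_right _ _)), ?_, ?_, ?_⟩, hRB, hXt, ?_, ?_⟩
  · rw [claim 0 _ (isStop_const s) (fun _ => le_rfl) fun ω => le_min (hτ'.le 0 ω)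
      (hst.trans (le_max_right _ _))]
    have hbs := hb6 _ (hτ'.reduces 0) _ (isStop_const s) (fun _ => le_rfl) (hτ'.le 0)
    refine ne_top_of_le_ne_top (b := ∫⁻ ω, ENNReal.ofReal (d * S' s ω) ∂Q') ?_
      (lintegral_mono_ae ?_)
    · exact ((h'.integrable le_rfl).const_mul d).lintegral_lt_top.ne
    · filter_upwards [h'.ac.ae_le hb5] with ω hω
      exact ENNReal.ofReal_le_ofReal (hω s le_rfl hst).2
  · filter_upwards [hτ'.mono, ae_all_iff.2 fun i => (hτ i).mono] with ω h1 h2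
    exact h1.min ((h2 (sel ω)).max monotone_const)
  · filter_upwards [hτ'.eventually, ae_all_iff.2 fun i => (hτ i).eventually] with ω h1 h2
    filter_upwards [h1, h2 (sel ω)] with n h3 h4
    simp only [ρ, h3, h4]
    rw [max_eq_left (M.le_horizon t), min_self]
  · intro n σ hσ hs hle
    rw [claim n σ hσ hs hle, claim n _ (isStop_const s) (fun _ => le_rfl)
      fun ω => (hs ω).trans (hle ω)]
  · filter_upwards [hb5, hb3] with ω h1 h2 u hsu hut
    rcases hut.lt_or_eq with hlt | rfl
    · simp only [X, if_pos hlt]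
      exact h1 u hsu hut
    · rw [hXt u le_rfl, ← h2]
      exact h1 u hsu le_rfl
  · intro f hf B hB
    have hfm : Measurable fun ω => f (sel ω) ω := measurable_select (M.𝓕.le t) hsel hf
    have hB' := M.𝓕.le t B hB
    rw [← lintegral_indicator hB', hR _ (hfm.indicator hB'), ← lintegral_indicator hB',
      ← sum_setLIntegral_eq hsel']
    refine Finset.sum_congr rfl fun i _ => ?_
    have hcm : Measurable[M.𝓕 t] (condLExp (M.𝓕 t) (Q i) (f i)) := measurable_condLExp _ _ _
    calc ∫⁻ ω, W i ω * B.indicator (fun ω => f (sel ω) ω) ω ∂(Q i)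
        = ∫⁻ ω, (W i ω * B.indicator 1 ω) * f i ω ∂(Q i) := by
          refine lintegral_congr fun ω => ?_
          by_cases hω : sel ω = i
          · by_cases hωB : ω ∈ B <;> simp [hωB, hω]
          · simp [hW2 i ω hω]
      _ = ∫⁻ ω, (W i ω * B.indicator 1 ω) * condLExp (M.𝓕 t) (Q i) (f i) ω ∂(Q i) := by
          refine lintegral_mul_congr (M.𝓕.le t) (hf i) (hcm.mono (M.𝓕.le t) le_rfl)
            (fun A hA => (setLIntegral_condLExp (M.𝓕.le t) _ _ hA).symm)
            ((hW1 i).mul (measurable_indicator_one hB))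
      _ = ∫⁻ ω, W i ω * (B.indicator 1 ω * condLExp (M.𝓕 t) (Q i) (f i) ω) ∂(Q i) := by
          simp_rw [mul_assoc]
      _ = ∫⁻ ω in {ω | sel ω = i}, B.indicator 1 ω * condLExp (M.𝓕 t) (Q i) (f i) ω ∂Q' :=
          hW3 i _ ((measurable_indicator_one hB).mul hcm)
      _ = _ := by
          refine setLIntegral_congr_fun (hsel' i) fun ω hω => ?_
          have hω' : sel ω = i := hω
          by_cases hωB : ω ∈ B <;> simp [hωB, hω']

end Paste

end Market

namespace Market

/-! ### Mixing two price systems. -/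

section MixtureProcess

variable {Ω : Type*} [mΩ : MeasurableSpace Ω] {M : Market Ω}

/-- Two nonnegative local martingales under two measures are mixed to a local martingale under the
mixture of the measures. -/
theorem exists_mixture {ν Q' : Measure Ω} {s t : Icc (0 : ℝ) M.T} {X₁ X₂ : Icc (0 : ℝ) M.T → Ω → ℝ}
    (h₁ : M.IsPosLocMart ν s X₁) (h₂ : M.IsPosLocMart Q' s X₂) (hPQ' : M.P ≪ Q')
    (heq : ∀ B, MeasurableSet[M.𝓕 t] B → ν B = Q' B) {ε : ℝ} (hε0 : 0 < ε) (hε1 : ε < 1) :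
    ∃ (X : Icc (0 : ℝ) M.T → Ω → ℝ) (V : Ω → ℝ), M.IsPosLocMart (mix ε ν Q') s X ∧
      M.P ≪ mix ε ν Q' ∧ Measurable V ∧ (∀ ω, 0 ≤ V ω ∧ V ω ≤ 1) ∧
      (∀ᵐ ω ∂M.P, X M.horizon ω = V ω * X₁ M.horizon ω + (1 - V ω) * X₂ M.horizon ω) ∧
      (∀ᵐ ω ∂M.P, ∀ u, s ≤ u → ∃ θ : ℝ, 0 ≤ θ ∧ θ ≤ 1 ∧ X u ω = θ * X₁ u ω + (1 - θ) * X₂ u ω ∧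
        (u ≤ t → θ = 1 - ε)) ∧
      ∀ f : Ω → ℝ≥0∞, Measurable f → ∫⁻ ω, ENNReal.ofReal (V ω) * f ω ∂(mix ε ν Q') =
        ENNReal.ofReal (1 - ε) * ∫⁻ ω, f ω ∂ν := by
  have := h₁.isProb
  have := h₂.isProb
  have hprob := isProbabilityMeasure_mix (Q₁ := ν) (Q₂ := Q') hε0 hε1
  obtain ⟨V, hVm, hV0, hV1, hVf₁, hVf₂⟩ := exists_density_mix (Q₁ := ν) (Q₂ := Q') hε0 hε1
  set Q := mix ε ν Q' with hQ
  have hQP : Q ≪ M.P := by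
    refine Measure.AbsolutelyContinuous.mk fun B _ hB => ?_
    simp [hQ, mix, h₁.ac hB, h₂.ac hB]
  -- Only the `Q'` component is used, so equivalence of `ν` to `P` is not required.
  have hPQ : M.P ≪ Q := by
    refine hPQ'.trans (Measure.AbsolutelyContinuous.mk fun B _ hB => ?_)
    simp only [hQ, mix, Measure.add_apply, Measure.smul_apply, smul_eq_mul, add_eq_zero,
      mul_eq_zero, ENNReal.ofReal_eq_zero] at hB
    exact hB.2.resolve_left (not_le.2 hε0)
  have hVi : Integrable V Q := Integrable.of_bound hVm.aestronglyMeasurable 1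
    (ae_of_all _ fun ω => by rw [Real.norm_of_nonneg (hV0 ω)]; exact hV1 ω)
  obtain ⟨L, hL1, hL2, hL3⟩ := exists_cadlag_condExp hPQ hVi (ae_of_all _ hV0)
  have hL : M.IsCadlagVersion Q V L := ⟨hL1, hL2, hL3⟩
  have hL' := hL.one_sub hVi
  have hV0' : 0 ≤ᵐ[Q] fun ω => 1 - V ω := ae_of_all _ fun ω => sub_nonneg.2 (hV1 ω)
  have hVi' : Integrable (fun ω => 1 - V ω) Q := (integrable_const _).sub hVi
  have hVm' : Measurable fun ω => 1 - V ω := measurable_const.sub hVm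
  have hLpos := hL.ae_forall_nonneg hPQ (ae_of_all _ hV0)
  have hLpos' := hL'.ae_forall_nonneg hPQ hV0'
  have hLT : L M.horizon =ᵐ[M.P] V := hPQ.ae_le
    (hL.ae_eq_of_measurable (t := M.horizon) (fun _ hE => M.measurableSet_horizon (hVm hE)) hVi
      le_rfl)
  -- before time `t`, the weight is constant
  have hconst : ∀ u, u ≤ t → L u =ᵐ[M.P] fun _ => 1 - ε := by
    intro u hut
    refine hPQ.ae_le ((hL2 u).trans ?_)
    symm
    refine ae_eq_condExp_of_forall_setIntegral_eq (M.𝓕.le u) hVi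
      (fun _ _ _ => (integrable_const _).integrableOn) (fun B hB _ => ?_)
      (measurable_const.stronglyMeasurable.aestronglyMeasurable)
    have hB' := M.𝓕.le u B hB
    have hνB := heq B (M.𝓕.mono hut B hB)
    have e1 : Q B = ν B := by
      simp only [hQ, mix, Measure.add_apply, Measure.smul_apply, smul_eq_mul, ← hνB]
      rw [← add_mul, ← ENNReal.ofReal_add (by linarith) hε0.le]
      simp
    rw [setIntegral_const, integral_eq_lintegral_of_nonneg_ae (ae_of_all _ hV0)
      hVm.aestronglyMeasurable, ← lintegral_indicator hB']
    have e2 := hVf₁ (B.indicator 1) (measurable_indicator_one hB')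
    rw [lintegral_indicator_one hB'] at e2
    have e3 : ∀ ω, B.indicator (fun ω => ENNReal.ofReal (V ω)) ω =
        ENNReal.ofReal (V ω) * B.indicator 1 ω := fun ω => by
      by_cases hω : ω ∈ B <;> simp [hω]
    simp_rw [e3]
    rw [e2, ENNReal.toReal_mul, ENNReal.toReal_ofReal (by linarith), Measure.real, e1, smul_eq_mul,
      mul_comm]
  have hconst' : ∀ᵐ ω ∂M.P, ∀ u, u ≤ t → L u ω = 1 - ε := by
    have c1 : ∀ᵐ ω ∂M.P, M.RightCont M.start fun _ : Icc (0 : ℝ) M.T => 1 - ε :=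
      ae_of_all _ fun _ _ _ => continuousWithinAt_const
    have a1 := ae_forall_le (Y := fun _ _ => 1 - ε) (M.start_le t) (hL.rightCont M.start) c1
      fun u _ hu => (hconst u hu).le
    have a2 := ae_forall_le (X := fun _ _ => 1 - ε) (M.start_le t) c1 (hL.rightCont M.start)
      fun u _ hu => (hconst u hu).symm.le
    filter_upwards [a1, a2] with ω b1 b2 u hu
    exact le_antisymm (b1 u (M.start_le u) hu) (b2 u (M.start_le u) hu)
  obtain ⟨τ₁, hτ₁⟩ := h₁.reduced
  obtain ⟨τ₂, hτ₂⟩ := h₂.reduced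
  let X : Icc (0 : ℝ) M.T → Ω → ℝ := fun u ω => L u ω * X₁ u ω + (1 - L u ω) * X₂ u ω
  -- Optional sampling replaces the density process at `σ` by the terminal density, which turns the
  -- mixture back into its two components. Reduction of `X` then follows from that of `X₁` and `X₂`.
  have hsample : ∀ σ, M.IsStop σ → (∀ ω, s ≤ σ ω) → ∫⁻ ω, ENNReal.ofReal (X (σ ω) ω) ∂Q =
      ENNReal.ofReal (1 - ε) * ∫⁻ ω, ENNReal.ofReal (X₁ (σ ω) ω) ∂ν +
        ENNReal.ofReal ε * ∫⁻ ω, ENNReal.ofReal (X₂ (σ ω) ω) ∂Q' := by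
    intro σ hσ hs
    have m1 := (h₁.isPosAdapted.measurable_sample' hσ hs).ennreal_ofReal
    have m2 := (h₂.isPosAdapted.measurable_sample' hσ hs).ennreal_ofReal
    have mL := ((hL.isPosAdapted hPQ (ae_of_all _ hV0) M.start).measurable_sample' hσ
      fun _ => M.start_le _).ennreal_ofReal
    rw [← hVf₁ _ m1, ← hVf₂ _ m2,
      ← hL.lintegral_sample_mul hQP hPQ (ae_of_all _ hV0) hVm hVi h₁.isPosAdapted hσ hs,
      ← hL'.lintegral_sample_mul hQP hPQ hV0' hVm' hVi' h₂.isPosAdapted hσ hs,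
      ← lintegral_add_left (f := fun ω => ENNReal.ofReal (L (σ ω) ω) * ENNReal.ofReal (X₁ (σ ω) ω))
        (mL.mul m1)]
    refine lintegral_congr_ae (hQP.ae_le ?_)
    filter_upwards [hLpos, hLpos', h₁.nonneg, h₂.nonneg] with ω a1 a2 a3 a4
    have b1 := a1 (σ ω)
    have b2 := a2 (σ ω)
    simp only [X]
    rw [ENNReal.ofReal_add (mul_nonneg b1 (a3 _ (hs ω))) (mul_nonneg b2 (a4 _ (hs ω))),
      ENNReal.ofReal_mul b1, ENNReal.ofReal_mul b2]
  have hmin := hτ₁.min hτ₂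
  have hmin' := hτ₂.min hτ₁
  refine ⟨X, V, ⟨hprob, hQP, fun u hu => ?_, ?_, ?_, ?_,
    fun n ω => min (τ₁ n ω) (τ₂ n ω), hmin.isStop, hmin.le, hmin.mono, hmin.eventually,
    fun n σ hσ hs hle => ?_⟩, hPQ, hVm, fun ω => ⟨hV0 ω, hV1 ω⟩, ?_, ?_, hVf₁⟩
  · exact ((hL1 u).mul (h₁.adapted u hu)).add
      ((measurable_const.sub (hL1 u)).mul (h₂.adapted u hu))
  · filter_upwards [hL3, h₁.cadlag, h₂.cadlag] with ω a1 a2 a3 u hu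
    obtain ⟨b1, l1, c1⟩ := IsCadlagOn_mono a1 (M.start_le s) u hu
    obtain ⟨b2, l2, c2⟩ := a2 u hu
    obtain ⟨b3, l3, c3⟩ := a3 u hu
    exact ⟨(b1.mul b2).add ((continuousWithinAt_const.sub b1).mul b3), _,
      (c1.mul c2).add ((tendsto_const_nhds.sub c1).mul c3)⟩
  · filter_upwards [hLpos, hLpos', h₁.nonneg, h₂.nonneg] with ω a1 a2 a3 a4 u hu
    exact add_nonneg (mul_nonneg (a1 u) (a3 u hu)) (mul_nonneg (a2 u) (a4 u hu))
  · rw [hsample (fun _ => s) (isStop_const s) fun _ => le_rfl]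
    exact ENNReal.add_ne_top.2 ⟨ENNReal.mul_ne_top ENNReal.ofReal_ne_top h₁.lintegral_ne_top,
      ENNReal.mul_ne_top ENNReal.ofReal_ne_top h₂.lintegral_ne_top⟩
  · rw [hsample σ hσ hs, hsample (fun _ => s) (isStop_const s) fun _ => le_rfl,
      hmin.reduces n σ hσ hs hle,
      hτ₂.reduces n σ hσ hs fun ω => (hle ω).trans (min_le_right _ _)]
  · filter_upwards [hLT] with ω hω
    simp only [X, hω]
  · filter_upwards [hLpos, hLpos', hconst'] with ω a1 a2 a3 u hu
    exact ⟨L u ω, a1 u, sub_nonneg.1 (a2 u), rfl, a3 u⟩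

end MixtureProcess

end Market

namespace Market

/-! ### Approximate upward directedness of the conditional prices. -/

section Concatenation

/-- At `δ = 0` the two bounds hold with slack `ε * l`, so by continuity they survive for small `δ`.
They say that weight `ε` on `S'` compensates the error made in comparing `S'` with `S`. -/
theorem exists_pos_spread {l ε : ℝ} (hl0 : 0 < l) (hε0 : 0 < ε) :
    ∃ δ, 0 < δ ∧ δ < l ∧ 1 - l ≤ ((1 - ε) * ((1 - l) / (1 + δ)) + ε) * (1 - δ) ∧
      ((1 - ε) * ((1 + l) / (1 - δ)) + ε) * (1 + δ) ≤ 1 + l := by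
  have t1 : Tendsto (fun δ : ℝ => ((1 - ε) * ((1 - l) / (1 + δ)) + ε) * (1 - δ)) (𝓝 0)
      (𝓝 (((1 - ε) * ((1 - l) / (1 + 0)) + ε) * (1 - 0))) := by
    have : ContinuousAt (fun δ : ℝ => ((1 - ε) * ((1 - l) / (1 + δ)) + ε) * (1 - δ)) 0 := by
      fun_prop (disch := norm_num)
    exact this
  have t2 : Tendsto (fun δ : ℝ => ((1 - ε) * ((1 + l) / (1 - δ)) + ε) * (1 + δ)) (𝓝 0)
      (𝓝 (((1 - ε) * ((1 + l) / (1 - 0)) + ε) * (1 + 0))) := by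
    have : ContinuousAt (fun δ : ℝ => ((1 - ε) * ((1 + l) / (1 - δ)) + ε) * (1 + δ)) 0 := by
      fun_prop (disch := norm_num)
    exact this
  have e1 := t1.eventually_const_le (u := 1 - l) (by
    norm_num
    nlinarith [mul_pos hε0 hl0])
  have e2 := t2.eventually_le_const (u := 1 + l) (by
    norm_num
    nlinarith [mul_pos hε0 hl0])
  have e3 : ∀ᶠ δ in 𝓝[>] (0 : ℝ), 0 < δ ∧ δ < l := Ioo_mem_nhdsGT hl0
  obtain ⟨δ, h1, h2, h3⟩ := ((e1.filter_mono nhdsWithin_le_nhds).and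
    ((e2.filter_mono nhdsWithin_le_nhds).and e3)).exists
  exact ⟨δ, h3.1, h3.2, h1, h2⟩

variable {Ω : Type*} [mΩ : MeasurableSpace Ω] {M : Market Ω}

/-- A claim is worth at least its liquidation value at every price in the bid-ask spread. -/
theorem liqValue_le {x₁ x₂ z : ℝ} {ω : Ω} (h1 : (1 - M.lam) * M.S M.horizon ω ≤ z)
    (h2 : z ≤ (1 + M.lam) * M.S M.horizon ω) : M.liqValue x₁ x₂ ω ≤ x₁ + x₂ * z := by
  have e : x₂ = max x₂ 0 - max (-x₂) 0 := by
    rcases le_total 0 x₂ with h | h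
    · rw [max_eq_left h, max_eq_right (by linarith)]; ring
    · rw [max_eq_right h, max_eq_left (by linarith)]; ring
  have h3 := mul_le_mul_of_nonneg_left h1 (le_max_right x₂ 0)
  have h4 := mul_le_mul_of_nonneg_left h2 (le_max_right (-x₂) 0)
  have h5 : x₂ * z = max x₂ 0 * z - max (-x₂) 0 * z := by rw [← sub_mul, ← e]
  unfold liqValue
  rw [h5]
  linarith

theorem IsCPSloc.ae_nonneg {Ms X₁ X₂ : Ω → ℝ} {s : Icc (0 : ℝ) M.T} {Q : Measure Ω}
    {X : Icc (0 : ℝ) M.T → Ω → ℝ} (h : M.IsCPSloc M.lam s Q X)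
    (hbound : ∀ᵐ ω ∂M.P, -Ms ω ≤ M.liqValue (X₁ ω) (X₂ ω) ω) :
    ∀ᵐ ω ∂M.P, 0 ≤ X₁ ω + X₂ ω * X M.horizon ω + Ms ω := by
  filter_upwards [hbound, h.spread] with ω h1 h2
  have h3 := h2 M.horizon (M.le_horizon s)
  linarith [liqValue_le (x₁ := X₁ ω) (x₂ := X₂ ω) h3.1 h3.2]

theorem IsCPSloc.measurable {l : ℝ} {s : Icc (0 : ℝ) M.T} {Q : Measure Ω}
    {X : Icc (0 : ℝ) M.T → Ω → ℝ} (h : M.IsCPSloc l s Q X) : Measurable (X M.horizon) :=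
  (h.localMartingale.adapted _ ⟨M.le_horizon s, le_rfl⟩).measurable.mono (M.𝓕.le _) le_rfl

/-- The conditional price at time `t` of the claim `(X₁, X₂)` raised by `Ms`. -/
noncomputable def raisedPrice (M : Market Ω) (X₁ X₂ Ms : Ω → ℝ) (t : Icc (0 : ℝ) M.T)
    (p : Measure Ω × (Icc (0 : ℝ) M.T → Ω → ℝ)) : Ω → ℝ≥0∞ :=
  condLExp (M.𝓕 t) p.1 fun ω => ENNReal.ofReal (X₁ ω + X₂ ω * p.2 M.horizon ω + Ms ω)

/-- The conditional prices are directed upwards, up to an arbitrarily small proportional error. -/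
theorem AdmitsCPSloc.exists_raisedPrice_ge (hM : M.AdmitsCPSloc) {s t : Icc (0 : ℝ) M.T}
    (hst : s ≤ t) {X₁ X₂ Ms : Ω → ℝ} (hX₁ : Measurable X₁) (hX₂ : Measurable X₂)
    (hMs : Measurable Ms) (hbound : ∀ᵐ ω ∂M.P, -Ms ω ≤ M.liqValue (X₁ ω) (X₂ ω) ω)
    {κ : Type*} [Fintype κ] {p : κ → Measure Ω × (Icc (0 : ℝ) M.T → Ω → ℝ)}
    (hp : ∀ i, p i ∈ M.CPSloc M.lam s) {sel : Ω → κ}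
    (hsel : ∀ i, MeasurableSet[M.𝓕 t] {ω | sel ω = i}) {ε : ℝ} (hε0 : 0 < ε) (hε1 : ε < 1) :
    ∃ q ∈ M.CPSloc M.lam s, ∀ᵐ ω ∂M.P, ENNReal.ofReal (1 - ε) *
      M.raisedPrice X₁ X₂ Ms t (p (sel ω)) ω ≤ M.raisedPrice X₁ X₂ Ms t q ω := by
  have hl0 := M.lam_pos
  have hl1 := M.lam_lt_one
  obtain ⟨δ, hδ0, hδl, hδ1, hδ2⟩ := exists_pos_spread hl0 hε0
  obtain ⟨⟨Q', S'⟩, hQ'⟩ := hM δ hδ0 hδl.le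
  have hQ' : M.IsCPSloc δ M.start Q' S' := hQ'
  have h' := (hQ'.isPosLocMart (by linarith)).restart (M.start_le s)
  have hp' : ∀ i, M.IsCPSloc M.lam s (p i).1 (p i).2 := hp
  obtain ⟨ν, X, hν, hνB, hXt, hXs, hνf⟩ := exists_paste hst hsel h' hQ'.ac'
    (fun i => (hp' i).isPosLocMart hl1.le) (fun i => (hp' i).ac')
    -- The bounds of `S i` by `S`, combined with those of `S'` by `S`, give exactly these ratios to
    -- `S'`.
    (c := (1 - M.lam) / (1 + δ)) (d := (1 + M.lam) / (1 - δ))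
    (div_nonneg (by linarith) (by linarith)) (by
      rw [div_le_div_iff₀ (by linarith) (by linarith)]
      nlinarith) (fun i => by
      filter_upwards [hQ'.spread, (hp' i).spread] with ω a1 a2
      have b1 := a1 t (M.start_le t)
      have b2 := a2 t hst
      rw [div_mul_eq_mul_div, div_mul_eq_mul_div, div_le_iff₀ (by linarith),
        le_div_iff₀ (by linarith)]
      constructor <;> nlinarith)
  obtain ⟨Y, V, hY, hPQ, hVm, hV, hYT, hYθ, hVf⟩ := exists_mixture hν h' hQ'.ac' hνB hε0 hε1
  set Q := mix ε ν Q' with hQ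
  have := hν.isProb
  have := hY.isProb
  have hcps : M.IsCPSloc M.lam s Q Y := by
    refine ⟨hY.isProb, hY.ac, hPQ, hY.isLocalMartingaleOn, ?_⟩
    filter_upwards [hYθ, hXs, hQ'.spread, ae_all_iff.2 fun i => (hp' i).spread]
      with ω a1 a2 a3 a4 u hu
    obtain ⟨θ, h0, h1, h2, h3⟩ := a1 u hu
    have b3 := a3 u (M.start_le u)
    have hS := M.pos u ω
    rw [h2]
    rcases le_total u t with hut | hut
    · obtain ⟨c1, c2⟩ := a2 u hu hut
      rw [h3 hut]
      have k0 : 0 ≤ (1 - M.lam) / (1 + δ) := div_nonneg (by linarith) (by linarith)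
      have k1 : 0 ≤ (1 + M.lam) / (1 - δ) := div_nonneg (by linarith) (by linarith)
      have k2 : 0 ≤ (1 - ε) * ((1 - M.lam) / (1 + δ)) + ε :=
        add_nonneg (mul_nonneg (by linarith) k0) hε0.le
      have k3 : 0 ≤ (1 - ε) * ((1 + M.lam) / (1 - δ)) + ε :=
        add_nonneg (mul_nonneg (by linarith) k1) hε0.le
      have d1 := mul_le_mul_of_nonneg_left c1 (sub_nonneg.2 hε1.le)
      have d2 := mul_le_mul_of_nonneg_left c2 (sub_nonneg.2 hε1.le)
      have d3 := mul_le_mul_of_nonneg_left b3.1 k2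
      have d4 := mul_le_mul_of_nonneg_left b3.2 k3
      have d5 := mul_le_mul_of_nonneg_right hδ1 hS.le
      have d6 := mul_le_mul_of_nonneg_right hδ2 hS.le
      constructor <;> linarith
    · have b4 := a4 (sel ω) u hu
      rw [hXt u hut]
      have hδS := mul_le_mul_of_nonneg_right hδl.le hS.le
      have d1 := mul_le_mul_of_nonneg_left b4.1 h0
      have d2 := mul_le_mul_of_nonneg_left b4.2 h0
      have d3 : (1 - θ) * ((1 - M.lam) * M.S u ω) ≤ (1 - θ) * S' u ω :=
        mul_le_mul_of_nonneg_left (by linarith) (sub_nonneg.2 h1)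
      have d4 : (1 - θ) * S' u ω ≤ (1 - θ) * ((1 + M.lam) * M.S u ω) :=
        mul_le_mul_of_nonneg_left (by linarith) (sub_nonneg.2 h1)
      constructor <;> linarith
  refine ⟨(Q, Y), hcps, ?_⟩
  let f : κ → Ω → ℝ≥0∞ := fun i ω =>
    ENNReal.ofReal (X₁ ω + X₂ ω * (p i).2 M.horizon ω + Ms ω)
  have hf : ∀ i, Measurable (f i) := fun i =>
    ((hX₁.add (hX₂.mul (hp' i).measurable)).add hMs).ennreal_ofReal
  have hfs : Measurable fun ω => f (sel ω) ω := measurable_select (M.𝓕.le t) hsel hf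
  let G : Ω → ℝ≥0∞ := fun ω => M.raisedPrice X₁ X₂ Ms t (p (sel ω)) ω
  have hG : Measurable[M.𝓕 t] G :=
    measurable_select le_rfl hsel fun i => measurable_condLExp (M.𝓕 t) (p i).1 (f i)
  have hG' : Measurable G := hG.mono (M.𝓕.le t) le_rfl
  -- The claim is affine in the price, so its raised value at `Y` is the `V`-convex combination of
  -- those at `X` and `S'`; the latter is nonnegative and may be dropped.
  have hle : ∀ᵐ ω ∂Q, ENNReal.ofReal (V ω) * f (sel ω) ω ≤
      ENNReal.ofReal (X₁ ω + X₂ ω * Y M.horizon ω + Ms ω) := by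
    refine hY.ac.ae_le ?_
    have hlam : ∀ᵐ ω ∂M.P, 0 ≤ X₁ ω + X₂ ω * S' M.horizon ω + Ms ω := by
      filter_upwards [hbound, hQ'.spread] with ω a1 a2
      have b1 := a2 M.horizon (M.start_le _)
      have hδS := mul_le_mul_of_nonneg_right hδl.le (M.pos M.horizon ω).le
      linarith [liqValue_le (M := M) (x₁ := X₁ ω) (x₂ := X₂ ω) (z := S' M.horizon ω) (ω := ω)
        (by linarith) (by linarith)]
    filter_upwards [hlam, hYT] with ω a1 a2
    rw [← ENNReal.ofReal_mul (hV ω).1, a2, hXt _ (M.le_horizon t)]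
    refine ENNReal.ofReal_le_ofReal ?_
    have := mul_nonneg (sub_nonneg.2 (hV ω).2) a1
    linarith
  have hmixG : ∀ B, MeasurableSet[M.𝓕 t] B → Q B = Q' B := by
    intro B hB
    simp only [hQ, mix, Measure.add_apply, Measure.smul_apply, smul_eq_mul, hνB B hB]
    rw [← add_mul, ← ENNReal.ofReal_add (by linarith) hε0.le]
    simp
  have htrim : Q.trim (M.𝓕.le t) = Q'.trim (M.𝓕.le t) := by
    refine @Measure.ext _ (M.𝓕 t) _ _ fun B hB => ?_
    rw [trim_measurableSet_eq _ hB, trim_measurableSet_eq _ hB, hmixG B hB]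
  refine hPQ.ae_le (ae_le_of_ae_le_trim (hm := M.𝓕.le t)
    (f₁ := fun ω => ENNReal.ofReal (1 - ε) * G ω) (f₂ := M.raisedPrice X₁ X₂ Ms t (Q, Y)) ?_)
  -- On `𝓕 t` the measures `Q`, `Q'` and `ν` agree. Integrating over `B`, Bayes' formula for `ν` and
  -- the density `V` turn `(1 - ε) * G` into the left side of `hle`.
  refine ae_le_of_forall_setLIntegral_le_of_sigmaFinite (hG.const_mul _) fun B hB _ => ?_
  have hB' := M.𝓕.le t B hB
  have s1 : ∫⁻ ω in B, G ω ∂(Q.trim (M.𝓕.le t)) = ∫⁻ ω in B, f (sel ω) ω ∂ν := by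
    rw [htrim, setLIntegral_trim (M.𝓕.le t) hG hB]
    exact (hνf f hf B hB).symm
  have s2 := setLIntegral_condLExp_trim (M.𝓕.le t) Q
    (fun ω => ENNReal.ofReal (X₁ ω + X₂ ω * Y M.horizon ω + Ms ω)) hB
  have s3 : ∫⁻ ω in B, ENNReal.ofReal (V ω) * f (sel ω) ω ∂Q =
      ENNReal.ofReal (1 - ε) * ∫⁻ ω in B, f (sel ω) ω ∂ν := by
    have := hVf (B.indicator fun ω => f (sel ω) ω) (hfs.indicator hB')
    rw [lintegral_indicator hB'] at this
    rw [← this, ← lintegral_indicator hB']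
    refine lintegral_congr fun ω => ?_
    by_cases hω : ω ∈ B <;> simp [hω]
  unfold raisedPrice
  rw [lintegral_const_mul _ hG, s1, ← s3, s2]
  exact lintegral_mono_ae (ae_restrict_of_ae hle)

end Concatenation

end Market

/-! ### Extended-real expectations and suprema of directed families. -/

section DirectedSup

/-- Two extended-real differences agree if the corresponding sums agree. -/
theorem EReal.coe_ennreal_sub_eq {a b g m : ℝ≥0∞} (hb : b ≠ ∞) (hm : m ≠ ∞) (h : g + b = a + m) :
    (a : EReal) - b = g - m := by
  lift b to NNReal using hb
  lift m to NNReal using hm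
  induction a with
  | top =>
    induction g with
    | top => rfl
    | coe g => exact absurd h (by simp [← ENNReal.coe_add])
  | coe a =>
    induction g with
    | top => exact absurd h.symm (by simp [← ENNReal.coe_add])
    | coe g =>
      have h1 : (g : ℝ) + b = a + m := by exact_mod_cast h
      have h2 : (a : ℝ) - b = g - m := by linarith
      have h3 : ∀ x : NNReal, ((x : ℝ≥0∞) : EReal) = ((x : ℝ) : EReal) := fun x => rfl
      rw [h3, h3, h3, h3, ← EReal.coe_sub, ← EReal.coe_sub, h2]

/-- Positive and negative parts rearranged as sums, so that integration never has to subtract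
infinities. -/
theorem EReal.toENNReal_coe_sub_add {g m : ℝ≥0∞} (hm : m ≠ ∞) :
    g + (-((g : EReal) - m)).toENNReal = ((g : EReal) - m).toENNReal + m := by
  lift m to NNReal using hm
  have h3 : ∀ x : NNReal, ((x : ℝ≥0∞) : EReal) = ((x : ℝ) : EReal) := fun x => rfl
  induction g with
  | top => simp [h3]
  | coe g =>
    rw [h3, h3, ← EReal.coe_sub, ← EReal.coe_neg, EReal.toENNReal_of_ne_top (EReal.coe_ne_top _),
      EReal.toENNReal_of_ne_top (EReal.coe_ne_top _), EReal.toReal_coe, EReal.toReal_coe,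
      ← ENNReal.ofReal_coe_nnreal, ← ENNReal.ofReal_coe_nnreal]
    rcases le_total (g : ℝ) m with h | h
    · rw [← ENNReal.ofReal_add (by positivity) (by linarith),
        ENNReal.ofReal_of_nonpos (p := (g : ℝ) - m) (by linarith)]
      simp
    · rw [← ENNReal.ofReal_add (p := (g : ℝ) - m) (by linarith) (by positivity),
        ENNReal.ofReal_of_nonpos (p := -((g : ℝ) - m)) (by linarith)]
      simp

variable {Ω : Type*} [mΩ : MeasurableSpace Ω] {Q : Measure Ω}

theorem negPartIntegrable_of_le {f : Ω → EReal} {m : Ω → ℝ≥0∞} (hm : ∫⁻ ω, m ω ∂Q ≠ ∞)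
    (h : ∀ᵐ ω ∂Q, -(m ω : EReal) ≤ f ω) : NegPartIntegrable Q f := by
  refine lt_of_le_of_lt (lintegral_mono_ae ?_) hm.lt_top
  filter_upwards [h] with ω hω
  have : -f ω ≤ m ω := EReal.neg_le.1 hω
  simpa using EReal.toENNReal_le_toENNReal this

theorem extExp_sub {g m : Ω → ℝ≥0∞} (hg : Measurable g) (hm : Measurable m)
    (hm' : ∀ ω, m ω ≠ ∞) (hmQ : ∫⁻ ω, m ω ∂Q ≠ ∞) :
    extExp Q (fun ω => (g ω : EReal) - m ω) =
      ((∫⁻ ω, g ω ∂Q : ℝ≥0∞) : EReal) - ((∫⁻ ω, m ω ∂Q : ℝ≥0∞) : EReal) := by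
  have hneg : NegPartIntegrable Q fun ω => (g ω : EReal) - m ω :=
    negPartIntegrable_of_le hmQ (ae_of_all _ fun ω => by
      rw [sub_eq_add_neg]
      exact le_add_of_nonneg_left (EReal.coe_ennreal_nonneg _))
  refine EReal.coe_ennreal_sub_eq (ne_of_lt hneg) hmQ ?_
  rw [← lintegral_add_left hg, ← lintegral_add_right _ hm]
  exact lintegral_congr fun ω => EReal.toENNReal_coe_sub_add (hm' ω)

theorem extExp_mono_ae {f g : Ω → EReal} (h : f ≤ᵐ[Q] g) : extExp Q f ≤ extExp Q g := by
  refine EReal.sub_le_sub (EReal.coe_ennreal_le_coe_ennreal_iff.2 (lintegral_mono_ae ?_))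
    (EReal.coe_ennreal_le_coe_ennreal_iff.2 (lintegral_mono_ae ?_))
  · filter_upwards [h] with ω hω using EReal.toENNReal_le_toENNReal hω
  · filter_upwards [h] with ω hω using EReal.toENNReal_le_toENNReal (EReal.neg_le_neg_iff.2 hω)

theorem extExp_congr_ae {f g : Ω → EReal} (h : f =ᵐ[Q] g) : extExp Q f = extExp Q g :=
  le_antisymm (extExp_mono_ae h.le) (extExp_mono_ae h.symm.le)

/-- A family of nonnegative random variables that is directed upwards, up to an arbitrarily small
proportional error, has a dominating random variable with expectation at most the supremum of the
expectations. -/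
theorem exists_dominating_of_directed {ι : Type*} [Nonempty ι] {g : ι → Ω → ℝ≥0∞}
    (hg : ∀ i, Measurable (g i))
    (hdir : ∀ i j, ∀ r : NNReal, r < 1 → ∃ k, ∀ᵐ ω ∂Q, r * max (g i ω) (g j ω) ≤ g k ω) :
    ∃ h : Ω → ℝ≥0∞, Measurable h ∧ (∀ i, g i ≤ᵐ[Q] h) ∧ ∫⁻ ω, h ω ∂Q ≤ ⨆ i, ∫⁻ ω, g i ω ∂Q := by
  by_cases hc : ⨆ i, ∫⁻ ω, g i ω ∂Q = ∞
  · exact ⟨fun _ => ∞, measurable_const, fun i => ae_of_all _ fun _ => le_top,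
      by rw [hc]; exact le_top⟩
  set c := ⨆ i, ∫⁻ ω, g i ω ∂Q with hcdef
  -- Functions which, shrunk by any factor below `1`, are dominated by a member. This class contains
  -- the family, is closed under maxima, and has the same bound `c` on integrals.
  let D : Set (Ω → ℝ≥0∞) := {h | ∀ r : NNReal, r < 1 → ∃ k, ∀ᵐ ω ∂Q, r * h ω ≤ g k ω}
  have hgD : ∀ i, g i ∈ D := fun i r hr => ⟨i, ae_of_all _ fun ω =>
    (mul_le_mul_left (ENNReal.coe_le_one_iff.2 hr.le) _).trans (one_mul _).le⟩
  have hmax : ∀ h₁ ∈ D, ∀ h₂ ∈ D, (fun ω => max (h₁ ω) (h₂ ω)) ∈ D := by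
    intro h₁ hh₁ h₂ hh₂ r hr
    -- One factor is lost in dominating `h₁` and `h₂` by members, another in the directedness of
    -- these members.
    obtain ⟨r', hr', hrr⟩ : ∃ r' : NNReal, r' < 1 ∧ r ≤ r' * r' := by
      refine ⟨NNReal.sqrt r, ?_, (NNReal.mul_self_sqrt r).ge⟩
      simpa using NNReal.sqrt_lt_sqrt.2 hr
    obtain ⟨i, hi⟩ := hh₁ r' hr'
    obtain ⟨j, hj⟩ := hh₂ r' hr'
    obtain ⟨k, hk⟩ := hdir i j r' hr'
    refine ⟨k, ?_⟩
    filter_upwards [hi, hj, hk] with ω a1 a2 a3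
    calc (r : ℝ≥0∞) * max (h₁ ω) (h₂ ω) ≤ (r' * r' : NNReal) * max (h₁ ω) (h₂ ω) := by
          gcongr
      _ = r' * max (r' * h₁ ω) (r' * h₂ ω) := by
          rw [ENNReal.coe_mul, mul_assoc, mul_max]
      _ ≤ r' * max (g i ω) (g j ω) := by gcongr
      _ ≤ g k ω := a3
  have hDc : ∀ h ∈ D, ∫⁻ ω, h ω ∂Q ≤ c := by
    intro h hh
    refine ENNReal.le_of_forall_lt_one_mul_le fun a ha => ?_
    lift a to NNReal using ne_top_of_lt ha
    obtain ⟨k, hk⟩ := hh a (by exact_mod_cast ha)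
    rw [← lintegral_const_mul' _ _ ENNReal.coe_ne_top]
    exact (lintegral_mono_ae hk).trans (le_iSup (fun i => ∫⁻ ω, g i ω ∂Q) k)
  obtain ⟨v, -, hv, hmem⟩ := exists_seq_tendsto_sSup (S := range fun i => ∫⁻ ω, g i ω ∂Q)
    (range_nonempty _) (OrderTop.bddAbove _)
  choose u hu using hmem
  let H : ℕ → Ω → ℝ≥0∞ := partialSups fun n => g (u n)
  have hH0 : H 0 = g (u 0) := partialSups_zero _
  have hHs : ∀ n, H (n + 1) = fun ω => max (H n ω) (g (u (n + 1)) ω) := fun n =>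
    partialSups_add_one _ n
  have hHD : ∀ n, H n ∈ D ∧ Measurable (H n) := by
    intro n
    induction n with
    | zero => rw [hH0]; exact ⟨hgD _, hg _⟩
    | succ n ih =>
      rw [hHs]
      exact ⟨hmax _ ih.1 _ (hgD _), ih.2.max (hg _)⟩
  have hHmono : Monotone H := (partialSups fun n => g (u n)).monotone
  have hsup : ∀ f : Ω → ℝ≥0∞, Measurable f → (∀ n, (fun ω => max (H n ω) (f ω)) ∈ D) →
      ∫⁻ ω, max (⨆ n, H n ω) (f ω) ∂Q ≤ c := by
    intro f hf hfD
    have e : ∀ ω, max (⨆ n, H n ω) (f ω) = ⨆ n, max (H n ω) (f ω) := fun ω => iSup_sup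
    simp_rw [e]
    rw [lintegral_iSup (fun n => (hHD n).2.max hf)
      fun i j hij ω => max_le_max_right _ (hHmono hij ω)]
    exact iSup_le fun n => hDc _ (hfD n)
  have hle : c ≤ ∫⁻ ω, ⨆ n, H n ω ∂Q := by
    rw [hcdef, ← sSup_range]
    refine le_of_tendsto' hv fun n => ?_
    rw [← hu n]
    refine lintegral_mono fun ω => ?_
    exact le_iSup_of_le n (le_partialSups (fun n => g (u n)) n ω)
  refine ⟨fun ω => ⨆ n, H n ω, .iSup fun n => (hHD n).2, fun i => ?_, ?_⟩
  -- The supremum of the `H n` already has the maximal integral `c`, which is finite; since taking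
  -- the maximum with `g i` cannot increase it, `g i` lies below almost everywhere.
  · have h1 := hsup (g i) (hg i) fun n => hmax _ (hHD n).1 _ (hgD i)
    have hfin : ∫⁻ ω, ⨆ n, H n ω ∂Q ≠ ∞ :=
      ne_top_of_le_ne_top hc ((lintegral_mono fun ω => le_max_left _ _).trans h1)
    have h2 := ae_eq_of_ae_le_of_lintegral_le
      (ae_of_all Q fun ω => le_max_left (⨆ n, H n ω) (g i ω))
      hfin ((Measurable.iSup fun n => (hHD n).2).max (hg i)).aemeasurable (h1.trans hle)
    filter_upwards [h2] with ω hω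
    rw [hω]
    exact le_max_right _ _
  · refine (lintegral_mono fun ω => le_max_left _ (H 0 ω)).trans (hsup _ (hHD 0).2 fun n =>
      hmax _ (hHD n).1 _ (hHD 0).1)

end DirectedSup

/-! ### Conclusion for the conditional prices. -/

namespace Market

variable {Ω : Type*} [mΩ : MeasurableSpace Ω] {M : Market Ω}

/-- With `Z` the claim value, condition the identity `(Z + Ms) + Z⁻ = Z⁺ + Ms` of nonnegative
variables. Subtraction is legitimate since `Z⁻ ≤ Ms` and `Ms`, being `𝓕 t`-measurable, is its own
conditional expectation. -/
theorem IsCPSloc.condPrice_ae_eq {s t : Icc (0 : ℝ) M.T} (hst : s ≤ t) {X₁ X₂ Ms : Ω → ℝ}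
    (hX₁ : Measurable X₁) (hX₂ : Measurable X₂) (hMs : Measurable[M.𝓕 s] Ms) (hMs0 : ∀ ω, 0 ≤ Ms ω)
    (hbound : ∀ᵐ ω ∂M.P, -Ms ω ≤ M.liqValue (X₁ ω) (X₂ ω) ω)
    {p : Measure Ω × (Icc (0 : ℝ) M.T → Ω → ℝ)} (h : M.IsCPSloc M.lam s p.1 p.2) :
    M.condPrice X₁ X₂ p t =ᵐ[M.P] fun ω =>
      (M.raisedPrice X₁ X₂ Ms t p ω : EReal) - (ENNReal.ofReal (Ms ω) : ℝ≥0∞) := by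
  have := h.isProb
  have hY : Measurable fun ω => X₁ ω + X₂ ω * p.2 M.horizon ω := hX₁.add (hX₂.mul h.measurable)
  have hMs' : Measurable Ms := hMs.mono (M.𝓕.le s) le_rfl
  have hnn := h.ac.ae_le (h.ae_nonneg hbound)
  have hself : condLExp (M.𝓕 t) p.1 (fun ω => ENNReal.ofReal (Ms ω)) =
      fun ω => ENNReal.ofReal (Ms ω) :=
    condLExp_eq_self (M.𝓕.le t) _ (ENNReal.measurable_ofReal.comp (hMs.mono (M.𝓕.mono hst) le_rfl))
  have e1 := condLExp_add_left (mΩ := M.𝓕 t) (P := p.1)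
    (X := fun ω => ENNReal.ofReal (X₁ ω + X₂ ω * p.2 M.horizon ω + Ms ω))
    (fun ω => ENNReal.ofReal (-(X₁ ω + X₂ ω * p.2 M.horizon ω)))
    (hY.add hMs').ennreal_ofReal.aemeasurable
  have e2 := condLExp_add_left (mΩ := M.𝓕 t) (P := p.1)
    (X := fun ω => ENNReal.ofReal (X₁ ω + X₂ ω * p.2 M.horizon ω))
    (fun ω => ENNReal.ofReal (Ms ω)) hY.ennreal_ofReal.aemeasurable
  have e3 : (fun ω => ENNReal.ofReal (X₁ ω + X₂ ω * p.2 M.horizon ω + Ms ω)) +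
      (fun ω => ENNReal.ofReal (-(X₁ ω + X₂ ω * p.2 M.horizon ω))) =ᵐ[p.1]
      (fun ω => ENNReal.ofReal (X₁ ω + X₂ ω * p.2 M.horizon ω)) +
      fun ω => ENNReal.ofReal (Ms ω) := by
    filter_upwards [hnn] with ω hω
    simp only [Pi.add_apply]
    rcases le_total 0 (X₁ ω + X₂ ω * p.2 M.horizon ω) with h0 | h0
    · rw [ENNReal.ofReal_of_nonpos (p := -_) (by linarith), add_zero,
        ENNReal.ofReal_add h0 (hMs0 ω)]
    · rw [ENNReal.ofReal_of_nonpos h0, zero_add, ← ENNReal.ofReal_add hω (by linarith)]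
      congr 1
      ring
  have e4 := condLExp_mono (mΩ := M.𝓕 t) (P := p.1)
    (X := fun ω => ENNReal.ofReal (-(X₁ ω + X₂ ω * p.2 M.horizon ω)))
    (Y := fun ω => ENNReal.ofReal (Ms ω)) (by
      filter_upwards [hnn] with ω hω
      exact ENNReal.ofReal_le_ofReal (by linarith))
  rw [hself] at e2 e4
  refine h.ac'.ae_le ?_
  filter_upwards [e1, e2, condLExp_congr_ae (mΩ := M.𝓕 t) e3, e4] with ω a1 a2 a3 a4
  exact EReal.coe_ennreal_sub_eq (ne_top_of_le_ne_top ENNReal.ofReal_ne_top a4)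
    ENNReal.ofReal_ne_top (a1.symm.trans (a3.trans a2))

theorem AdmitsCPSloc.exists_dominating (hM : M.AdmitsCPSloc) {s t : Icc (0 : ℝ) M.T}
    (hst : s ≤ t) {X₁ X₂ Ms : Ω → ℝ} (hX₁ : Measurable X₁) (hX₂ : Measurable X₂)
    (hMs : Measurable Ms) (hbound : ∀ᵐ ω ∂M.P, -Ms ω ≤ M.liqValue (X₁ ω) (X₂ ω) ω)
    {Q₀ : Measure Ω} (hQ₀ : Q₀ ∈ M.Qloc s) :
    ∃ h : Ω → ℝ≥0∞, Measurable h ∧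
      (∀ p ∈ M.CPSloc M.lam s, M.raisedPrice X₁ X₂ Ms t p ≤ᵐ[M.P] h) ∧
      ∫⁻ ω, h ω ∂Q₀ ≤ ⨆ p ∈ M.CPSloc M.lam s, ∫⁻ ω, M.raisedPrice X₁ X₂ Ms t p ω ∂Q₀ := by
  classical
  obtain ⟨X₀, hX₀⟩ := hQ₀
  have hX₀' : M.IsCPSloc M.lam s Q₀ X₀ := hX₀
  have : Nonempty (M.CPSloc M.lam s) := ⟨⟨_, hX₀⟩⟩
  obtain ⟨h, h1, h2, h3⟩ := exists_dominating_of_directed (Q := Q₀)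
    (g := fun p : M.CPSloc M.lam s => M.raisedPrice X₁ X₂ Ms t p)
    (fun p => measurable_condLExp' _ _ _) (by
      intro i j r hr
      rcases eq_or_ne r 0 with rfl | hr0
      · exact ⟨i, by simp⟩
      have hr0' : (0 : ℝ) < r := NNReal.coe_pos.2 (pos_iff_ne_zero.2 hr0)
      have hr1 : (r : ℝ) < 1 := by exact_mod_cast hr
      -- Selecting the larger of the two prices pointwise turns the selected price into their
      -- maximum; `ε = 1 - r` gives the required factor.
      let sel : Ω → Bool := fun ω =>
        decide (M.raisedPrice X₁ X₂ Ms t i ω ≤ M.raisedPrice X₁ X₂ Ms t j ω)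
      have hA : MeasurableSet[M.𝓕 t]
          {ω | M.raisedPrice X₁ X₂ Ms t i ω ≤ M.raisedPrice X₁ X₂ Ms t j ω} :=
        @measurableSet_le _ _ _ _ _ (M.𝓕 t) _ _ _ _ _ (measurable_condLExp _ _ _)
          (measurable_condLExp _ _ _)
      obtain ⟨q, hq, hle⟩ := hM.exists_raisedPrice_ge hst hX₁ hX₂ hMs hbound
        (p := fun b : Bool => if b then j.1 else i.1) (fun b => by cases b <;> simp) (sel := sel)
        (fun b => by
          cases b
          · simpa [sel, compl_ofPred] using hA.compl
          · simpa [sel] using hA) (ε := 1 - r) (by linarith) (by linarith)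
      refine ⟨⟨q, hq⟩, hX₀'.ac.ae_le ?_⟩
      filter_upwards [hle] with ω hω
      refine le_trans (le_of_eq ?_) hω
      rw [sub_sub_cancel, ENNReal.ofReal_coe_nnreal]
      congr 1
      by_cases hij : M.raisedPrice X₁ X₂ Ms t i ω ≤ M.raisedPrice X₁ X₂ Ms t j ω
      · simp [sel, hij]
      · simp [sel, hij, (not_le.1 hij).le])
  refine ⟨h, h1, fun p hp => hX₀'.ac'.ae_le (h2 ⟨p, hp⟩), ?_⟩
  rwa [iSup_subtype] at h3

end Market

theorem lemma3p11 {Ω : Type*} [mΩ : MeasurableSpace Ω] (M : Market Ω) (hM : M.AdmitsCPSloc)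
    (s : Set.Icc (0 : ℝ) M.T) (X₁ X₂ : Ω → ℝ) (hX₁ : Measurable X₁) (hX₂ : Measurable X₂)
    (Ms : Ω → ℝ) (hMs : Ms ∈ M.L1plusQloc s)
    (hbound : ∀ᵐ ω ∂M.P, -Ms ω ≤ M.liqValue (X₁ ω) (X₂ ω) ω)
    (Q₀ : Measure Ω) (hQ₀ : Q₀ ∈ M.Qloc s) (t : Set.Icc (0 : ℝ) M.T) (hst : s ≤ t) :
    NegPartIntegrable Q₀ (M.supPrice X₁ X₂ s t) ∧
    (∀ p ∈ M.CPSloc M.lam s, NegPartIntegrable Q₀ (M.condPrice X₁ X₂ p t)) ∧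
    extExp Q₀ (M.supPrice X₁ X₂ s t) =
      ⨆ p ∈ M.CPSloc M.lam s, extExp Q₀ (M.condPrice X₁ X₂ p t) := by
  obtain ⟨hMs1, hMs2, hMs3⟩ := hMs
  have hMs' : Measurable Ms := hMs1.mono (M.𝓕.le s) le_rfl
  set m : Ω → ℝ≥0∞ := fun ω => ENNReal.ofReal (Ms ω) with hm
  have hmm : Measurable m := hMs'.ennreal_ofReal
  have hmQ : ∫⁻ ω, m ω ∂Q₀ ≠ ∞ := (hMs3 Q₀ hQ₀).lintegral_lt_top.ne
  have hmt : ∀ ω, m ω ≠ ∞ := fun ω => ENNReal.ofReal_ne_top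
  have hQ₀' := hQ₀
  obtain ⟨X₀, hX₀⟩ := hQ₀'
  have hX₀' : M.IsCPSloc M.lam s Q₀ X₀ := hX₀
  have hS := M.isEssSup_supPrice X₁ X₂ s t
  have hprice : ∀ p ∈ M.CPSloc M.lam s, M.condPrice X₁ X₂ p t =ᵐ[M.P] fun ω =>
      (M.raisedPrice X₁ X₂ Ms t p ω : EReal) - m ω := fun p hp =>
    Market.IsCPSloc.condPrice_ae_eq hst hX₁ hX₂ hMs1 hMs2 hbound hp
  have hge : ∀ p ∈ M.CPSloc M.lam s, ∀ᵐ ω ∂M.P, -(m ω : EReal) ≤ M.condPrice X₁ X₂ p t ω := by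
    intro p hp
    filter_upwards [hprice p hp] with ω hω
    rw [hω, sub_eq_add_neg]
    exact le_add_of_nonneg_left (EReal.coe_ennreal_nonneg _)
  have hexp : ∀ p ∈ M.CPSloc M.lam s, extExp Q₀ (M.condPrice X₁ X₂ p t) =
      ((∫⁻ ω, M.raisedPrice X₁ X₂ Ms t p ω ∂Q₀ : ℝ≥0∞) : EReal) -
        ((∫⁻ ω, m ω ∂Q₀ : ℝ≥0∞) : EReal) := fun p hp =>
    (extExp_congr_ae (hX₀'.ac.ae_le (hprice p hp))).trans
      (extExp_sub (measurable_condLExp' _ _ _) hmm hmt hmQ)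
  refine ⟨negPartIntegrable_of_le hmQ (hX₀'.ac.ae_le ?_), fun p hp =>
    negPartIntegrable_of_le hmQ (hX₀'.ac.ae_le (hge p hp)), le_antisymm ?_ (iSup₂_le fun p hp =>
      extExp_mono_ae (hX₀'.ac.ae_le (hS.le ⟨p, hp⟩)))⟩
  · filter_upwards [hge _ hX₀, hS.le ⟨_, hX₀⟩] with ω a1 a2 using a1.trans a2
  obtain ⟨h, h1, h2, h3⟩ := hM.exists_dominating hst hX₁ hX₂ hMs' hbound hQ₀ (t := t)
  have hle : M.supPrice X₁ X₂ s t ≤ᵐ[M.P] fun ω => (h ω : EReal) - m ω := by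
    refine hS.least _ ?_ fun p => ?_
    · simp only [sub_eq_add_neg]
      exact h1.coe_ereal_ennreal.add hmm.coe_ereal_ennreal.neg
    · filter_upwards [hprice p p.2, h2 p p.2] with ω a1 a2
      rw [a1]
      exact EReal.sub_le_sub (EReal.coe_ennreal_le_coe_ennreal_iff.2 a2) le_rfl
  refine (extExp_mono_ae (hX₀'.ac.ae_le hle)).trans ?_
  rw [extExp_sub h1 hmm hmt hmQ]
  have hmtop : ((∫⁻ ω, m ω ∂Q₀ : ℝ≥0∞) : EReal) ≠ ⊤ := by simpa using hmQ
  have hmbot : ((∫⁻ ω, m ω ∂Q₀ : ℝ≥0∞) : EReal) ≠ ⊥ := EReal.coe_ennreal_ne_bot _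
  rw [EReal.sub_le_iff_le_add (.inl hmbot) (.inl hmtop)]
  -- The supremum shifted back by the finite expectation of `Ms`; it bounds all raised expectations,
  -- which reduces the claim to an inequality in `ℝ≥0∞`.
  set K := (⨆ p ∈ M.CPSloc M.lam s, extExp Q₀ (M.condPrice X₁ X₂ p t)) +
    ((∫⁻ ω, m ω ∂Q₀ : ℝ≥0∞) : EReal) with hK
  have hpK : ∀ p ∈ M.CPSloc M.lam s,
      ((∫⁻ ω, M.raisedPrice X₁ X₂ Ms t p ω ∂Q₀ : ℝ≥0∞) : EReal) ≤ K := by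
    intro p hp
    rw [hK, ← EReal.sub_le_iff_le_add (.inl hmbot) (.inl hmtop), ← hexp p hp]
    exact le_iSup₂ (f := fun p (_ : p ∈ M.CPSloc M.lam s) => extExp Q₀ (M.condPrice X₁ X₂ p t)) p hp
  have hK0 : 0 ≤ K := (EReal.coe_ennreal_nonneg _).trans (hpK _ hX₀)
  have : ∫⁻ ω, h ω ∂Q₀ ≤ K.toENNReal := h3.trans (iSup₂_le fun p hp => by
    simpa using EReal.toENNReal_le_toENNReal (hpK p hp))
  rw [← EReal.coe_toENNReal hK0]
  exact EReal.coe_ennreal_le_coe_ennreal_iff.2 this
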